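/- Let $\mathcal N$ be a real nuclear space whose topology is generated by an increasing sequence of Hilbertian norms $|\cdot|_p$, $p\in\mathbb N_0$, such that for every $p$ there is $p'\ge p$ for which the canonical map $\mathcal H_{p'}\to\mathcal H_p$ of the completions is Hilbert–Schmidt. Let $\mathcal N'=\bigcup_p\mathcal H_{-p}$ be its dual, with the $\sigma$-algebra generated by the cylinder sets and with the dual norms $|\cdot|_{-p}$. A subscript $\mathbb C$ denotes complexification, $\langle\cdot,\cdot\rangle$ the complex bilinear pairing of $\mathcal N'_{\mathbb C}$ and $\mathcal N_{\mathbb C}$, and $\mathcal N_{\mathbb C}^{\hat\otimes n}$ the projective limit of the symmetric Hilbert tensor powers $\mathcal H_{p,\mathbb C}^{\hat\otimes n}$, whose norms are again written $|\cdot|_p$. Let $\mu$ be a probability measure on $\mathcal N'$ whose Laplace transform $l_\mu(\theta)=\int_{\mathcal N'}e^{\langle x,\theta\rangle}\,d\mu(x)$ exists and is holomorphic in a neighbourhood of $0\in\mathcal N_{\mathbb C}$. For $z\in\mathcal N'_{\mathbb C}$ let $P^\mu_n(z)\in(\mathcal N_{\mathbb C}^{\hat\otimes n})'$ be the continuous linear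 functionals with $$\frac{e^{\langle z,\theta\rangle}}{l_\mu(\theta)}=\sum_{n=0}^\infty\frac1{n!}\langle P^\mu_n(z),\theta^{\otimes n}\rangle\qquad(\theta\in\mathcal N_{\mathbb C}\text{ near }0).$$ Let $(\mathcal N)^1$ be the space of all series $\varphi=\sum_{n\ge0}\langle P^\mu_n,\varphi^{(n)}\rangle$, $\varphi^{(n)}\in\mathcal N_{\mathbb C}^{\hat\otimes n}$, for which $$\|\varphi\|_{p,q,\mu}^2=\sum_{n=0}^\infty(n!)^2\,2^{nq}\,|\varphi^{(n)}|_p^2$$ is finite for all $p,q\in\mathbb N_0$, with the topology given by these norms (that is, the projective limit of the completions of the continuous polynomials with respect to them). Let $\mathcal E^1_{\min}(\mathcal N'_{\mathbb C})$ be the space of all functions $F:\mathcal N'_{\mathbb C}\to\mathbb C$ that are entire on each $\mathcal H_{-p,\mathbb C}$ and satisfy $$\mathrm n_{p,l,1}(F)=\sup_{z\in\mathcal H_{-p,\mathbb C}}|F(z)|\exp(-2^{-l}|z|_{-p})<\infty\qquad\text{for all }p,l\in\mathbb N_0,$$ with the topology given by the norms $\mathrm n_{p,l,1}$. Then $P^\mu_n(z)$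 exists for all $n$ and $z$. For every $\varphi\in(\mathcal N)^1$ the series $\varphi(z)=\sum_n\langle P_n^\mu(z),\varphi^{(n)}\rangle$ converges for every $z\in\mathcal N'_{\mathbb C}$, the sequence $(\varphi^{(n)})_n$ is determined by the function $\varphi$ on $\mathcal N'$, and $x\mapsto\varphi(x+z)$ is $\mu$-integrable for every $z\in\mathcal N'_{\mathbb C}$. The convolution $$C_\mu\varphi(z)=\int_{\mathcal N'}\varphi(x+z)\,d\mu(x),\qquad z\in\mathcal N'_{\mathbb C},$$ is a topological isomorphism from $(\mathcal N)^1$ onto $\mathcal E^1_{\min}(\mathcal N'_{\mathbb C})$. Moreover, for all $p,q\in\mathbb N_0$, $$\Big(\sum_{n=0}^\infty(n!)^2\,2^{nq}\,|F^{(n)}|_p^2\Big)^{1/2}=\|\varphi\|_{p,q,\mu},\qquad F=C_\mu\varphi,$$ where $F^{(n)}$ is the $n$-th Taylor kernel of $F$ at $0$, i.e. $\langle z^{\otimes n},F^{(n)}\rangle=\frac1{n!}d^nF(0)(z,\dots,z)$. -/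

import Mathlib

open MeasureTheory
open scoped ENNReal

noncomputable section

namespace NonGaussian

/-! ## Auxiliary facts on `ℝ≥0∞`-valued norms -/

/-- A finite, subadditive and absolutely homogeneous `ℝ≥0∞`-valued function as a seminorm. -/
def seminormOf {E : Type*} [AddCommGroup E] [Module ℂ E] (ν : E → ℝ≥0∞)
    (hfin : ∀ x, ν x ≠ ∞) (hadd : ∀ x y, ν (x + y) ≤ ν x + ν y)
    (hsmul : ∀ (c : ℂ) x, ν (c • x) = ‖c‖ₑ * ν x) : Seminorm ℂ E :=
  Seminorm.of (fun x => (ν x).toReal)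
    (fun x y => by
      rw [← ENNReal.toReal_add (hfin x) (hfin y)]
      exact ENNReal.toReal_mono (ENNReal.add_ne_top.2 ⟨hfin x, hfin y⟩) (hadd x y))
    (fun c x => by
      simp only [hsmul, ENNReal.toReal_mul, toReal_enorm])

theorem l2_add_le {ι : Type*} (f g : ι → ℝ≥0∞) :
    (∑' i, (f i + g i) ^ (2 : ℝ)) ^ (1 / 2 : ℝ)
      ≤ (∑' i, f i ^ (2 : ℝ)) ^ (1 / 2 : ℝ) + (∑' i, g i ^ (2 : ℝ)) ^ (1 / 2 : ℝ) := by
  let _ : MeasurableSpace ι := ⊤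
  have h := ENNReal.lintegral_Lp_add_le (μ := Measure.count) (p := 2) (f := f) (g := g)
    (measurable_from_top).aemeasurable (measurable_from_top).aemeasurable (by norm_num)
  simpa only [lintegral_count, Pi.add_apply] using h

theorem l2_mul {ι : Type*} (c : ℝ≥0∞) (f : ι → ℝ≥0∞) :
    (∑' i, (c * f i) ^ (2 : ℝ)) ^ (1 / 2 : ℝ) = c * (∑' i, f i ^ (2 : ℝ)) ^ (1 / 2 : ℝ) := by
  simp_rw [ENNReal.mul_rpow_of_nonneg _ _ (show (0 : ℝ) ≤ 2 by norm_num)]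
  rw [ENNReal.tsum_mul_left, ENNReal.mul_rpow_of_nonneg _ _ (by norm_num), ← ENNReal.rpow_mul]
  norm_num

theorem l2_mono {ι : Type*} {f g : ι → ℝ≥0∞} (h : ∀ i, f i ≤ g i) :
    (∑' i, f i ^ (2 : ℝ)) ^ (1 / 2 : ℝ) ≤ (∑' i, g i ^ (2 : ℝ)) ^ (1 / 2 : ℝ) :=
  ENNReal.rpow_le_rpow
    (ENNReal.tsum_le_tsum fun i => ENNReal.rpow_le_rpow (h i) (by norm_num)) (by norm_num)

/-! ## The nuclear space, its dual, and complexifications -/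

/-- A real nuclear (countably Hilbert) space: the topology of `N` is generated by an increasing
sequence of Hilbertian norms `|·|_p`, the inner product of `|·|_p` being `form p`, such that for
every `p` there is `p' ≥ p` for which the canonical map `H_{p'} → H_p` between the completions
is a Hilbert–Schmidt operator. -/
structure NuclearNorms (N : Type*) [AddCommGroup N] [Module ℝ N] [TopologicalSpace N] where
  nrm : SeminormFamily ℝ N ℕ
  form : ℕ → LinearMap.BilinForm ℝ N
  form_symm : ∀ p ξ η, form p ξ η = form p η ξ
  nrm_sq : ∀ p ξ, nrm p ξ ^ 2 = form p ξ ξ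
  definite : ∀ p ξ, nrm p ξ = 0 → ξ = 0
  mono : ∀ p q, p ≤ q → ∀ ξ, nrm p ξ ≤ nrm q ξ
  hilbertSchmidt : ∀ p, ∃ p', p ≤ p' ∧ ∃ C : ℝ, ∀ (m : ℕ) (e : Fin m → N),
    (∀ i j, form p' (e i) (e j) = if i = j then 1 else 0) → ∑ i, nrm p (e i) ^ 2 ≤ C
  withSeminorms : WithSeminorms nrm

section Duals

variable {N : Type*} [AddCommGroup N] [Module ℝ N] [TopologicalSpace N]

/-- The dual `N'` carries the σ-algebra generated by the cylinder sets. -/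
instance cylinderSigmaAlgebra : MeasurableSpace (N →L[ℝ] ℝ) :=
  ⨆ ξ : N, MeasurableSpace.comap (fun x : N →L[ℝ] ℝ => x ξ) inferInstance

/-- The inclusion of `N'` into `N'_ℂ`, the latter being the space `N →L[ℝ] ℂ` of continuous
real-linear maps `N → ℂ`. -/
def toComplex (x : N →L[ℝ] ℝ) : N →L[ℝ] ℂ := Complex.ofRealCLM.comp x

/-- Elements of the complexification `N_ℂ` are pairs `θ = (ξ, η)`, meaning `ξ + iη`.
Multiplication by the complex scalar `t`. -/
def cmul (t : ℂ) (θ : N × N) : N × N := (t.re • θ.1 - t.im • θ.2, t.im • θ.1 + t.re • θ.2)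

/-- The complex bilinear dual pairing `⟨z, θ⟩` of `z ∈ N'_ℂ` and `θ ∈ N_ℂ`. -/
def pairing (z : N →L[ℝ] ℂ) (θ : N × N) : ℂ := z θ.1 + Complex.I * z θ.2

/-- Holomorphy on an open subset `U` of `N_ℂ`: Gâteaux holomorphic and locally bounded. -/
def HolomorphicOn (F : N × N → ℂ) (U : Set (N × N)) : Prop :=
  ∀ θ₀ ∈ U, (∀ θ : N × N, AnalyticAt ℂ (fun t : ℂ => F (θ₀ + cmul t θ)) 0) ∧
    ∃ V ∈ nhds θ₀, ∃ M : ℝ, ∀ θ ∈ V, ‖F θ‖ ≤ M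

/-- The Laplace transform `l_μ(θ) = ∫ exp⟨x, θ⟩ dμ(x)`, `θ ∈ N_ℂ`. -/
def laplace (μ : Measure (N →L[ℝ] ℝ)) (θ : N × N) : ℂ :=
  ∫ x, Complex.exp (pairing (toComplex x) θ) ∂μ

/-- The class `M_a(N')`: the Laplace transform exists and is holomorphic in an open neighbourhood
of zero in `N_ℂ`. -/
def IsAnalyticMeasure (μ : Measure (N →L[ℝ] ℝ)) : Prop :=
  ∃ U : Set (N × N), IsOpen U ∧ 0 ∈ U ∧
    (∀ θ ∈ U, Integrable (fun x => Complex.exp (pairing (toComplex x) θ)) μ) ∧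
    HolomorphicOn (laplace μ) U

/-- The `n`-linear form `v ↦ (1/n!) dⁿF(0)(v₁, …, vₙ)`, where
`dⁿF(0)(v₁, …, vₙ) = ∂ⁿ/∂t₁⋯∂tₙ F(t₁v₁ + ⋯ + tₙvₙ)` at `t = 0`. -/
def taylorForm (F : (N →L[ℝ] ℂ) → ℂ) (n : ℕ) (v : Fin n → (N →L[ℝ] ℂ)) : ℂ :=
  (n.factorial : ℂ)⁻¹ * iteratedFDeriv ℂ n (fun t : Fin n → ℂ => F (∑ i, t i • v i)) 0
    (fun i => Pi.single i 1)

end Duals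

namespace NuclearNorms

variable {N : Type*} [AddCommGroup N] [Module ℝ N] [TopologicalSpace N] (S : NuclearNorms N)

/-- The norm of `H_{p,ℂ}` on `N_ℂ`. -/
def cnorm (p : ℕ) (θ : N × N) : ℝ := √(S.nrm p θ.1 ^ 2 + S.nrm p θ.2 ^ 2)

/-- The dual norm `|z|_{-p}`; the space `H_{-p,ℂ}` consists of all `z ∈ N'_ℂ` for which it is
finite. -/
def dualNorm (p : ℕ) (z : N →L[ℝ] ℂ) : ℝ≥0∞ :=
  ⨆ (θ : N × N) (_ : S.cnorm p θ ≤ 1), ‖pairing z θ‖ₑ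

/-- A finite family in `H_{-p,ℂ}` is orthonormal iff `|∑ cᵢ fᵢ|² = ∑ |cᵢ|²` for all complex
coefficients (polarization). -/
def IsOrthonormal (p : ℕ) {m : ℕ} (f : Fin m → (N →L[ℝ] ℂ)) : Prop :=
  ∀ c : Fin m → ℂ, S.dualNorm p (∑ i, c i • f i) = ENNReal.ofReal √(∑ i, ‖c i‖ ^ 2)

/-! ## Kernels -/

/-- The Hilbert–Schmidt norm `|k|_p` of an `n`-linear form `k` on the Hilbert space `H_{-p,ℂ}`:
`|k|_p² = ∑ |k(f_{i₁}, …, f_{iₙ})|²` over an orthonormal basis, written as the supremum over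
finite orthonormal families. The `n`-linear Hilbert–Schmidt forms on `H_{-p,ℂ} = H_{p,ℂ}'`, with
this norm, are the Hilbert tensor power `H_{p,ℂ}^{⊗n}`. -/
def hsNorm (p : ℕ) {n : ℕ} (k : (Fin n → (N →L[ℝ] ℂ)) → ℂ) : ℝ≥0∞ :=
  ⨆ (m : ℕ) (f : Fin m → (N →L[ℝ] ℂ)) (_ : S.IsOrthonormal p f),
    (∑' i : Fin n → Fin m, ‖k (fun j => f (i j))‖ₑ ^ (2 : ℝ)) ^ (1 / 2 : ℝ)

theorem hsNorm_add_le (p : ℕ) {n : ℕ} (k l : (Fin n → (N →L[ℝ] ℂ)) → ℂ) :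
    S.hsNorm p (k + l) ≤ S.hsNorm p k + S.hsNorm p l := by
  refine iSup_le fun m => iSup_le fun f => iSup_le fun hf => ?_
  refine (l2_mono fun i => enorm_add_le _ _).trans ((l2_add_le _ _).trans ?_)
  refine add_le_add ?_ ?_ <;> exact le_iSup_of_le m (le_iSup_of_le f (le_iSup_of_le hf le_rfl))

theorem hsNorm_smul (p : ℕ) {n : ℕ} (c : ℂ) (k : (Fin n → (N →L[ℝ] ℂ)) → ℂ) :
    S.hsNorm p (c • k) = ‖c‖ₑ * S.hsNorm p k := by
  simp only [hsNorm, ENNReal.mul_iSup, Pi.smul_apply, smul_eq_mul, enorm_mul, l2_mul]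

/-- The symmetric tensor power `N_ℂ^{⊗̂n}`, the projective limit of the symmetric Hilbert tensor
powers of `H_{p,ℂ}`: symmetric `n`-linear forms on `N'_ℂ = ⋃ₚ H_{-p,ℂ}` that are Hilbert–Schmidt
on every `H_{-p,ℂ}`. The pairing `⟨z^{⊗n}, k⟩` is `k (z, …, z)`. -/
def SymKernel (n : ℕ) : Submodule ℂ (MultilinearMap ℂ (fun _ : Fin n => N →L[ℝ] ℂ) ℂ) where
  carrier := {k | (∀ (σ : Equiv.Perm (Fin n)) (v : Fin n → (N →L[ℝ] ℂ)), k (v ∘ σ) = k v) ∧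
    ∀ p, S.hsNorm p k ≠ ∞}
  zero_mem' := by
    refine ⟨fun _ _ => rfl, fun p => ?_⟩
    have h := S.hsNorm_smul p 0 (0 : (Fin n → (N →L[ℝ] ℂ)) → ℂ)
    rw [zero_smul, enorm_zero, zero_mul] at h
    have h' : S.hsNorm p (⇑(0 : MultilinearMap ℂ (fun _ : Fin n => N →L[ℝ] ℂ) ℂ)) = 0 := h
    rw [h']
    exact ENNReal.zero_ne_top
  add_mem' := by
    intro a b ha hb
    refine ⟨fun σ v => ?_, fun p => ?_⟩
    · rw [add_apply, add_apply, ha.1, hb.1]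
    · exact ne_top_of_le_ne_top (ENNReal.add_ne_top.2 ⟨ha.2 p, hb.2 p⟩) (S.hsNorm_add_le p a b)
  smul_mem' := by
    intro c a ha
    refine ⟨fun σ v => ?_, fun p => ?_⟩
    · rw [smul_apply, smul_apply, ha.1]
    · have h : S.hsNorm p (⇑(c • a)) = ‖c‖ₑ * S.hsNorm p a := S.hsNorm_smul p c a
      rw [h]
      exact ENNReal.mul_ne_top enorm_ne_top (ha.2 p)

theorem cnorm_smul (p : ℕ) {r : ℝ} (hr : 0 ≤ r) (θ : N × N) :
    S.cnorm p (r • θ) = r * S.cnorm p θ := by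
  simp only [cnorm, Prod.smul_fst, Prod.smul_snd, map_smul_eq_mul, Real.norm_eq_abs, mul_pow,
    sq_abs]
  rw [← mul_add, Real.sqrt_mul (sq_nonneg r), Real.sqrt_sq hr]

theorem enorm_pairing_le (p : ℕ) (z : N →L[ℝ] ℂ) (θ : N × N) :
    ‖pairing z θ‖ₑ ≤ S.dualNorm p z * ENNReal.ofReal (S.cnorm p θ) := by
  have hr : 0 ≤ S.cnorm p θ := Real.sqrt_nonneg _
  rcases hr.eq_or_lt with h | h
  · have h0 : S.nrm p θ.1 ^ 2 + S.nrm p θ.2 ^ 2 = 0 :=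
      (Real.sqrt_eq_zero (by positivity)).1 h.symm
    have h1 : S.nrm p θ.1 = 0 := by nlinarith [sq_nonneg (S.nrm p θ.1), sq_nonneg (S.nrm p θ.2)]
    have h2 : S.nrm p θ.2 = 0 := by nlinarith [sq_nonneg (S.nrm p θ.1), sq_nonneg (S.nrm p θ.2)]
    simp [pairing, S.definite p _ h1, S.definite p _ h2]
  · have h1 : S.cnorm p ((S.cnorm p θ)⁻¹ • θ) ≤ 1 := by
      rw [S.cnorm_smul p (inv_nonneg.2 h.le), inv_mul_cancel₀ h.ne']
    have h2 : pairing z θ = (S.cnorm p θ : ℂ) * pairing z ((S.cnorm p θ)⁻¹ • θ) := by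
      have h3 : (S.cnorm p θ : ℂ) ≠ 0 := by exact_mod_cast h.ne'
      simp only [pairing, Prod.smul_fst, Prod.smul_snd, map_smul, Complex.real_smul,
        Complex.ofReal_inv]
      field_simp
    have h4 : ‖(S.cnorm p θ : ℂ)‖ₑ = ENNReal.ofReal (S.cnorm p θ) := by
      rw [← ofReal_norm, Complex.norm_real, Real.norm_of_nonneg h.le]
    rw [h2, enorm_mul, h4, mul_comm]
    gcongr
    exact le_iSup₂_of_le (f := fun (θ : N × N) (_ : S.cnorm p θ ≤ 1) => ‖pairing z θ‖ₑ) _ h1 le_rfl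

theorem pairing_add (y z : N →L[ℝ] ℂ) (θ : N × N) :
    pairing (y + z) θ = pairing y θ + pairing z θ := by
  simp only [pairing, add_apply]; ring

theorem pairing_smul (c : ℂ) (z : N →L[ℝ] ℂ) (θ : N × N) :
    pairing (c • z) θ = c * pairing z θ := by
  simp only [pairing, smul_apply, smul_eq_mul]; ring

theorem pairing_sum {m : ℕ} (c : Fin m → ℂ) (f : Fin m → (N →L[ℝ] ℂ)) (θ : N × N) :
    pairing (∑ i, c i • f i) θ = ∑ i, c i * pairing (f i) θ := by
  let L : (N →L[ℝ] ℂ) →ₗ[ℂ] ℂ :=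
    { toFun := fun z => pairing z θ
      map_add' := fun y z => pairing_add y z θ
      map_smul' := fun c z => pairing_smul c z θ }
  have h : L (∑ i, c i • f i) = ∑ i, c i * L (f i) := by simp
  exact h

theorem bessel (p : ℕ) {m : ℕ} {f : Fin m → (N →L[ℝ] ℂ)} (hf : S.IsOrthonormal p f) (θ : N × N) :
    ∑ i, ‖pairing (f i) θ‖ ^ 2 ≤ S.cnorm p θ ^ 2 := by
  set s : ℝ := ∑ i, ‖pairing (f i) θ‖ ^ 2 with hs
  have hs0 : 0 ≤ s := Finset.sum_nonneg fun i _ => by positivity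
  have hr0 : 0 ≤ S.cnorm p θ := Real.sqrt_nonneg _
  have h := S.enorm_pairing_le p (∑ i, (starRingEnd ℂ) (pairing (f i) θ) • f i) θ
  rw [hf, pairing_sum, ← ENNReal.ofReal_mul (Real.sqrt_nonneg _)] at h
  have h1 : ∑ i, (starRingEnd ℂ) (pairing (f i) θ) * pairing (f i) θ = (s : ℂ) := by
    rw [hs, Complex.ofReal_sum]
    exact Finset.sum_congr rfl fun i _ => by rw [Complex.conj_mul', Complex.ofReal_pow]
  rw [h1, ← ofReal_norm, Complex.norm_real, Real.norm_of_nonneg hs0,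
    ENNReal.ofReal_le_ofReal_iff (by positivity)] at h
  simp only [RCLike.norm_conj, ← hs] at h
  have h2 := Real.sq_sqrt hs0
  rcases (Real.sqrt_nonneg s).eq_or_lt with h3 | h3
  · rw [← h3] at h2
    nlinarith [sq_nonneg (S.cnorm p θ)]
  · have h4 : √s ≤ S.cnorm p θ := by
      refine le_of_mul_le_mul_left ?_ h3
      nlinarith
    rw [← h2]
    exact pow_le_pow_left₀ h3.le h4 2

/-- The `n`-linear form `(z₁, …, zₙ) ↦ ∏ ⟨zᵢ, θ⟩`. -/
def powForm (n : ℕ) (θ : N × N) : MultilinearMap ℂ (fun _ : Fin n => N →L[ℝ] ℂ) ℂ :=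
  (MultilinearMap.mkPiAlgebra ℂ (Fin n) ℂ).compLinearMap fun _ =>
    { toFun := fun z => pairing z θ
      map_add' := fun y z => pairing_add y z θ
      map_smul' := fun c z => pairing_smul c z θ }

theorem powForm_apply (n : ℕ) (θ : N × N) (v : Fin n → (N →L[ℝ] ℂ)) :
    powForm n θ v = ∏ i, pairing (v i) θ := rfl

theorem powForm_mem (n : ℕ) (θ : N × N) : powForm n θ ∈ S.SymKernel n := by
  refine ⟨fun σ v => ?_, fun p => ?_⟩
  · simp only [powForm_apply, Function.comp_apply]
    exact Equiv.prod_comp σ fun i => pairing (v i) θ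
  · refine ne_top_of_le_ne_top (b := ENNReal.ofReal ((S.cnorm p θ ^ 2) ^ n) ^ (1 / 2 : ℝ)) ?_ ?_
    · exact (ENNReal.rpow_lt_top_of_nonneg (by norm_num) ENNReal.ofReal_ne_top).ne
    · refine iSup_le fun m => iSup_le fun f => iSup_le fun hf => ?_
      refine ENNReal.rpow_le_rpow ?_ (by norm_num)
      have h : ∀ i : Fin n → Fin m, ‖powForm n θ (fun j => f (i j))‖ₑ ^ (2 : ℝ)
          = ENNReal.ofReal (∏ j, ‖pairing (f (i j)) θ‖ ^ 2) := by
        intro i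
        rw [powForm_apply, ← ofReal_norm, norm_prod, Finset.prod_pow]
        norm_cast
        rw [ENNReal.ofReal_pow (by positivity)]
      rw [tsum_fintype, Finset.sum_congr rfl fun i _ => h i,
        ← ENNReal.ofReal_sum_of_nonneg fun i _ => by positivity]
      refine ENNReal.ofReal_le_ofReal ?_
      rw [← Fintype.sum_pow (fun i => ‖pairing (f i) θ‖ ^ 2) n]
      exact pow_le_pow_left₀ (Finset.sum_nonneg fun i _ => by positivity) (S.bessel p hf θ) n

/-- The kernel `θ^{⊗n}` of `N_ℂ^{⊗̂n}`. -/
def powKernel (n : ℕ) (θ : N × N) : S.SymKernel n := ⟨powForm n θ, S.powForm_mem n θ⟩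

/-! ## The `P^μ`-system -/

/-- `P` is the generalized Appell kernel `P_n^μ(z) ∈ (N_ℂ^{⊗̂n})'`: the continuous linear
functional on `N_ℂ^{⊗̂n}` given by the Taylor coefficients at `0` of the `μ`-exponential
`e_μ(θ; z) = exp⟨z, θ⟩ / l_μ(θ) = ∑ (1/n!) ⟨P_n^μ(z), θ^{⊗n}⟩`. -/
def IsAppell (μ : Measure (N →L[ℝ] ℝ)) (n : ℕ) (z : N →L[ℝ] ℂ) (P : S.SymKernel n →ₗ[ℂ] ℂ) :
    Prop :=
  (∃ (p : ℕ) (C : ℝ), ∀ k : S.SymKernel n, ‖P k‖ ≤ C * (S.hsNorm p k.1).toReal) ∧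
  ∀ θ : N × N, P (S.powKernel n θ) =
    iteratedDeriv n (fun t : ℂ => Complex.exp (t * pairing z θ) / laplace μ (cmul t θ)) 0

/-- The Appell kernel `P_n^μ(z)`. -/
def appell (μ : Measure (N →L[ℝ] ℝ)) (n : ℕ) (z : N →L[ℝ] ℂ) : S.SymKernel n →ₗ[ℂ] ℂ :=
  Classical.epsilon (S.IsAppell μ n z)

/-! ## Test functions -/

/-- The weighted norm `(∑ₙ (n!)² 2^{nq} |kₙ|_p²)^{1/2}` of a sequence of `n`-linear forms. -/
def seqNorm (p q : ℕ) (k : ∀ n, (Fin n → (N →L[ℝ] ℂ)) → ℂ) : ℝ≥0∞ :=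
  (∑' n, (n.factorial : ℝ≥0∞) ^ 2 * 2 ^ (n * q) * S.hsNorm p (k n) ^ 2) ^ (1 / 2 : ℝ)

theorem seqNorm_eq (p q : ℕ) (k : ∀ n, (Fin n → (N →L[ℝ] ℂ)) → ℂ) :
    S.seqNorm p q k = (∑' n, ((n.factorial : ℝ≥0∞) * 2 ^ (((n * q : ℕ) : ℝ) * (1 / 2)) *
      S.hsNorm p (k n)) ^ (2 : ℝ)) ^ (1 / 2 : ℝ) := by
  unfold seqNorm
  congr 2
  ext n
  rw [ENNReal.mul_rpow_of_nonneg _ _ (by norm_num), ENNReal.mul_rpow_of_nonneg _ _ (by norm_num),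
    ← ENNReal.rpow_mul, mul_assoc ((n * q : ℕ) : ℝ), show (1 / 2 : ℝ) * 2 = 1 by norm_num, mul_one,
    ENNReal.rpow_natCast]
  norm_cast

theorem seqNorm_add_le (p q : ℕ) (k l : ∀ n, (Fin n → (N →L[ℝ] ℂ)) → ℂ) :
    S.seqNorm p q (k + l) ≤ S.seqNorm p q k + S.seqNorm p q l := by
  simp only [seqNorm_eq]
  refine (l2_mono fun n => ?_).trans (l2_add_le _ _)
  rw [← mul_add]
  gcongr
  exact S.hsNorm_add_le p (k n) (l n)

theorem seqNorm_smul (p q : ℕ) (c : ℂ) (k : ∀ n, (Fin n → (N →L[ℝ] ℂ)) → ℂ) :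
    S.seqNorm p q (c • k) = ‖c‖ₑ * S.seqNorm p q k := by
  simp only [seqNorm_eq, ← l2_mul, Pi.smul_apply, hsNorm_smul]
  congr 2
  ext n
  ring_nf

/-- The test function space `(N)^1_μ`. The completion of the polynomials
`φ = ∑ ⟨P_n^μ, φ^{(n)}⟩` (finite sums) with respect to all the norms
`‖φ‖²_{p,q,μ} = ∑ (n!)² 2^{nq} |φ^{(n)}|_p²` consists of the series
`φ = ∑ ⟨P_n^μ, φ^{(n)}⟩` with `φ^{(n)} ∈ N_ℂ^{⊗̂n}` for which all these norms are finite.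
An element is stored as the sequence of its kernels, so that `μ` enters through the
function `testFun` which the element represents. -/
def TestSpace (_μ : Measure (N →L[ℝ] ℝ)) : Submodule ℂ (∀ n, S.SymKernel n) where
  carrier := {φ | ∀ p q, S.seqNorm p q (fun n => (φ n).1) ≠ ∞}
  zero_mem' := by
    intro p q
    have h := S.seqNorm_smul p q 0 0
    rw [zero_smul, enorm_zero, zero_mul] at h
    have h' : S.seqNorm p q (fun n => ((0 : ∀ n, S.SymKernel n) n).1) = 0 := h
    rw [h']
    exact ENNReal.zero_ne_top
  add_mem' := by
    intro a b ha hb p q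
    exact ne_top_of_le_ne_top (ENNReal.add_ne_top.2 ⟨ha p q, hb p q⟩)
      (S.seqNorm_add_le p q (fun n => (a n).1) (fun n => (b n).1))
  smul_mem' := by
    intro c a ha p q
    have h : S.seqNorm p q (fun n => ((c • a) n).1) = ‖c‖ₑ * S.seqNorm p q (fun n => (a n).1) :=
      S.seqNorm_smul p q c (fun n => (a n).1)
    rw [h]
    exact ENNReal.mul_ne_top enorm_ne_top (ha p q)

variable {μ : Measure (N →L[ℝ] ℝ)}

/-- The function on `N'_ℂ` represented by a test function, `φ(z) = ∑ ⟨P_n^μ(z), φ^{(n)}⟩`. -/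
def testFun (φ : S.TestSpace μ) (z : N →L[ℝ] ℂ) : ℂ := ∑' n, S.appell μ n z (φ.1 n)

/-- The norm `‖φ‖_{p,q,μ}`. -/
def testNorm (p q : ℕ) (φ : S.TestSpace μ) : ℝ≥0∞ := S.seqNorm p q fun n => (φ.1 n).1

/-- The norms `‖·‖_{p,q,μ}` as seminorms. -/
def testSeminorms : SeminormFamily ℂ (S.TestSpace μ) (ℕ × ℕ) := fun pq =>
  seminormOf (S.testNorm pq.1 pq.2) (fun φ => φ.2 pq.1 pq.2)
    (fun φ ψ => S.seqNorm_add_le pq.1 pq.2 (fun n => (φ.1 n).1) (fun n => (ψ.1 n).1))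
    (fun c φ => S.seqNorm_smul pq.1 pq.2 c (fun n => (φ.1 n).1))

/-- The projective limit topology, generated by all norms `‖·‖_{p,q,μ}`. -/
instance : TopologicalSpace (S.TestSpace μ) := S.testSeminorms.moduleFilterBasis.topology

/-- The topology on `S.TestSpace μ` found by instance search is the one above. -/
theorem testSpace_withSeminorms : WithSeminorms (S.testSeminorms (μ := μ)) := ⟨rfl⟩

/-- The convolution `C_μ φ(z) = ∫_{N'} φ(x + z) dμ(x)`. -/
def conv (φ : S.TestSpace μ) (z : N →L[ℝ] ℂ) : ℂ := ∫ x, S.testFun φ (toComplex x + z) ∂μ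

/-! ## Entire functions of growth one and minimal type -/

/-- `F` is an entire function on the Hilbert space `H_{-p,ℂ}`: Gâteaux entire and locally
bounded. -/
def IsEntireOn (p : ℕ) (F : (N →L[ℝ] ℂ) → ℂ) : Prop :=
  (∀ z w, S.dualNorm p z ≠ ∞ → S.dualNorm p w ≠ ∞ →
    Differentiable ℂ fun t : ℂ => F (z + t • w)) ∧
  ∀ z, S.dualNorm p z ≠ ∞ → ∃ r : ℝ, 0 < r ∧ ∃ M : ℝ,
    ∀ w, S.dualNorm p w ≤ ENNReal.ofReal r → ‖F (z + w)‖ ≤ M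

/-- The norm `n_{p,l,1}(F) = sup |F(z)| exp(-2^{-l} |z|_{-p})` over `z ∈ H_{-p,ℂ}`. -/
def growthNorm (p l : ℕ) (F : (N →L[ℝ] ℂ) → ℂ) : ℝ≥0∞ :=
  ⨆ (z : N →L[ℝ] ℂ) (_ : S.dualNorm p z ≠ ∞),
    ‖F z‖ₑ * ENNReal.ofReal (Real.exp (-((2 : ℝ)⁻¹ ^ l * (S.dualNorm p z).toReal)))

theorem growthNorm_add_le (p l : ℕ) (F G : (N →L[ℝ] ℂ) → ℂ) :
    S.growthNorm p l (F + G) ≤ S.growthNorm p l F + S.growthNorm p l G := by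
  refine iSup_le fun z => iSup_le fun hz => ?_
  refine (mul_le_mul_left (enorm_add_le (F z) (G z)) _).trans ?_
  rw [add_mul]
  exact add_le_add (le_iSup_of_le z (le_iSup_of_le hz le_rfl))
    (le_iSup_of_le z (le_iSup_of_le hz le_rfl))

theorem growthNorm_smul (p l : ℕ) (c : ℂ) (F : (N →L[ℝ] ℂ) → ℂ) :
    S.growthNorm p l (c • F) = ‖c‖ₑ * S.growthNorm p l F := by
  simp only [growthNorm, ENNReal.mul_iSup, Pi.smul_apply, smul_eq_mul, enorm_mul, mul_assoc]

/-- The space `E^1_min(N'_ℂ)`, the projective limit over `p, l` of the spaces of entire functions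
on `H_{-p,ℂ}` of growth `1` and type `2^{-l}`. -/
def EMin : Submodule ℂ ((N →L[ℝ] ℂ) → ℂ) where
  carrier := {F | (∀ p, S.IsEntireOn p F) ∧ ∀ p l, S.growthNorm p l F ≠ ∞}
  zero_mem' := by
    refine ⟨fun p => ⟨fun z w _ _ => differentiable_const 0,
      fun z _ => ⟨1, one_pos, 0, fun w _ => by simp⟩⟩, fun p l => ?_⟩
    have h := S.growthNorm_smul p l 0 0
    rw [zero_smul, enorm_zero, zero_mul] at h
    rw [h]
    exact ENNReal.zero_ne_top
  add_mem' := by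
    intro F G hF hG
    refine ⟨fun p => ⟨fun z w hz hw => ((hF.1 p).1 z w hz hw).add ((hG.1 p).1 z w hz hw),
      fun z hz => ?_⟩, fun p l => ?_⟩
    · obtain ⟨r, hr, M, hM⟩ := (hF.1 p).2 z hz
      obtain ⟨r', hr', M', hM'⟩ := (hG.1 p).2 z hz
      refine ⟨min r r', lt_min hr hr', M + M', fun w hw => ?_⟩
      refine (norm_add_le _ _).trans (add_le_add (hM w (hw.trans ?_)) (hM' w (hw.trans ?_)))
      · exact ENNReal.ofReal_le_ofReal (min_le_left _ _)
      · exact ENNReal.ofReal_le_ofReal (min_le_right _ _)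
    · exact ne_top_of_le_ne_top (ENNReal.add_ne_top.2 ⟨hF.2 p l, hG.2 p l⟩)
        (S.growthNorm_add_le p l F G)
  smul_mem' := by
    intro c F hF
    refine ⟨fun p => ⟨fun z w hz hw => ((hF.1 p).1 z w hz hw).const_mul c, fun z hz => ?_⟩,
      fun p l => ?_⟩
    · obtain ⟨r, hr, M, hM⟩ := (hF.1 p).2 z hz
      refine ⟨r, hr, ‖c‖ * M, fun w hw => ?_⟩
      rw [Pi.smul_apply, norm_smul]
      exact mul_le_mul_of_nonneg_left (hM w hw) (norm_nonneg c)
    · rw [S.growthNorm_smul]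
      exact ENNReal.mul_ne_top enorm_ne_top (hF.2 p l)

/-- The norms `n_{p,l,1}` as seminorms. -/
def growthSeminorms : SeminormFamily ℂ S.EMin (ℕ × ℕ) := fun pl =>
  seminormOf (fun F => S.growthNorm pl.1 pl.2 F.1) (fun F => F.2.2 pl.1 pl.2)
    (fun F G => S.growthNorm_add_le pl.1 pl.2 F.1 G.1)
    (fun c F => S.growthNorm_smul pl.1 pl.2 c F.1)

/-- The projective limit topology, generated by all norms `n_{p,l,1}`. -/
instance : TopologicalSpace S.EMin := S.growthSeminorms.moduleFilterBasis.topology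

/-- The topology on `S.EMin` found by instance search is the one above. -/
theorem eMin_withSeminorms : WithSeminorms S.growthSeminorms := ⟨rfl⟩

/-- The norm `|||F|||_{p,q,1} = (∑ (n!)² 2^{nq} |F^{(n)}|_p²)^{1/2}`, where the kernels `F^{(n)}`
are the Taylor coefficients of `F` at zero. -/
def kernelNorm (p q : ℕ) (F : S.EMin) : ℝ≥0∞ := S.seqNorm p q (taylorForm F.1)

end NuclearNorms

end NonGaussian

end

open NonGaussian

/-! The convolution turns `⟨P_n^μ(z), k⟩` into the homogeneous polynomial `⟨z^{⊗n}, k⟩`. Hence `C_μ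
φ` is the entire function whose Taylor kernels at `0` are exactly the kernels `φ^{(n)}`, and the
norm identity is immediate. What remains is to justify this formula and to compare kernel norms with
growth norms.

Exponential moments. Local boundedness of `l_μ` at `0`, the Hilbert–Schmidt property and the
convexity of `u ↦ cosh √u` give `p₀`, `ε > 0` and `K` with `∫ exp(ε |x|_{-p}) dμ(x) ≤ K` for all `p
≥ p₀` (`exists_expMoment`). So `C_μ` acts on functions of growth `exp(ε |z|_{-p})` and multiplies
the constant in such a bound by at most `K`.

Appell kernels. Formally, `C_μ` maps `f(t) exp(t⟨z, θ⟩)` to `f(t) l_μ(tθ) exp(t⟨z, θ⟩)`. Since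
`l_μ(0) = 1`, the operator `1 - C_μ` raises the order of `f` at `t = 0`, that is, it lowers the
degree in `z` of the coefficient of `tⁿ`. On polynomials of degree `n` the Neumann series `∑ (1 -
C_μ)^r` therefore stops at `r = n` and inverts `C_μ`. Applied to `⟨z^{⊗n}, k⟩` it constructs
`⟨P_n^μ(z), k⟩`, with the bound `|k|_p n! cⁿ exp(ε |z|_{-p})` (`ExpMoment.expBound_appellMap`).
Uniqueness holds because finite-rank approximation makes the powers `ξ^{⊗n}`, `ξ ∈ N`, determine
every bounded functional on kernels (`eq_zero_of_powKernel`).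

The convolution. The weights `(n!)² 2^{nq}`, for all `q`, absorb `n! cⁿ`, so the series for `φ`
converges, is dominated by an integrable function and may be integrated termwise
(`ExpMoment.hasSum_conv`). Summing `|φ^{(n)}|_p |z|_{-p}ⁿ` gives the growth bounds and the
continuity of `C_μ`.

The inverse. For `F` of minimal type, Cauchy's estimates on circles of radius `2^l`, polarization,
and the passage from bounded to Hilbert–Schmidt forms bound `|F^{(n)}|_p` by `(C 2^{-l})ⁿ / n!`
times a growth norm (`exists_hsNorm_taylorKernel_le`). With `l` large this controls every weighted
norm, so `F ↦ (F^{(n)})` is the continuous inverse.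

Values on `N'` suffice to determine `φ`: they determine `C_μ φ` on `N'`, hence everywhere by the
identity theorem, hence all its Taylor kernels. -/

namespace NonGaussian

namespace NuclearNorms

variable {N : Type*} [AddCommGroup N] [Module ℝ N] [TopologicalSpace N] (S : NuclearNorms N)

/-! ## Elementary properties of the dual norms -/

theorem pairing_ofReal (z : N →L[ℝ] ℂ) (ξ : N) : pairing z (ξ, 0) = z ξ := by
  simp [pairing]

theorem cnorm_nonneg (p : ℕ) (θ : N × N) : 0 ≤ S.cnorm p θ := Real.sqrt_nonneg _

theorem cnorm_ofReal (p : ℕ) (ξ : N) : S.cnorm p (ξ, 0) = S.nrm p ξ := by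
  simp [cnorm, Real.sqrt_sq (apply_nonneg (S.nrm p) ξ)]

theorem cnorm_mono {p q : ℕ} (h : p ≤ q) (θ : N × N) : S.cnorm p θ ≤ S.cnorm q θ := by
  unfold cnorm
  have h1 := S.mono p q h
  have h2 := fun ξ => apply_nonneg (S.nrm p) ξ
  gcongr <;> simp only [h1]

theorem norm_pairing_le (p : ℕ) {z : N →L[ℝ] ℂ} (hz : S.dualNorm p z ≠ ∞) (θ : N × N) :
    ‖pairing z θ‖ ≤ (S.dualNorm p z).toReal * S.cnorm p θ := by
  have h := ENNReal.toReal_mono (ENNReal.mul_ne_top hz ENNReal.ofReal_ne_top)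
    (S.enorm_pairing_le p z θ)
  rwa [toReal_enorm, ENNReal.toReal_mul, ENNReal.toReal_ofReal (S.cnorm_nonneg p θ)] at h

theorem dualNorm_le_ofReal (p : ℕ) {z : N →L[ℝ] ℂ} {A : ℝ} (hA : 0 ≤ A)
    (h : ∀ θ, ‖pairing z θ‖ ≤ A * S.cnorm p θ) : S.dualNorm p z ≤ ENNReal.ofReal A := by
  refine iSup₂_le fun θ hθ => ?_
  rw [← ofReal_norm]
  exact ENNReal.ofReal_le_ofReal ((h θ).trans (mul_le_of_le_one_right hA hθ))

theorem dualNorm_anti {p q : ℕ} (h : p ≤ q) (z : N →L[ℝ] ℂ) :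
    S.dualNorm q z ≤ S.dualNorm p z :=
  iSup₂_le fun θ hθ => le_iSup₂_of_le (f := fun (θ : N × N) (_ : S.cnorm p θ ≤ 1) =>
    ‖pairing z θ‖ₑ) θ ((S.cnorm_mono h θ).trans hθ) le_rfl

theorem dualNorm_add_le (p : ℕ) (y z : N →L[ℝ] ℂ) :
    S.dualNorm p (y + z) ≤ S.dualNorm p y + S.dualNorm p z := by
  refine iSup₂_le fun θ hθ => ?_
  rw [pairing_add]
  refine (enorm_add_le _ _).trans (add_le_add ?_ ?_) <;>
  exact le_iSup₂_of_le (f := fun (θ : N × N) (_ : S.cnorm p θ ≤ 1) => ‖pairing _ θ‖ₑ) θ hθ le_rfl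

theorem dualNorm_smul (p : ℕ) (c : ℂ) (z : N →L[ℝ] ℂ) :
    S.dualNorm p (c • z) = ‖c‖ₑ * S.dualNorm p z := by
  simp only [dualNorm, ENNReal.mul_iSup, pairing_smul, enorm_mul]

theorem dualNorm_zero (p : ℕ) : S.dualNorm p 0 = 0 := by
  refine le_antisymm ?_ zero_le
  simpa using S.dualNorm_le_ofReal p (z := 0) le_rfl fun θ => by simp [pairing]

theorem dualNorm_sum_le (p : ℕ) {ι : Type*} (s : Finset ι) (z : ι → (N →L[ℝ] ℂ)) :
    S.dualNorm p (∑ i ∈ s, z i) ≤ ∑ i ∈ s, S.dualNorm p (z i) := by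
  classical
  induction s using Finset.induction_on with
  | empty => simp [dualNorm_zero]
  | insert a s ha ih =>
    rw [Finset.sum_insert ha, Finset.sum_insert ha]
    exact (S.dualNorm_add_le p _ _).trans (add_le_add_right ih _)

theorem add_ne_top' {p : ℕ} {y z : N →L[ℝ] ℂ} (hy : S.dualNorm p y ≠ ∞)
    (hz : S.dualNorm p z ≠ ∞) : S.dualNorm p (y + z) ≠ ∞ :=
  ne_top_of_le_ne_top (ENNReal.add_ne_top.2 ⟨hy, hz⟩) (S.dualNorm_add_le p y z)

theorem smul_ne_top' {p : ℕ} (c : ℂ) {z : N →L[ℝ] ℂ} (hz : S.dualNorm p z ≠ ∞) :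
    S.dualNorm p (c • z) ≠ ∞ := by
  rw [dualNorm_smul]; exact ENNReal.mul_ne_top enorm_ne_top hz

theorem toReal_dualNorm_add_le (p : ℕ) {y z : N →L[ℝ] ℂ} (hy : S.dualNorm p y ≠ ∞)
    (hz : S.dualNorm p z ≠ ∞) : (S.dualNorm p (y + z)).toReal ≤
      (S.dualNorm p y).toReal + (S.dualNorm p z).toReal := by
  rw [← ENNReal.toReal_add hy hz]
  exact ENNReal.toReal_mono (ENNReal.add_ne_top.2 ⟨hy, hz⟩) (S.dualNorm_add_le p y z)

theorem toReal_dualNorm_smul (p : ℕ) (c : ℂ) (z : N →L[ℝ] ℂ) :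
    (S.dualNorm p (c • z)).toReal = ‖c‖ * (S.dualNorm p z).toReal := by
  rw [dualNorm_smul, ENNReal.toReal_mul, toReal_enorm]

theorem eq_zero_of_dualNorm (p : ℕ) {z : N →L[ℝ] ℂ} (h : S.dualNorm p z = 0) : z = 0 := by
  ext ξ
  have h1 := S.norm_pairing_le p (z := z) (by simp [h]) (ξ, 0)
  rw [pairing_ofReal, h] at h1
  simpa using h1

/-- Continuity estimates come with a finite supremum of the norms; as the norms increase, a single
norm replaces it. -/
theorem sup_nrm_le (s : Finset ℕ) : ∃ p, ∀ q, p ≤ q → ∀ ξ, s.sup S.nrm ξ ≤ S.nrm q ξ := by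
  refine ⟨s.sup id, fun q hq ξ => ?_⟩
  exact Seminorm.finset_sup_apply_le (apply_nonneg _ _) fun i hi =>
    S.mono i q ((Finset.le_sup (f := id) hi).trans hq) ξ

theorem exists_norm_le (z : N →L[ℝ] ℂ) : ∃ p, ∃ C : ℝ, 0 ≤ C ∧ ∀ ξ, ‖z ξ‖ ≤ C * S.nrm p ξ := by
  obtain ⟨s, C, -, hC⟩ := Seminorm.bound_of_continuous S.withSeminorms
    ((normSeminorm ℝ ℂ).comp (z : N →ₗ[ℝ] ℂ)) (z.continuous.norm)
  obtain ⟨p, hp⟩ := S.sup_nrm_le s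
  refine ⟨p, C, C.2, fun ξ => (hC ξ).trans ?_⟩
  exact mul_le_mul_of_nonneg_left (hp p le_rfl ξ) C.2

theorem dualNorm_ne_top_of_norm_le (p : ℕ) {z : N →L[ℝ] ℂ} {C : ℝ} (hC : 0 ≤ C)
    (h : ∀ ξ, ‖z ξ‖ ≤ C * S.nrm p ξ) : S.dualNorm p z ≠ ∞ := by
  refine ne_top_of_le_ne_top (b := ENNReal.ofReal (C * 2)) ENNReal.ofReal_ne_top
    (S.dualNorm_le_ofReal p (by positivity) fun θ => ?_)
  have h1 : S.nrm p θ.1 ≤ S.cnorm p θ := Real.le_sqrt_of_sq_le (by nlinarith [sq_nonneg (S.nrm p θ.2)])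
  have h2 : S.nrm p θ.2 ≤ S.cnorm p θ := Real.le_sqrt_of_sq_le (by nlinarith [sq_nonneg (S.nrm p θ.1)])
  calc ‖pairing z θ‖ ≤ ‖z θ.1‖ + ‖Complex.I * z θ.2‖ := norm_add_le _ _
    _ = ‖z θ.1‖ + ‖z θ.2‖ := by simp
    _ ≤ C * S.cnorm p θ + C * S.cnorm p θ := by
        gcongr
        · exact (h _).trans (by gcongr)
        · exact (h _).trans (by gcongr)
    _ = C * 2 * S.cnorm p θ := by ring

/-- This is `N'_ℂ = ⋃ H_{-p,ℂ}`. All larger indices are included so that finitely many vectors, and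
lower bounds such as `p₀ ≤ p`, can be accommodated by one index. -/
theorem exists_dualNorm_ne_top (z : N →L[ℝ] ℂ) : ∃ p, ∀ q, p ≤ q → S.dualNorm q z ≠ ∞ := by
  obtain ⟨p, C, hC, h⟩ := S.exists_norm_le z
  exact ⟨p, fun q hq => ne_top_of_le_ne_top (S.dualNorm_ne_top_of_norm_le p hC h)
    (S.dualNorm_anti hq z)⟩

theorem exists_forall_dualNorm_ne_top {ι : Type*} [Finite ι] (z : ι → (N →L[ℝ] ℂ)) :
    ∃ p, ∀ q, p ≤ q → ∀ i, S.dualNorm q (z i) ≠ ∞ := by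
  cases nonempty_fintype ι
  choose p hp using fun i => S.exists_dualNorm_ne_top (z i)
  exact ⟨Finset.univ.sup p, fun q hq i => hp i q ((Finset.le_sup (Finset.mem_univ i)).trans hq)⟩

/-! ## Finite-rank approximation of the canonical maps -/

theorem form_self_nonneg (p : ℕ) (ξ : N) : 0 ≤ S.form p ξ ξ := by
  rw [← S.nrm_sq]; positivity

/-- The orthogonal projection onto the span of a finite orthonormal family. -/
def proj (p : ℕ) {m : ℕ} (e : Fin m → N) : N →ₗ[ℝ] N :=
  ∑ i, (S.form p (e i)).smulRight (e i)

theorem proj_apply (p : ℕ) {m : ℕ} (e : Fin m → N) (ξ : N) :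
    S.proj p e ξ = ∑ i, S.form p (e i) ξ • e i := by
  simp [proj]

theorem form_sub_proj (p : ℕ) {m : ℕ} {e : Fin m → N}
    (he : ∀ i j, S.form p (e i) (e j) = if i = j then 1 else 0) (ξ : N) (i : Fin m) :
    S.form p (e i) (ξ - S.proj p e ξ) = 0 := by
  simp [proj_apply, he]

/-- Pythagoras: the residual `ξ - proj ξ` is orthogonal to every `e i`, hence to `proj ξ`. -/
theorem nrm_sq_eq_add (p : ℕ) {m : ℕ} {e : Fin m → N}
    (he : ∀ i j, S.form p (e i) (e j) = if i = j then 1 else 0) (ξ : N) :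
    S.nrm p ξ ^ 2 = S.nrm p (S.proj p e ξ) ^ 2 + S.nrm p (ξ - S.proj p e ξ) ^ 2 := by
  have h0 : S.form p (S.proj p e ξ) (ξ - S.proj p e ξ) = 0 := by
    have h2 := S.form_sub_proj p he ξ
    generalize ξ - S.proj p e ξ = η at h2 ⊢
    simp [S.proj_apply, h2]
  have h1 : ξ = S.proj p e ξ + (ξ - S.proj p e ξ) := by abel
  conv_lhs => rw [h1, S.nrm_sq]
  rw [LinearMap.map_add₂, map_add, map_add, h0,
    S.form_symm p (ξ - S.proj p e ξ) (S.proj p e ξ), h0,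
    S.nrm_sq, S.nrm_sq]
  ring

theorem nrm_proj_le (p : ℕ) {m : ℕ} {e : Fin m → N}
    (he : ∀ i j, S.form p (e i) (e j) = if i = j then 1 else 0) (ξ : N) :
    S.nrm p (S.proj p e ξ) ≤ S.nrm p ξ := by
  refine le_of_sq_le_sq ?_ (apply_nonneg _ _)
  rw [S.nrm_sq_eq_add p he ξ]; nlinarith [sq_nonneg (S.nrm p (ξ - S.proj p e ξ))]

theorem nrm_sub_proj_le (p : ℕ) {m : ℕ} {e : Fin m → N}
    (he : ∀ i j, S.form p (e i) (e j) = if i = j then 1 else 0) (ξ : N) :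
    S.nrm p (ξ - S.proj p e ξ) ≤ S.nrm p ξ := by
  refine le_of_sq_le_sq ?_ (apply_nonneg _ _)
  rw [S.nrm_sq_eq_add p he ξ]; nlinarith [sq_nonneg (S.nrm p (S.proj p e ξ))]

/-- The canonical map `H_{p'} → H_p`, being Hilbert–Schmidt, is approximated in operator norm by
its restriction to the span of a finite orthonormal family. -/
theorem exists_proj_approx (p : ℕ) : ∃ p', p ≤ p' ∧ ∀ δ : ℝ, 0 < δ → ∃ (m : ℕ) (e : Fin m → N),
    (∀ i j, S.form p' (e i) (e j) = if i = j then 1 else 0) ∧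
      ∀ ξ, S.nrm p (ξ - S.proj p' e ξ) ≤ δ * S.nrm p' ξ := by
  obtain ⟨p', hpp, C, hC⟩ := S.hilbertSchmidt p
  refine ⟨p', hpp, fun δ hδ => ?_⟩
  let A : Set ℝ := {s | ∃ (m : ℕ) (e : Fin m → N),
    (∀ i j, S.form p' (e i) (e j) = if i = j then 1 else 0) ∧ s = ∑ i, S.nrm p (e i) ^ 2}
  have hbdd : BddAbove A := ⟨C, by rintro _ ⟨m, e, he, rfl⟩; exact hC m e he⟩
  have hne : A.Nonempty := ⟨0, 0, Fin.elim0, fun i => i.elim0, by simp⟩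
  -- The family `e` comes within `δ²` of the supremum of all Hilbert–Schmidt sums. A `p'`-unit
  -- vector `u` orthogonal to `e` can be adjoined to it, so its contribution `|u|_p²` must stay
  -- below `δ²`.
  obtain ⟨_, ⟨m, e, he, rfl⟩, hlt⟩ := exists_lt_of_lt_csSup hne
    (show sSup A - δ ^ 2 < sSup A by nlinarith [sq_pos_of_pos hδ])
  refine ⟨m, e, he, fun ξ => ?_⟩
  set η := ξ - S.proj p' e ξ with hη
  rcases (apply_nonneg (S.nrm p') η).eq_or_lt with h0 | h0
  · rw [S.definite p' η h0.symm, map_zero]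
    exact mul_nonneg hδ.le (apply_nonneg _ _)
  · set u := (S.nrm p' η)⁻¹ • η with hu
    have huu : S.form p' u u = 1 := by
      rw [hu, LinearMap.map_smul₂, map_smul, ← S.nrm_sq]
      simp only [smul_eq_mul]; field_simp
    have heu : ∀ i, S.form p' (e i) u = 0 := fun i => by
      rw [hu, map_smul, hη, S.form_sub_proj p' he, smul_zero]
    have hmem : S.nrm p u ^ 2 + ∑ i, S.nrm p (e i) ^ 2 ∈ A := by
      refine ⟨m + 1, Fin.cons u e, fun i j => ?_, by simp [Fin.sum_univ_succ]⟩
      refine Fin.cases ?_ (fun i => ?_) i <;> refine Fin.cases ?_ (fun j => ?_) j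
      · simp [huu]
      · simp [S.form_symm p' u, heu, (Fin.succ_ne_zero j).symm]
      · simp [heu]
      · simp [he]
    have h1 : S.nrm p u ^ 2 < δ ^ 2 := by linarith [le_csSup hbdd hmem]
    have h2 : S.nrm p u < δ := lt_of_pow_lt_pow_left₀ 2 hδ.le h1
    have h3 : S.nrm p u = (S.nrm p' η)⁻¹ * S.nrm p η := by
      rw [hu, map_smul_eq_mul, Real.norm_of_nonneg (by positivity)]
    rw [h3, inv_mul_lt_iff₀ h0] at h2
    calc S.nrm p η ≤ S.nrm p' η * δ := h2.le
      _ ≤ δ * S.nrm p' ξ := by rw [mul_comm]; gcongr; exact S.nrm_sub_proj_le p' he ξ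

end NuclearNorms

end NonGaussian

/-! ### Gram–Schmidt orthonormalization -/

namespace NonGaussian

/-- Gram–Schmidt for a positive definite bilinear form: a sequence with the same span whose
members are pairwise orthogonal and are zero or normalized. -/
theorem exists_orthonormal_sequence {E : Type*} [AddCommGroup E] [Module ℝ E]
    (B : LinearMap.BilinForm ℝ E) (hs : ∀ x y, B x y = B y x) (hn : ∀ x, 0 ≤ B x x)
    (hd : ∀ x, B x x = 0 → x = 0) (g : ℕ → E) :
    ∃ e : ℕ → E, (∀ i j, i ≠ j → B (e i) (e j) = 0) ∧ (∀ i, e i ≠ 0 → B (e i) (e i) = 1) ∧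
      Submodule.span ℝ (Set.range e) = Submodule.span ℝ (Set.range g) := by
  -- The inner product structure is introduced only locally, to make the normalized Gram–Schmidt
  -- process available. Linearly dependent members of `g` yield zeros, which are kept in the
  -- sequence.
  let core : InnerProductSpace.Core ℝ E :=
    { inner := fun x y => B x y
      conj_inner_symm := fun x y => hs y x
      re_inner_nonneg := hn
      add_left := fun x y z => by simp
      smul_left := fun x y r => by simp
      definite := hd }
  let _ : NormedAddCommGroup E := core.toNormedAddCommGroup
  let _ : InnerProductSpace ℝ E := InnerProductSpace.ofCore core.toCore
  let e := InnerProductSpace.gramSchmidtNormed ℝ g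
  have ho := InnerProductSpace.gramSchmidtNormed_orthonormal' (𝕜 := ℝ) g
  refine ⟨e, fun i j hij => ?_, fun i hi => ?_,
    InnerProductSpace.span_gramSchmidtNormed_range (𝕜 := ℝ) g |>.trans
      (InnerProductSpace.span_gramSchmidt ℝ g)⟩
  · by_cases hi : e i = 0
    · simp [hi]
    by_cases hj : e j = 0
    · simp [hj]
    exact ho.2 (i := ⟨i, hi⟩) (j := ⟨j, hj⟩) (fun h => hij (congrArg Subtype.val h))
  · have h1 : ‖e i‖ = 1 := ho.1 ⟨i, hi⟩
    have h2 : inner ℝ (e i) (e i) = ‖e i‖ ^ 2 := real_inner_self_eq_norm_sq (e i)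
    rw [h1, one_pow] at h2
    exact h2

namespace NuclearNorms

variable {N : Type*} [AddCommGroup N] [Module ℝ N] [TopologicalSpace N] (S : NuclearNorms N)

/-! ## Separability and orthonormal sequences -/

/-- A nuclear space is separable: some sequence spans a dense subspace. -/
theorem exists_dense_sequence : ∃ g : ℕ → N, ∀ p ξ, ∀ δ : ℝ, 0 < δ →
    ∃ η ∈ Submodule.span ℝ (Set.range g), S.nrm p (ξ - η) < δ := by
  choose p' _ h using S.exists_proj_approx
  choose m e he hap using fun p n : ℕ => h p (1 / ((n : ℝ) + 1)) (by positivity)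
  -- The finite families approximating `H_{p'} → H_p` with accuracy `1 / (n + 1)`, for all `p` and
  -- `n`, together form a countable set. Adjoining `0` makes it non-empty, so that it is the range
  -- of a sequence.
  let D : Set N := insert 0 (⋃ p, ⋃ n, Set.range (e p n))
  have hD : D.Countable := by
    refine Set.Countable.insert _ (Set.countable_iUnion fun p => Set.countable_iUnion fun n =>
      Set.countable_range _)
  obtain ⟨g, hg⟩ := hD.exists_eq_range ⟨0, Set.mem_insert _ _⟩
  refine ⟨g, fun p ξ δ hδ => ?_⟩
  obtain ⟨n, hn⟩ := exists_nat_gt (S.nrm (p' p) ξ / δ)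
  refine ⟨S.proj (p' p) (e p n) ξ, ?_, (hap p n ξ).trans_lt ?_⟩
  · rw [← hg, S.proj_apply]
    refine Submodule.sum_mem _ fun i _ => Submodule.smul_mem _ _ (Submodule.subset_span ?_)
    exact Set.mem_insert_of_mem _ (Set.mem_iUnion_of_mem p (Set.mem_iUnion_of_mem n ⟨i, rfl⟩))
  · rw [div_lt_iff₀ hδ] at hn
    rw [one_div, inv_mul_lt_iff₀ (by positivity)]
    nlinarith

/-- For every `p` there is a total sequence in `N` consisting of pairwise `p`-orthogonal vectors
that are zero or `p`-normalized. -/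
theorem exists_total_sequence (p : ℕ) : ∃ e : ℕ → N,
    (∀ i j, i ≠ j → S.form p (e i) (e j) = 0) ∧ (∀ i, e i ≠ 0 → S.form p (e i) (e i) = 1) ∧
    ∀ q ξ, ∀ δ : ℝ, 0 < δ → ∃ η ∈ Submodule.span ℝ (Set.range e), S.nrm q (ξ - η) < δ := by
  obtain ⟨g, hg⟩ := S.exists_dense_sequence
  obtain ⟨e, h1, h2, h3⟩ := exists_orthonormal_sequence (S.form p) (S.form_symm p)
    (S.form_self_nonneg p) (fun x hx => S.definite p x (by
      have := S.nrm_sq p x; rw [hx] at this; exact pow_eq_zero_iff (two_ne_zero) |>.1 this)) g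
  exact ⟨e, h1, h2, fun q ξ δ hδ => by rw [h3]; exact hg q ξ δ hδ⟩

/-- A total `p`-orthonormal sequence, possibly interspersed with zeros. -/
noncomputable def basis (p : ℕ) : ℕ → N := (S.exists_total_sequence p).choose

theorem basis_orthogonal (p : ℕ) {i j : ℕ} (h : i ≠ j) :
    S.form p (S.basis p i) (S.basis p j) = 0 := (S.exists_total_sequence p).choose_spec.1 i j h

theorem basis_normalized (p : ℕ) {i : ℕ} (h : S.basis p i ≠ 0) :
    S.form p (S.basis p i) (S.basis p i) = 1 := (S.exists_total_sequence p).choose_spec.2.1 i h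

theorem basis_dense (p q : ℕ) (ξ : N) {δ : ℝ} (hδ : 0 < δ) :
    ∃ η ∈ Submodule.span ℝ (Set.range (S.basis p)), S.nrm q (ξ - η) < δ :=
  (S.exists_total_sequence p).choose_spec.2.2 q ξ δ hδ

/-- A finite set of members of the basis sequence, without the zeros, listed as an orthonormal
family. -/
theorem exists_family (p m : ℕ) : ∃ (k : ℕ) (e : Fin k → N),
    (∀ i j, S.form p (e i) (e j) = if i = j then 1 else 0) ∧ (∀ i, ∃ j, e i = S.basis p j) ∧
    ∀ f : N → ℝ, f 0 = 0 → ∑ j ∈ Finset.range m, f (S.basis p j) = ∑ i, f (e i) := by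
  classical
  let s := (Finset.range m).filter fun j => S.basis p j ≠ 0
  refine ⟨s.card, fun i => S.basis p (s.equivFin.symm i), fun i j => ?_, fun i => ⟨_, rfl⟩,
    fun f hf => ?_⟩
  · split_ifs with h
    · subst h
      exact S.basis_normalized p (Finset.mem_filter.1 (s.equivFin.symm i).2).2
    · exact S.basis_orthogonal p fun h' => h (s.equivFin.symm.injective (Subtype.ext h'))
  · rw [Equiv.sum_comp s.equivFin.symm (fun j : s => f (S.basis p j)),
      Finset.sum_coe_sort s (fun j => f (S.basis p j)), Finset.sum_filter]
    refine Finset.sum_congr rfl fun j _ => ?_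
    split_ifs with h
    · rfl
    · rw [not_not.1 h, hf]

/-! ### Parseval's identity for the dual norms -/

theorem sum_norm_sq_le (p m : ℕ) (z : N →L[ℝ] ℂ) (hz : S.dualNorm p z ≠ ∞) :
    ∑ j ∈ Finset.range m, ‖z (S.basis p j)‖ ^ 2 ≤ (S.dualNorm p z).toReal ^ 2 := by
  obtain ⟨k, e, he, -, hsum⟩ := S.exists_family p m
  rw [hsum (fun ξ => ‖z ξ‖ ^ 2) (by simp)]
  set s : ℝ := ∑ i, ‖z (e i)‖ ^ 2 with hs
  have hs0 : 0 ≤ s := Finset.sum_nonneg fun i _ => by positivity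
  -- The test vector is `∑ conj(z(eᵢ)) eᵢ`: it has pairing `s` with `z` and norm `√s`, so `s ≤
  -- |z|_{-p} √s`.
  let θ : N × N := (∑ i, (z (e i)).re • e i, -∑ i, (z (e i)).im • e i)
  have h1 : pairing z θ = s := by
    simp only [pairing, θ, map_neg, map_sum, map_smul, Complex.real_smul, hs, Complex.ofReal_sum,
      Finset.mul_sum, mul_neg, ← sub_eq_add_neg, ← Finset.sum_sub_distrib]
    refine Finset.sum_congr rfl fun i _ => ?_
    rw [← Complex.normSq_eq_norm_sq, Complex.normSq_eq_conj_mul_self]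
    conv_rhs => rw [← Complex.re_add_im ((starRingEnd ℂ) (z (e i)))]
    simp only [Complex.conj_re, Complex.conj_im, Complex.ofReal_neg]
    ring
  have h2 : ∀ c : Fin k → ℝ, S.nrm p (∑ i, c i • e i) ^ 2 = ∑ i, c i ^ 2 := fun c => by
    rw [S.nrm_sq]; simp [he, sq]
  have h3 : S.cnorm p θ = √s := by
    simp only [cnorm, θ, map_neg_eq_map, h2, ← Finset.sum_add_distrib, hs]
    congr 1
    refine Finset.sum_congr rfl fun i _ => ?_
    rw [← Complex.normSq_eq_norm_sq, Complex.normSq_apply]; ring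
  have h4 := S.norm_pairing_le p hz θ
  rw [h1, h3, Complex.norm_real, Real.norm_of_nonneg hs0] at h4
  have h5 := Real.sq_sqrt hs0
  rcases (Real.sqrt_nonneg s).eq_or_lt with h6 | h6
  · rw [← h5, ← h6, zero_pow two_ne_zero]; positivity
  · rw [← h5]
    refine pow_le_pow_left₀ h6.le (le_of_mul_le_mul_right ?_ h6) 2
    nlinarith

theorem basis_eq_zero_or (p j : ℕ) :
    S.basis p j = 0 ∨ S.form p (S.basis p j) (S.basis p j) = 1 := by
  by_cases h : S.basis p j = 0
  · exact Or.inl h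
  · exact Or.inr (S.basis_normalized p h)

/-- Where the basis sequence is zero the coefficient `c j` cannot be recovered; multiplying by the
basis vector makes the formula hold there too. -/
theorem form_basis_sum (p m : ℕ) (c : ℕ → ℝ) (j : ℕ) (hj : j < m) :
    S.form p (S.basis p j) (∑ i ∈ Finset.range m, c i • S.basis p i) • S.basis p j
      = c j • S.basis p j := by
  rw [map_sum, Finset.sum_eq_single_of_mem j (Finset.mem_range.2 hj)]
  · rcases S.basis_eq_zero_or p j with h | h
    · rw [h, smul_zero, smul_zero]
    · rw [map_smul, h, smul_eq_mul, mul_one]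
  · intro i _ hi
    rw [map_smul, S.basis_orthogonal p hi.symm, smul_zero]

/-- Holding for all large `m`, the expansion can be used for two vectors with a common `m`. -/
theorem eventually_eq_sum_basis (p : ℕ) {ξ : N}
    (hξ : ξ ∈ Submodule.span ℝ (Set.range (S.basis p))) :
    ∃ M, ∀ m, M ≤ m →
      ξ = ∑ j ∈ Finset.range m, S.form p (S.basis p j) ξ • S.basis p j := by
  obtain ⟨c, rfl⟩ := (Finsupp.mem_span_range_iff_exists_finsupp).1 hξ
  refine ⟨c.support.sup id + 1, fun m hm => ?_⟩
  have h : (c.sum fun i a => a • S.basis p i) = ∑ j ∈ Finset.range m, c j • S.basis p j := by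
    refine Finset.sum_subset (fun j hj => ?_) fun j _ hj => ?_
    · exact Finset.mem_range.2
        ((Nat.lt_succ_of_le (Finset.le_sup (f := id) hj)).trans_le hm)
    · simp only [Finsupp.notMem_support_iff.1 hj, zero_smul]
  rw [h]
  exact Finset.sum_congr rfl fun j hj => (S.form_basis_sum p m c j (Finset.mem_range.1 hj)).symm

theorem nrm_sq_sum_basis (p m : ℕ) (ξ : N)
    (h : ξ = ∑ j ∈ Finset.range m, S.form p (S.basis p j) ξ • S.basis p j) :
    ∑ j ∈ Finset.range m, S.form p (S.basis p j) ξ ^ 2 = S.nrm p ξ ^ 2 := by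
  rw [S.nrm_sq]
  refine Eq.trans ?_ (congrArg (fun η => S.form p η ξ) h).symm
  simp [sq]

theorem cnorm_le_add (p : ℕ) (θ θ' : N × N) {δ : ℝ} (hδ : 0 ≤ δ)
    (h1 : S.nrm p (θ.1 - θ'.1) ≤ δ) (h2 : S.nrm p (θ.2 - θ'.2) ≤ δ) :
    S.cnorm p θ' ≤ S.cnorm p θ + 2 * δ := by
  have h3 : ∀ a b : N, S.nrm p (a - b) ≤ δ → S.nrm p b ≤ S.nrm p a + δ := fun a b h => by
    have := map_sub_le_add (S.nrm p) a (a - b)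
    rw [sub_sub_cancel] at this
    linarith
  have h4 := h3 _ _ h1
  have h5 := h3 _ _ h2
  have p1 := apply_nonneg (S.nrm p) θ.1
  have p2 := apply_nonneg (S.nrm p) θ.2
  have p3 := apply_nonneg (S.nrm p) θ'.1
  have p4 := apply_nonneg (S.nrm p) θ'.2
  have h6 : S.nrm p θ.1 ≤ S.cnorm p θ := Real.le_sqrt_of_sq_le (by nlinarith)
  have h7 : S.nrm p θ.2 ≤ S.cnorm p θ := Real.le_sqrt_of_sq_le (by nlinarith)
  have h8 : S.cnorm p θ ^ 2 = S.nrm p θ.1 ^ 2 + S.nrm p θ.2 ^ 2 := Real.sq_sqrt (by positivity)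
  refine Real.sqrt_le_iff.2 ⟨by linarith, ?_⟩
  nlinarith [mul_le_mul_of_nonneg_right h6 hδ, mul_le_mul_of_nonneg_right h7 hδ,
    pow_le_pow_left₀ p3 h4 2, pow_le_pow_left₀ p4 h5 2]

/-- On the span of the basis this is Cauchy–Schwarz. It extends to all of `N` by density, but `z` is
not known in advance to be continuous for `|·|_p`: it is bounded by some `|·|_{q₀}`, so the
approximation is made in the norm with index `max p q₀`. -/
theorem dualNorm_le_of_sum_le (p : ℕ) (z : N →L[ℝ] ℂ) {A : ℝ} (hA : 0 ≤ A)
    (h : ∀ m, ∑ j ∈ Finset.range m, ‖z (S.basis p j)‖ ^ 2 ≤ A ^ 2) :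
    S.dualNorm p z ≤ ENNReal.ofReal A := by
  have key : ∀ ξ ∈ Submodule.span ℝ (Set.range (S.basis p)),
      ∀ η ∈ Submodule.span ℝ (Set.range (S.basis p)),
      ‖pairing z (ξ, η)‖ ≤ A * S.cnorm p (ξ, η) := by
    intro ξ hξ η hη
    obtain ⟨M, hM⟩ := S.eventually_eq_sum_basis p hξ
    obtain ⟨M', hM'⟩ := S.eventually_eq_sum_basis p hη
    set m := max M M'
    have e1 := hM m (le_max_left _ _)
    have e2 := hM' m (le_max_right _ _)
    have n1 := S.nrm_sq_sum_basis p m ξ e1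
    have n2 := S.nrm_sq_sum_basis p m η e2
    set a := fun j => S.form p (S.basis p j) ξ
    set b := fun j => S.form p (S.basis p j) η
    have h1 : pairing z (ξ, η)
        = ∑ j ∈ Finset.range m, z (S.basis p j) * ((a j : ℂ) + b j * Complex.I) := by
      simp only [pairing]
      rw [e1, e2, map_sum, map_sum, Finset.mul_sum, ← Finset.sum_add_distrib]
      refine Finset.sum_congr rfl fun j _ => ?_
      rw [map_smul, map_smul, Complex.real_smul, Complex.real_smul]
      simp only [a, b]
      ring
    have h2 : ∀ j, ‖(a j : ℂ) + b j * Complex.I‖ ^ 2 = a j ^ 2 + b j ^ 2 := fun j => by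
      rw [← Complex.normSq_eq_norm_sq, Complex.normSq_add_mul_I]
    have h3 : ‖pairing z (ξ, η)‖ ^ 2 ≤ A ^ 2 * (S.cnorm p (ξ, η)) ^ 2 := by
      rw [h1, show S.cnorm p (ξ, η) ^ 2 = S.nrm p ξ ^ 2 + S.nrm p η ^ 2 from
        Real.sq_sqrt (by positivity), ← n1, ← n2, ← Finset.sum_add_distrib]
      calc _ ≤ (∑ j ∈ Finset.range m,
              ‖z (S.basis p j)‖ * ‖(a j : ℂ) + b j * Complex.I‖) ^ 2 := by
            gcongr
            exact (norm_sum_le _ _).trans (Finset.sum_le_sum fun j _ => norm_mul_le _ _)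
        _ ≤ (∑ j ∈ Finset.range m, ‖z (S.basis p j)‖ ^ 2) *
              ∑ j ∈ Finset.range m, ‖(a j : ℂ) + b j * Complex.I‖ ^ 2 :=
            Finset.sum_mul_sq_le_sq_mul_sq _ _ _
        _ ≤ _ := by
            simp only [h2]
            exact mul_le_mul_of_nonneg_right (h m)
              (Finset.sum_nonneg fun j _ => by positivity)
    rw [← mul_pow] at h3
    exact le_of_sq_le_sq h3 (mul_nonneg hA (S.cnorm_nonneg _ _))
  refine S.dualNorm_le_ofReal p hA fun θ => ?_
  obtain ⟨q₀, C, hC, hz⟩ := S.exists_norm_le z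
  refine le_of_forall_pos_le_add fun ε hε => ?_
  -- The replacement of `θ` costs `2Aδ` through `cnorm_le_add` and `2Cδ` through the continuity of
  -- `z`; this `δ` keeps the total below `ε`.
  obtain ⟨ξ, hξ, h1⟩ := S.basis_dense p (max p q₀) θ.1 (δ := ε / (2 * A + 2 * C + 1)) (by positivity)
  obtain ⟨η, hη, h2⟩ := S.basis_dense p (max p q₀) θ.2 (δ := ε / (2 * A + 2 * C + 1)) (by positivity)
  set δ := ε / (2 * A + 2 * C + 1) with hδ
  have hδ0 : 0 < δ := by positivity
  have h3 : (2 * A + 2 * C) * δ ≤ ε := by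
    have : (2 * A + 2 * C + 1) * δ = ε := by rw [hδ]; field_simp
    linarith
  have h4 := S.cnorm_le_add p θ (ξ, η) hδ0.le ((S.mono _ _ (le_max_left p q₀) _).trans h1.le)
    ((S.mono _ _ (le_max_left p q₀) _).trans h2.le)
  have h5 : pairing z θ = pairing z (ξ, η) + (z (θ.1 - ξ) + Complex.I * z (θ.2 - η)) := by
    simp only [pairing, map_sub]; ring
  have h6 : ‖z (θ.1 - ξ)‖ ≤ C * δ := (hz _).trans
    (mul_le_mul_of_nonneg_left ((S.mono _ _ (le_max_right p q₀) _).trans h1.le) hC)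
  have h7 : ‖z (θ.2 - η)‖ ≤ C * δ := (hz _).trans
    (mul_le_mul_of_nonneg_left ((S.mono _ _ (le_max_right p q₀) _).trans h2.le) hC)
  have h8 : ‖z (θ.1 - ξ) + Complex.I * z (θ.2 - η)‖ ≤ C * δ + C * δ := by
    refine (norm_add_le _ _).trans (add_le_add h6 ?_)
    rw [norm_mul, Complex.norm_I, one_mul]; exact h7
  rw [h5]
  have h9 := key ξ hξ η hη
  have h10 := norm_add_le (pairing z (ξ, η)) (z (θ.1 - ξ) + Complex.I * z (θ.2 - η))
  have h11 := mul_le_mul_of_nonneg_left h4 hA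
  nlinarith

/-- Parseval's identity for the dual norm. -/
theorem dualNorm_sq_eq (p : ℕ) (z : N →L[ℝ] ℂ) :
    S.dualNorm p z ^ 2 = ∑' j, ‖z (S.basis p j)‖ₑ ^ 2 := by
  have hsum : ∀ m, ∑ j ∈ Finset.range m, ‖z (S.basis p j)‖ₑ ^ 2
      = ENNReal.ofReal (∑ j ∈ Finset.range m, ‖z (S.basis p j)‖ ^ 2) := fun m => by
    rw [ENNReal.ofReal_sum_of_nonneg fun _ _ => by positivity]
    exact Finset.sum_congr rfl fun j _ => by
      rw [← ofReal_norm, ENNReal.ofReal_pow (norm_nonneg _)]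
  refine le_antisymm ?_ ?_
  · by_cases ht : ∑' j, ‖z (S.basis p j)‖ₑ ^ 2 = ∞
    · rw [ht]; exact le_top
    set s := (∑' j, ‖z (S.basis p j)‖ₑ ^ 2).toReal with hs
    have hs0 : 0 ≤ s := ENNReal.toReal_nonneg
    have h := S.dualNorm_le_of_sum_le p z (Real.sqrt_nonneg s) fun m => by
      rw [Real.sq_sqrt hs0, ← ENNReal.ofReal_le_ofReal_iff hs0, ← hsum, hs,
        ENNReal.ofReal_toReal ht]
      exact ENNReal.sum_le_tsum _
    calc _ ≤ ENNReal.ofReal √s ^ 2 := by gcongr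
      _ = _ := by
        rw [← ENNReal.ofReal_pow (Real.sqrt_nonneg s), Real.sq_sqrt hs0, ENNReal.ofReal_toReal ht]
  · by_cases ht : S.dualNorm p z = ∞
    · rw [ht]; simp
    rw [ENNReal.tsum_eq_iSup_nat]
    refine iSup_le fun m => ?_
    rw [hsum, ← ENNReal.ofReal_toReal ht, ← ENNReal.ofReal_pow ENNReal.toReal_nonneg]
    exact ENNReal.ofReal_le_ofReal (S.sum_norm_sq_le p m z ht)

/-! ### Hilbert–Schmidt estimates for inclusions and multilinear forms -/

theorem exists_sum_basis_le (p : ℕ) : ∃ p', p ≤ p' ∧ ∃ C : ℝ, 0 < C ∧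
    ∀ m, ∑ j ∈ Finset.range m, S.nrm p (S.basis p' j) ^ 2 ≤ C := by
  obtain ⟨p', hp, C, hC⟩ := S.hilbertSchmidt p
  -- The maximum with `1` makes the constant strictly positive.
  refine ⟨p', hp, max C 1, by positivity, fun m => ?_⟩
  obtain ⟨k, e, he, -, hsum⟩ := S.exists_family p' m
  rw [hsum (fun ξ => S.nrm p ξ ^ 2) (by simp)]
  exact (hC k e he).trans (le_max_left _ _)

/-- The adjoint inclusion `H_{-p} → H_{-p'}` is Hilbert–Schmidt. -/
theorem exists_sum_dualNorm_le (p : ℕ) : ∃ p', p ≤ p' ∧ ∃ C : ℝ, 0 < C ∧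
    ∀ (m : ℕ) (f : Fin m → (N →L[ℝ] ℂ)), S.IsOrthonormal p f →
      ∑ i, S.dualNorm p' (f i) ^ 2 ≤ ENNReal.ofReal C := by
  obtain ⟨p', hp, C, hC0, hC⟩ := S.exists_sum_basis_le p
  refine ⟨p', hp, C, hC0, fun m f hf => ?_⟩
  -- Parseval turns the claim into a double sum of `|fᵢ(eⱼ)|²`. Bessel's inequality bounds the sum
  -- over `i` by `|eⱼ|_p²`, and the sum of these over `j` is a Hilbert–Schmidt sum.
  simp_rw [dualNorm_sq_eq]
  rw [← Summable.tsum_finsetSum fun i _ => ENNReal.summable, ENNReal.tsum_eq_iSup_nat]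
  refine iSup_le fun k => ?_
  have h : ∀ j, ∑ i, ‖f i (S.basis p' j)‖ₑ ^ 2 ≤ ENNReal.ofReal (S.nrm p (S.basis p' j) ^ 2) := by
    intro j
    have h1 := S.bessel p hf (S.basis p' j, 0)
    simp only [pairing_ofReal, cnorm_ofReal] at h1
    refine le_trans (le_of_eq ?_) (ENNReal.ofReal_le_ofReal h1)
    rw [ENNReal.ofReal_sum_of_nonneg fun _ _ => by positivity]
    exact Finset.sum_congr rfl fun i _ => by
      rw [← ofReal_norm, ENNReal.ofReal_pow (norm_nonneg _)]
  refine (Finset.sum_le_sum fun j _ => h j).trans ?_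
  rw [← ENNReal.ofReal_sum_of_nonneg fun _ _ => by positivity]
  exact ENNReal.ofReal_le_ofReal (hC k)

/-- Bounded multilinear forms on `H_{-p'}` are Hilbert–Schmidt on `H_{-p}`. -/
theorem exists_hsNorm_le (p : ℕ) : ∃ p', p ≤ p' ∧ ∃ C : ℝ, 0 < C ∧
    ∀ (n : ℕ) (k : (Fin n → (N →L[ℝ] ℂ)) → ℂ) (A : ℝ), 0 ≤ A →
      (∀ v : Fin n → (N →L[ℝ] ℂ), (∀ i, S.dualNorm p' (v i) ≠ ∞) →
        ‖k v‖ ≤ A * ∏ i, (S.dualNorm p' (v i)).toReal) →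
      S.hsNorm p k ≤ ENNReal.ofReal (A * C ^ n) := by
  obtain ⟨p', hp, C, hC0, hC⟩ := S.exists_sum_dualNorm_le p
  -- The constant is `√C` because the sum over all `i : Fin n → Fin m` of `∏ |f_{i_j}|²` factorizes
  -- as `(∑ |fᵢ|²)ⁿ ≤ Cⁿ`, and the Hilbert–Schmidt norm is its square root.
  refine ⟨p', hp, √C, Real.sqrt_pos.2 hC0, fun n k A hA hk => ?_⟩
  refine iSup_le fun m => iSup_le fun f => iSup_le fun hf => ?_
  have h1 := hC m f hf
  have hfin : ∀ i, S.dualNorm p' (f i) ≠ ∞ := fun i ht => by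
    have h2 := Finset.single_le_sum (f := fun i => S.dualNorm p' (f i) ^ 2)
      (fun _ _ => zero_le) (Finset.mem_univ i)
    have h3 := h2.trans h1
    simp [ht] at h3
  have h4 : ∑ i, (S.dualNorm p' (f i)).toReal ^ 2 ≤ C := by
    rw [← ENNReal.ofReal_le_ofReal_iff hC0.le, ENNReal.ofReal_sum_of_nonneg
      fun _ _ => by positivity]
    refine le_trans (le_of_eq (Finset.sum_congr rfl fun i _ => ?_)) h1
    rw [ENNReal.ofReal_pow ENNReal.toReal_nonneg, ENNReal.ofReal_toReal (hfin i)]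
  have h5 : ∀ i : Fin n → Fin m, ‖k (fun j => f (i j))‖ₑ ^ (2 : ℝ)
      ≤ ENNReal.ofReal (A ^ 2 * ∏ j, (S.dualNorm p' (f (i j))).toReal ^ 2) := by
    intro i
    have h6 := hk (fun j => f (i j)) fun j => hfin _
    rw [← ofReal_norm, ENNReal.ofReal_rpow_of_nonneg (norm_nonneg _) (by norm_num)]
    refine ENNReal.ofReal_le_ofReal ?_
    rw [Finset.prod_pow, ← mul_pow]
    norm_cast
    gcongr
  rw [tsum_fintype]
  calc _ ≤ (ENNReal.ofReal (A ^ 2 * C ^ n)) ^ (1 / 2 : ℝ) := by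
        refine ENNReal.rpow_le_rpow ((Finset.sum_le_sum fun i _ => h5 i).trans ?_) (by norm_num)
        rw [← ENNReal.ofReal_sum_of_nonneg fun i _ => by positivity, ← Finset.mul_sum,
          ← Fintype.sum_pow (fun i => (S.dualNorm p' (f i)).toReal ^ 2) n]
        gcongr
    _ = _ := by
        rw [ENNReal.ofReal_rpow_of_nonneg (by positivity) (by norm_num), ← Real.sqrt_eq_rpow,
          Real.sqrt_mul (by positivity), Real.sqrt_sq hA]
        congr 2
        rw [← Real.sqrt_sq (show 0 ≤ √C ^ n by positivity), ← pow_mul, mul_comm n, pow_mul,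
          Real.sq_sqrt hC0.le]

/-- A kernel on the diagonal is bounded by its Hilbert–Schmidt norm. -/
theorem norm_diag_le (p : ℕ) {n : ℕ} (k : S.SymKernel n) {z : N →L[ℝ] ℂ}
    (hz : S.dualNorm p z ≠ ∞) :
    ‖k.1 fun _ => z‖ ≤ (S.hsNorm p k.1).toReal * (S.dualNorm p z).toReal ^ n := by
  have hfam : ∀ (m : ℕ) (f : Fin m → (N →L[ℝ] ℂ)), S.IsOrthonormal p f →
      ∀ i : Fin n → Fin m, ‖k.1 fun j => f (i j)‖ ≤ (S.hsNorm p k.1).toReal := by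
    intro m f hf i
    rw [← toReal_enorm]
    refine ENNReal.toReal_mono (k.2.2 p) ?_
    refine le_trans ?_ (le_iSup_of_le m (le_iSup_of_le f (le_iSup_of_le hf le_rfl)))
    calc ‖k.1 fun j => f (i j)‖ₑ
        = (‖k.1 fun j => f (i j)‖ₑ ^ (2 : ℝ)) ^ (1 / 2 : ℝ) := by
          rw [← ENNReal.rpow_mul]; norm_num
      _ ≤ _ := ENNReal.rpow_le_rpow
          (ENNReal.le_tsum (f := fun i : Fin n → Fin m => ‖k.1 fun j => f (i j)‖ₑ ^ (2 : ℝ)) i)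
          (by norm_num)
  rcases (ENNReal.toReal_nonneg (a := S.dualNorm p z)).eq_or_lt with h0 | h0
  · have hz0 : z = 0 := S.eq_zero_of_dualNorm p (by
      rcases (ENNReal.toReal_eq_zero_iff _).1 h0.symm with h | h
      · exact h
      · exact absurd h hz)
    rcases n with _ | n
    -- For `n = 0` the form is a constant, already detected by the empty orthonormal family; for `n
    -- > 0` it vanishes at `z = 0`.
    · have h1 := hfam 0 Fin.elim0 (fun c => by simp [dualNorm_zero]) Fin.elim0
      rw [pow_zero, mul_one]
      convert h1 using 3
    · rw [hz0, k.1.map_coord_zero 0 rfl, norm_zero]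
      positivity
  · set r := (S.dualNorm p z).toReal
    -- The normalized vector `z / |z|_{-p}` is a one-member orthonormal family, and `k` on its
    -- diagonal is a single term of the Hilbert–Schmidt sum.
    have hf : S.IsOrthonormal p fun _ : Fin 1 => ((r : ℂ)⁻¹) • z := by
      intro c
      rw [Fin.sum_univ_one, Fin.sum_univ_one, smul_smul, dualNorm_smul, Real.sqrt_sq (norm_nonneg _),
        ← ENNReal.ofReal_toReal hz, ← ofReal_norm, ← ENNReal.ofReal_mul (norm_nonneg _), norm_mul,
        norm_inv, Complex.norm_real, Real.norm_of_nonneg h0.le]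
      congr 1
      change _ * _ * r = _
      field_simp
    have h1 := hfam 1 _ hf fun _ => 0
    rw [k.1.map_smul_univ (fun _ => (r : ℂ)⁻¹) fun _ => z] at h1
    simp only [Finset.prod_const, Finset.card_univ, Fintype.card_fin, smul_eq_mul, norm_mul,
      norm_pow, norm_inv, Complex.norm_real, Real.norm_of_nonneg h0.le, inv_pow] at h1
    rwa [inv_mul_le_iff₀ (by positivity), mul_comm] at h1

end NuclearNorms

end NonGaussian

/-! ### Polarization -/

namespace NonGaussian

/-- Polarization of a multilinear map. -/
theorem sum_perm_eq_sum_diag {R M M' : Type*} [CommRing R] [AddCommGroup M] [Module R M]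
    [AddCommGroup M'] [Module R M'] {n : ℕ} (k : MultilinearMap R (fun _ : Fin n => M) M')
    (v : Fin n → M) :
    ∑ σ : Equiv.Perm (Fin n), k (fun i => v (σ i))
      = ∑ s : Finset (Fin n), (-1 : ℤ) ^ sᶜ.card • k fun _ => ∑ i ∈ s, v i := by
  classical
  have h1 : ∀ s : Finset (Fin n), (k fun _ => ∑ i ∈ s, v i)
      = ∑ r : Fin n → Fin n, if ∀ i, r i ∈ s then k (fun i => v (r i)) else 0 := by
    intro s
    rw [k.map_sum_finset (fun _ j => v j) (fun _ => s), ← Finset.sum_filter]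
    refine Finset.sum_congr ?_ fun _ _ => rfl
    ext r; simp [Fintype.mem_piFinset]
  simp_rw [h1, Finset.smul_sum]
  rw [Finset.sum_comm]
  -- Inclusion–exclusion: an index map `r` is counted with the alternating sum over all sets
  -- containing its range, which vanishes unless `r` is surjective, hence a permutation.
  have h2 : ∀ r : Fin n → Fin n,
      ∑ s : Finset (Fin n), (-1 : ℤ) ^ sᶜ.card •
        (if ∀ i, r i ∈ s then k (fun i => v (r i)) else 0)
      = if Function.Bijective r then k (fun i => v (r i)) else 0 := by
    intro r
    have h3 : ∑ s : Finset (Fin n), (if ∀ i, r i ∈ s then (-1 : ℤ) ^ sᶜ.card else 0)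
        = if Function.Bijective r then 1 else 0 := by
      -- In terms of complements the sets involved are all subsets of the complement of the range,
      -- where the alternating sum is zero unless that complement is empty.
      rw [← Equiv.sum_comp (Function.Involutive.toPerm (compl : Finset (Fin n) → Finset (Fin n))
        compl_involutive)]
      simp only [Function.Involutive.coe_toPerm, compl_compl]
      rw [← Finset.sum_filter, show (Finset.univ.filter fun t : Finset (Fin n) => ∀ i, r i ∈ tᶜ)
        = ((Finset.univ.image r)ᶜ).powerset by
          ext t
          simp only [Finset.mem_filter, Finset.mem_univ, true_and, Finset.mem_compl,
            Finset.mem_powerset, Finset.subset_iff, Finset.mem_image, not_exists]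
          exact ⟨fun h x hx i hi => h i (hi ▸ hx), fun h i hi => h hi i rfl⟩,
        Finset.sum_powerset_neg_one_pow_card]
      refine if_congr ?_ rfl rfl
      rw [← Finite.surjective_iff_bijective, Finset.compl_eq_empty_iff, Finset.eq_univ_iff_forall]
      simp [Function.Surjective]
    simp only [smul_ite, smul_zero]
    rw [← one_smul ℤ (k fun i => v (r i)), ← ite_zero_smul, ← h3, Finset.sum_smul]
    exact Finset.sum_congr rfl fun s _ => by split_ifs <;> simp
  rw [Finset.sum_congr rfl fun r _ => h2 r, ← Finset.sum_filter]
  refine Finset.sum_bij (fun σ _ => ⇑σ) (fun σ _ => Finset.mem_filter.2 ⟨Finset.mem_univ _, σ.bijective⟩)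
    (fun σ _ τ _ h => Equiv.ext (congrFun h)) (fun r hr => ?_) fun _ _ => rfl
  exact ⟨Equiv.ofBijective r (Finset.mem_filter.1 hr).2, Finset.mem_univ _, rfl⟩

theorem factorial_smul_eq_sum_diag {R M M' : Type*} [CommRing R] [AddCommGroup M] [Module R M]
    [AddCommGroup M'] [Module R M'] {n : ℕ} (k : MultilinearMap R (fun _ : Fin n => M) M')
    (hk : ∀ (σ : Equiv.Perm (Fin n)) v, k (v ∘ σ) = k v) (v : Fin n → M) :
    n.factorial • k v
      = ∑ s : Finset (Fin n), (-1 : ℤ) ^ sᶜ.card • k fun _ => ∑ i ∈ s, v i := by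
  rw [← sum_perm_eq_sum_diag]
  have h : ∀ σ : Equiv.Perm (Fin n), (k fun i => v (σ i)) = k v := fun σ => hk σ v
  simp [h, Fintype.card_perm]

namespace NuclearNorms

variable {N : Type*} [AddCommGroup N] [Module ℝ N] [TopologicalSpace N] (S : NuclearNorms N)

/-! ## Bounds for symmetric multilinear forms -/

/-- A symmetric form is bounded by its values on the diagonal. -/
theorem norm_le_of_diag (p : ℕ) {n : ℕ} (k : MultilinearMap ℂ (fun _ : Fin n => N →L[ℝ] ℂ) ℂ)
    (hk : ∀ (σ : Equiv.Perm (Fin n)) v, k (v ∘ σ) = k v) {A : ℝ}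
    (h : ∀ y, S.dualNorm p y ≠ ∞ → (S.dualNorm p y).toReal ≤ n → ‖k fun _ => y‖ ≤ A)
    (v : Fin n → (N →L[ℝ] ℂ)) (hv : ∀ i, S.dualNorm p (v i) ≠ ∞) :
    ‖k v‖ ≤ 2 ^ n / n.factorial * A * ∏ i, (S.dualNorm p (v i)).toReal := by
  have hA : 0 ≤ A := (norm_nonneg _).trans
    (h 0 (by simp [dualNorm_zero]) (by simp [dualNorm_zero]))
  by_cases h0 : ∃ i, (S.dualNorm p (v i)).toReal = 0
  · obtain ⟨i, hi⟩ := h0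
    have hz : v i = 0 := S.eq_zero_of_dualNorm p (by
      rcases (ENNReal.toReal_eq_zero_iff _).1 hi with h | h
      · exact h
      · exact absurd h (hv i))
    rw [k.map_coord_zero i hz, norm_zero]
    exact mul_nonneg (mul_nonneg (by positivity) hA)
      (Finset.prod_nonneg fun _ _ => ENNReal.toReal_nonneg)
  push Not at h0
  obtain ⟨r, hr⟩ : ∃ r : Fin n → ℝ, ∀ i, r i = (S.dualNorm p (v i)).toReal :=
    ⟨_, fun _ => rfl⟩
  have hr0 : ∀ i, 0 < r i := fun i => by
    rw [hr]; exact lt_of_le_of_ne ENNReal.toReal_nonneg (h0 i).symm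
  -- After normalization the partial sums `∑ i ∈ s, w i` have norm at most `n`, which is why the
  -- diagonal is controlled on the ball of radius `n`. Polarization has `2ⁿ` terms and a factor
  -- `n!`.
  obtain ⟨w, hw⟩ : ∃ w : Fin n → (N →L[ℝ] ℂ), ∀ i, w i = ((r i : ℂ)⁻¹) • v i := ⟨_, fun _ => rfl⟩
  have hwv : v = fun i => (r i : ℂ) • w i := by
    funext i
    have : (r i : ℂ) ≠ 0 := by exact_mod_cast (hr0 i).ne'
    rw [hw]
    exact (smul_inv_smul₀ this (v i)).symm
  have hwt : ∀ i, S.dualNorm p (w i) = 1 := fun i => by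
    rw [hw, dualNorm_smul, ← ENNReal.ofReal_toReal (hv i), ← ofReal_norm,
      ← ENNReal.ofReal_mul (norm_nonneg _), norm_inv, Complex.norm_real,
      Real.norm_of_nonneg (hr0 i).le, ← hr, inv_mul_cancel₀ (hr0 i).ne', ENNReal.ofReal_one]
  have hdiag : ∀ s : Finset (Fin n), ‖k fun _ => ∑ i ∈ s, w i‖ ≤ A := fun s => by
    have h1 : S.dualNorm p (∑ i ∈ s, w i) ≤ (n : ℝ≥0∞) := by
      refine (S.dualNorm_sum_le p s w).trans ?_
      simp only [hwt, Finset.sum_const, nsmul_eq_mul, mul_one]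
      exact_mod_cast (Finset.card_le_univ s).trans (Fintype.card_fin n).le
    have h2 := ne_top_of_le_ne_top (ENNReal.natCast_ne_top n) h1
    exact h _ h2 (by simpa using ENNReal.toReal_mono (ENNReal.natCast_ne_top n) h1)
  have h2 : ‖k w‖ ≤ 2 ^ n / n.factorial * A := by
    have h3 := congrArg norm (factorial_smul_eq_sum_diag k hk w)
    rw [nsmul_eq_mul, norm_mul, Complex.norm_natCast] at h3
    have h4 : ‖∑ s : Finset (Fin n), (-1 : ℤ) ^ sᶜ.card • k fun _ => ∑ i ∈ s, w i‖
        ≤ 2 ^ n * A := by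
      refine (norm_sum_le _ _).trans ?_
      refine (Finset.sum_le_card_nsmul _ _ A fun s _ => ?_).trans ?_
      · rw [zsmul_eq_mul, norm_mul]
        simpa using hdiag s
      · simp
    rw [← h3] at h4
    have : (0 : ℝ) < n.factorial := by exact_mod_cast n.factorial_pos
    rw [div_mul_eq_mul_div, le_div_iff₀ this]
    linarith
  rw [hwv, k.map_smul_univ, norm_smul, norm_prod]
  have h5 : ∀ i, (S.dualNorm p ((r i : ℂ) • w i)).toReal = r i := fun i => by
    rw [toReal_dualNorm_smul, hwt, Complex.norm_real, Real.norm_of_nonneg (hr0 i).le]; simp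
  simp only [h5, Complex.norm_real, Real.norm_of_nonneg (hr0 _).le]
  rw [mul_comm]
  exact mul_le_mul_of_nonneg_right h2 (Finset.prod_nonneg fun i _ => (hr0 i).le)

theorem norm_kernel_le (p : ℕ) {n : ℕ} (k : S.SymKernel n) (v : Fin n → (N →L[ℝ] ℂ))
    (hv : ∀ i, S.dualNorm p (v i) ≠ ∞) :
    ‖k.1 v‖ ≤ 2 ^ n / n.factorial * ((S.hsNorm p k.1).toReal * n ^ n) *
      ∏ i, (S.dualNorm p (v i)).toReal :=
  S.norm_le_of_diag p k.1 k.2.1 (fun _ hy hyn => (S.norm_diag_le p k hy).trans (by gcongr)) v hv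

/-! ## Uniqueness of continuous functionals on kernels -/

/-- The functional `(η, ·)_p` on `N`. -/
noncomputable def dualVec (p : ℕ) (η : N) : N →L[ℝ] ℂ :=
  Complex.ofRealCLM.comp
    { toLinearMap := S.form p η
      cont := by
        refine S.withSeminorms.continuous_normedSpace_rng ℝ _
          ⟨{p}, ⟨S.nrm p η, apply_nonneg _ _⟩, fun ξ => ?_⟩
        have h := LinearMap.BilinForm.apply_sq_le_of_symm (S.form p) (S.form_self_nonneg p)
          ⟨fun x y => S.form_symm p x y⟩ η ξ
        rw [← S.nrm_sq, ← S.nrm_sq, ← mul_pow] at h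
        have h2 := abs_le_of_sq_le_sq h (mul_nonneg (apply_nonneg _ _) (apply_nonneg _ _))
        rw [Finset.sup_singleton]
        exact h2 }

theorem dualVec_apply (p : ℕ) (η ξ : N) : S.dualVec p η ξ = (S.form p η ξ : ℂ) := rfl

/-- The adjoint of the projection onto the span of a finite family. -/
noncomputable def dualProj (p : ℕ) {m : ℕ} (e : Fin m → N) :
    (N →L[ℝ] ℂ) →ₗ[ℂ] (N →L[ℝ] ℂ) where
  toFun z := ∑ i, z (e i) • S.dualVec p (e i)
  map_add' y z := by
    rw [← Finset.sum_add_distrib]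
    exact Finset.sum_congr rfl fun i _ => add_smul (y (e i)) (z (e i)) (S.dualVec p (e i))
  map_smul' c z := by simp [Finset.smul_sum, smul_smul]

theorem dualProj_apply (p : ℕ) {m : ℕ} (e : Fin m → N) (z : N →L[ℝ] ℂ) :
    S.dualProj p e z = ∑ i, z (e i) • S.dualVec p (e i) := rfl

theorem dualProj_apply_apply (p : ℕ) {m : ℕ} (e : Fin m → N) (z : N →L[ℝ] ℂ) (ξ : N) :
    S.dualProj p e z ξ = z (S.proj p e ξ) := by
  simp [dualProj_apply, proj_apply, dualVec_apply, map_sum, mul_comm, sum_apply]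

theorem dualNorm_dualProj_le (p : ℕ) {m : ℕ} {e : Fin m → N}
    (he : ∀ i j, S.form p (e i) (e j) = if i = j then 1 else 0) {z : N →L[ℝ] ℂ}
    (hz : S.dualNorm p z ≠ ∞) : S.dualNorm p (S.dualProj p e z) ≤ S.dualNorm p z := by
  rw [← ENNReal.ofReal_toReal hz]
  refine S.dualNorm_le_ofReal p ENNReal.toReal_nonneg fun θ => ?_
  have h := S.norm_pairing_le p hz (S.proj p e θ.1, S.proj p e θ.2)
  refine (le_of_eq ?_).trans (h.trans ?_)
  · simp only [pairing, dualProj_apply_apply]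
  · refine mul_le_mul_of_nonneg_left ?_ ENNReal.toReal_nonneg
    refine Real.sqrt_le_sqrt (add_le_add ?_ ?_) <;>
    exact pow_le_pow_left₀ (apply_nonneg _ _) (S.nrm_proj_le p he _) 2

/-- The adjoint of `exists_proj_approx`: the inclusion `H_{-p} → H_{-q}` is approximated in operator
norm by finite-rank maps. -/
theorem dualNorm_sub_dualProj_le (p q : ℕ) {m : ℕ} {e : Fin m → N} {δ : ℝ} (hδ : 0 ≤ δ)
    (he : ∀ ξ, S.nrm p (ξ - S.proj q e ξ) ≤ δ * S.nrm q ξ) {z : N →L[ℝ] ℂ}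
    (hz : S.dualNorm p z ≠ ∞) :
    S.dualNorm q (z - S.dualProj q e z) ≤ ENNReal.ofReal (δ * (S.dualNorm p z).toReal) := by
  refine S.dualNorm_le_ofReal q (mul_nonneg hδ ENNReal.toReal_nonneg) fun θ => ?_
  have h := S.norm_pairing_le p hz (θ.1 - S.proj q e θ.1, θ.2 - S.proj q e θ.2)
  refine (le_of_eq ?_).trans (h.trans ?_)
  · simp only [pairing, sub_apply, dualProj_apply_apply, map_sub]
  · rw [mul_comm δ, mul_assoc]
    refine mul_le_mul_of_nonneg_left ?_ ENNReal.toReal_nonneg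
    refine Real.sqrt_le_iff.2 ⟨mul_nonneg hδ (S.cnorm_nonneg _ _), ?_⟩
    rw [mul_pow, show S.cnorm q θ ^ 2 = S.nrm q θ.1 ^ 2 + S.nrm q θ.2 ^ 2 from
      Real.sq_sqrt (by positivity), mul_add, ← mul_pow, ← mul_pow]
    refine add_le_add ?_ ?_ <;> exact pow_le_pow_left₀ (apply_nonneg _ _) (he _) 2

theorem comp_dualProj_eq_sum (p : ℕ) {m n : ℕ} (e : Fin m → N)
    (k : MultilinearMap ℂ (fun _ : Fin n => N →L[ℝ] ℂ) ℂ) (w : Fin n → (N →L[ℝ] ℂ)) :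
    (k fun i => S.dualProj p e (w i))
      = ∑ i : Fin n → Fin m, (∏ j, w j (e (i j))) * k fun j => S.dualVec p (e (i j)) := by
  classical
  simp only [dualProj_apply]
  rw [k.map_sum]
  exact Finset.sum_congr rfl fun i _ => k.map_smul_univ _ _

/-- A kernel composed with a finite-rank projection is a combination of powers `ξ^{⊗n}`. -/
theorem exists_span_eq_comp_dualProj (p : ℕ) {m n : ℕ} (e : Fin m → N) (k : S.SymKernel n) :
    ∃ l ∈ Submodule.span ℂ (Set.range fun ξ : N => S.powKernel n (ξ, 0)),
      ∀ v, l.1 v = k.1 fun i => S.dualProj p e (v i) := by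
  classical
  refine ⟨(n.factorial : ℂ)⁻¹ • ∑ i : Fin n → Fin m, ∑ s : Finset (Fin n),
    ((-1 : ℂ) ^ sᶜ.card * k.1 fun j => S.dualVec p (e (i j))) •
      S.powKernel n (∑ j ∈ s, e (i j), 0), ?_, fun v => ?_⟩
  · refine Submodule.smul_mem _ _ (Submodule.sum_mem _ fun i _ => Submodule.sum_mem _ fun s _ =>
      Submodule.smul_mem _ _ (Submodule.subset_span ⟨_, rfl⟩))
  -- Polarization in the arguments `e (i j)` of the real multilinear map `(ηₗ) ↦ ∏ v l (ηₗ)`; only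
  -- real vectors `∑ j ∈ s, e (i j)` occur. Summing over inverse permutations moves the permutation
  -- from the `e`'s to the `v`'s.
  have hpol : ∀ i : Fin n → Fin m, ∑ σ : Equiv.Perm (Fin n), ∏ j, v (σ j) (e (i j))
      = ∑ s : Finset (Fin n), (-1 : ℂ) ^ sᶜ.card * ∏ l, v l (∑ j ∈ s, e (i j)) := by
    intro i
    have h := sum_perm_eq_sum_diag ((MultilinearMap.mkPiAlgebra ℝ (Fin n) ℂ).compLinearMap
      fun l => (v l : N →ₗ[ℝ] ℂ)) fun j => e (i j)
    simp only [MultilinearMap.compLinearMap_apply, MultilinearMap.mkPiAlgebra_apply,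
      ContinuousLinearMap.coe_coe, zsmul_eq_mul, Int.cast_pow, Int.cast_neg, Int.cast_one] at h
    rw [← h, ← Equiv.sum_comp (Equiv.inv (Equiv.Perm (Fin n)))]
    refine Finset.sum_congr rfl fun σ _ => ?_
    rw [← Equiv.prod_comp σ]
    simp
  have hfac : (n.factorial : ℂ) ≠ 0 := by exact_mod_cast n.factorial_ne_zero
  -- As `k` is symmetric, its finite-rank expansion may be averaged over the permutations of `v`,
  -- which produces the symmetrized products treated by `hpol`.
  have hsym : (n.factorial : ℂ) * (k.1 fun i => S.dualProj p e (v i))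
      = ∑ i : Fin n → Fin m, (∑ σ : Equiv.Perm (Fin n), ∏ j, v (σ j) (e (i j))) *
        k.1 fun j => S.dualVec p (e (i j)) := by
    simp_rw [Finset.sum_mul]
    rw [Finset.sum_comm]
    rw [Finset.sum_congr rfl fun σ _ => 
      (S.comp_dualProj_eq_sum p e k.1 fun j => v (σ j)).symm]
    have h : ∀ σ : Equiv.Perm (Fin n), (k.1 fun i => S.dualProj p e (v (σ i)))
        = k.1 fun i => S.dualProj p e (v i) := fun σ => k.2.1 σ fun i => S.dualProj p e (v i)
    simp [h, Fintype.card_perm]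
  rw [← mul_right_inj' hfac, hsym]
  simp only [Submodule.coe_smul, Submodule.coe_sum, smul_apply, smul_eq_mul, sum_apply,
    mul_inv_cancel_left₀ hfac, hpol, Finset.sum_mul]
  refine Finset.sum_congr rfl fun i _ => Finset.sum_congr rfl fun s _ => ?_
  simp only [powKernel, powForm_apply, pairing_ofReal]
  ring

/-- Writing `v i` as its projection plus a remainder expands `k v` over subsets. The full subset
gives the term that is subtracted; each of the other, at most `2ⁿ`, terms contains a remainder, of
norm at most `δ |v i|_{-p}`, while the other factors are at most `|v i|_{-p}` because `δ ≤ 1`. -/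
theorem norm_sub_comp_dualProj_le {p q : ℕ} (hpq : p ≤ q) {m n : ℕ} {e : Fin m → N}
    (he : ∀ i j, S.form q (e i) (e j) = if i = j then 1 else 0) {δ : ℝ} (hδ : 0 ≤ δ) (hδ1 : δ ≤ 1)
    (hap : ∀ ξ, S.nrm p (ξ - S.proj q e ξ) ≤ δ * S.nrm q ξ)
    (k : MultilinearMap ℂ (fun _ : Fin n => N →L[ℝ] ℂ) ℂ) {B : ℝ} (hB : 0 ≤ B)
    (hk : ∀ v : Fin n → (N →L[ℝ] ℂ), (∀ i, S.dualNorm q (v i) ≠ ∞) →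
      ‖k v‖ ≤ B * ∏ i, (S.dualNorm q (v i)).toReal)
    (v : Fin n → (N →L[ℝ] ℂ)) (hv : ∀ i, S.dualNorm p (v i) ≠ ∞) :
    ‖k v - k fun i => S.dualProj q e (v i)‖
      ≤ 2 ^ n * B * δ * ∏ i, (S.dualNorm p (v i)).toReal := by
  classical
  have hvq : ∀ i, S.dualNorm q (v i) ≠ ∞ := fun i =>
    ne_top_of_le_ne_top (hv i) (S.dualNorm_anti hpq _)
  have h1 : ∀ i, S.dualNorm q (S.dualProj q e (v i)) ≤ S.dualNorm p (v i) := fun i =>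
    (S.dualNorm_dualProj_le q he (hvq i)).trans (S.dualNorm_anti hpq _)
  have h2 := fun i => S.dualNorm_sub_dualProj_le p q hδ hap (hv i)
  have hsplit : v = (fun i => S.dualProj q e (v i)) + fun i => v i - S.dualProj q e (v i) := by
    funext i; simp
  have h3 : k v = ∑ s : Finset (Fin n), k (s.piecewise (fun i => S.dualProj q e (v i))
      fun i => v i - S.dualProj q e (v i)) := by
    conv_lhs => rw [hsplit]
    rw [k.map_add_univ]
  rw [h3, ← Finset.add_sum_erase _ _ (Finset.mem_univ Finset.univ), Finset.piecewise_univ,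
    add_sub_cancel_left]
  refine (norm_sum_le _ _).trans ?_
  have hbound : ∀ s ∈ Finset.univ.erase (Finset.univ : Finset (Fin n)),
      ‖k (s.piecewise (fun i => S.dualProj q e (v i)) fun i => v i - S.dualProj q e (v i))‖
        ≤ B * (δ * ∏ i, (S.dualNorm p (v i)).toReal) := by
    intro s hs
    have hne : ∃ i, i ∉ s := by
      by_contra hcon
      push Not at hcon
      exact (Finset.mem_erase.1 hs).1 (Finset.eq_univ_iff_forall.2 hcon)
    obtain ⟨i₀, hi₀⟩ := hne
    have hfin : ∀ i, S.dualNorm q (s.piecewise (fun i => S.dualProj q e (v i))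
        (fun i => v i - S.dualProj q e (v i)) i) ≠ ∞ := by
      intro i
      by_cases hi : i ∈ s
      · rw [Finset.piecewise_eq_of_mem _ _ _ hi]
        exact ne_top_of_le_ne_top (hv i) (h1 i)
      · rw [Finset.piecewise_eq_of_notMem _ _ _ hi]
        exact ne_top_of_le_ne_top ENNReal.ofReal_ne_top (h2 i)
    refine (hk _ hfin).trans (mul_le_mul_of_nonneg_left ?_ hB)
    have h4 : ∀ i, (S.dualNorm q (s.piecewise (fun i => S.dualProj q e (v i))
        (fun i => v i - S.dualProj q e (v i)) i)).toReal
        ≤ (if i = i₀ then δ else 1) * (S.dualNorm p (v i)).toReal := by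
      intro i
      by_cases hi : i ∈ s
      · rw [Finset.piecewise_eq_of_mem _ _ _ hi, if_neg (by rintro rfl; exact hi₀ hi), one_mul]
        exact ENNReal.toReal_mono (hv i) (h1 i)
      · rw [Finset.piecewise_eq_of_notMem _ _ _ hi]
        have h5 := ENNReal.toReal_mono ENNReal.ofReal_ne_top (h2 i)
        rw [ENNReal.toReal_ofReal (mul_nonneg hδ ENNReal.toReal_nonneg)] at h5
        refine h5.trans ?_
        split_ifs
        · exact le_rfl
        · exact mul_le_mul_of_nonneg_right hδ1 ENNReal.toReal_nonneg
    refine (Finset.prod_le_prod (fun i _ => ENNReal.toReal_nonneg) fun i _ => h4 i).trans ?_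
    rw [Finset.prod_mul_distrib, Finset.prod_ite_eq' Finset.univ i₀ fun _ => δ,
      if_pos (Finset.mem_univ _)]
  refine (Finset.sum_le_card_nsmul _ _ _ hbound).trans ?_
  have h6 : ((Finset.univ.erase (Finset.univ : Finset (Fin n))).card : ℝ) ≤ 2 ^ n := by
    have h7 := Finset.card_erase_le (s := Finset.univ) (a := (Finset.univ : Finset (Fin n)))
    rw [Finset.card_univ, Fintype.card_finset, Fintype.card_fin] at h7
    exact_mod_cast h7
  rw [nsmul_eq_mul]
  have h8 : 0 ≤ ∏ i, (S.dualNorm p (v i)).toReal :=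
    Finset.prod_nonneg fun i _ => ENNReal.toReal_nonneg
  calc _ ≤ 2 ^ n * (B * (δ * ∏ i, (S.dualNorm p (v i)).toReal)) := by gcongr
    _ = _ := by ring

/-- A bounded linear functional on kernels is determined by its values on powers. -/
theorem eq_zero_of_powKernel {n : ℕ} (P : S.SymKernel n →ₗ[ℂ] ℂ) (p₁ p₂ : ℕ) (C : ℝ)
    (hP : ∀ k : S.SymKernel n,
      ‖P k‖ ≤ C * ((S.hsNorm p₁ k.1).toReal + (S.hsNorm p₂ k.1).toReal))
    (h0 : ∀ ξ : N, P (S.powKernel n (ξ, 0)) = 0) : P = 0 := by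
  ext k
  obtain ⟨q₁, -, D₁, hD₁, hhs₁⟩ := S.exists_hsNorm_le p₁
  obtain ⟨q₂, -, D₂, hD₂, hhs₂⟩ := S.exists_hsNorm_le p₂
  obtain ⟨r, hqr, hap⟩ := S.exists_proj_approx (max q₁ q₂)
  set B : ℝ := 2 ^ n / n.factorial * ((S.hsNorm r k.1).toReal * n ^ n) with hB
  have hB0 : 0 ≤ B := by positivity
  -- The finite-rank kernel `l` is a combination of powers, so `P l = 0` and `P k = P (k - l)`. The
  -- operator bound for `k - l` on `H_{-max q₁ q₂}` becomes a Hilbert–Schmidt bound for both `p₁`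
  -- and `p₂`; as `B` does not depend on `δ`, letting `δ → 0` finishes the proof.
  have key : ∀ δ : ℝ, 0 < δ → δ ≤ 1 → ‖P k‖ ≤ |C| * (2 ^ n * B * (D₁ ^ n + D₂ ^ n)) * δ := by
    intro δ hδ hδ1
    obtain ⟨m, e, he, hap'⟩ := hap δ hδ
    obtain ⟨l, hl, hlk⟩ := S.exists_span_eq_comp_dualProj r e k
    have hPl : P l = 0 := by
      have h : Submodule.span ℂ (Set.range fun ξ : N => S.powKernel n (ξ, 0)) ≤ LinearMap.ker P :=
        Submodule.span_le.2 (by rintro _ ⟨ξ, rfl⟩; exact h0 ξ)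
      exact h hl
    have hop : ∀ q, q ≤ max q₁ q₂ → ∀ v : Fin n → (N →L[ℝ] ℂ), (∀ i, S.dualNorm q (v i) ≠ ∞) →
        ‖(k - l : S.SymKernel n).1 v‖
          ≤ 2 ^ n * B * δ * ∏ i, (S.dualNorm q (v i)).toReal := by
      intro q hq v hv
      have h1 : ‖(k - l : S.SymKernel n).1 v‖
          ≤ 2 ^ n * B * δ * ∏ i, (S.dualNorm (max q₁ q₂) (v i)).toReal := by
        have h2 := S.norm_sub_comp_dualProj_le hqr he hδ.le hδ1 hap' k.1 hB0
          (fun v hv => S.norm_kernel_le r k v hv) v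
          (fun i => ne_top_of_le_ne_top (hv i) (S.dualNorm_anti hq _))
        rw [← hlk] at h2
        exact h2
      refine h1.trans (mul_le_mul_of_nonneg_left ?_ (by positivity))
      exact Finset.prod_le_prod (fun _ _ => ENNReal.toReal_nonneg) fun i _ =>
        ENNReal.toReal_mono (hv i) (S.dualNorm_anti hq _)
    have h1 := ENNReal.toReal_mono ENNReal.ofReal_ne_top
      (hhs₁ n (k - l : S.SymKernel n).1 _ (by positivity) (hop q₁ (le_max_left _ _)))
    have h2 := ENNReal.toReal_mono ENNReal.ofReal_ne_top
      (hhs₂ n (k - l : S.SymKernel n).1 _ (by positivity) (hop q₂ (le_max_right _ _)))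
    rw [ENNReal.toReal_ofReal (by positivity)] at h1 h2
    calc ‖P k‖ = ‖P (k - l)‖ := by rw [map_sub, hPl, sub_zero]
      _ ≤ |C| * ((S.hsNorm p₁ (k - l : S.SymKernel n).1).toReal +
          (S.hsNorm p₂ (k - l : S.SymKernel n).1).toReal) :=
          (hP _).trans (mul_le_mul_of_nonneg_right (le_abs_self C)
            (add_nonneg ENNReal.toReal_nonneg ENNReal.toReal_nonneg))
      _ ≤ |C| * (2 ^ n * B * δ * D₁ ^ n + 2 ^ n * B * δ * D₂ ^ n) := by gcongr
      _ = _ := by ring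
  set E := |C| * (2 ^ n * B * (D₁ ^ n + D₂ ^ n))
  have hE : 0 ≤ E := by positivity
  have h1 : ‖P k‖ ≤ 0 := by
    refine le_of_forall_pos_le_add fun ε hε => ?_
    refine (key (min 1 (ε / (E + 1))) (lt_min one_pos (by positivity)) (min_le_left _ _)).trans ?_
    calc E * min 1 (ε / (E + 1)) ≤ E * (ε / (E + 1)) := by gcongr; exact min_le_right _ _
      _ ≤ 0 + ε := by
        rw [zero_add, mul_div_assoc', div_le_iff₀ (by positivity)]; nlinarith
  simpa using h1

end NuclearNorms

end NonGaussian

/-! ### A convexity inequality, and measurability on the dual space -/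

namespace NonGaussian

/-- Jensen's inequality for `u ↦ cosh √u = ∑ uⁿ / (2n)!`: all coefficients are nonnegative, so the
power mean inequality applies term by term. -/
theorem cosh_sqrt_sum_le {ι : Type*} (s : Finset ι) (w y : ι → ℝ) (hw : ∀ i ∈ s, 0 ≤ w i)
    (hw1 : ∑ i ∈ s, w i = 1) :
    Real.cosh √(∑ i ∈ s, w i * y i ^ 2) ≤ ∑ i ∈ s, w i * Real.cosh (y i) := by
  have h1 := Real.hasSum_cosh √(∑ i ∈ s, w i * y i ^ 2)
  have h2 := hasSum_sum fun i (_ : i ∈ s) => (Real.hasSum_cosh (y i)).mul_left (w i)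
  refine hasSum_le (fun n => ?_) h1 h2
  rw [pow_mul, Real.sq_sqrt (Finset.sum_nonneg fun i hi => mul_nonneg (hw i hi) (sq_nonneg _))]
  simp_rw [pow_mul, ← mul_div_assoc]
  rw [← Finset.sum_div]
  gcongr
  exact Real.pow_arith_mean_le_arith_mean_pow s w _ hw hw1 (fun i _ => sq_nonneg _) n

section Measurability

variable {N : Type*} [AddCommGroup N] [Module ℝ N] [TopologicalSpace N]

theorem measurable_apply (ξ : N) : Measurable fun x : N →L[ℝ] ℝ => x ξ :=
  measurable_iff_comap_le.2
    (le_iSup (fun ξ : N => MeasurableSpace.comap (fun x : N →L[ℝ] ℝ => x ξ) inferInstance) ξ)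

theorem measurable_of_apply {α : Type*} [MeasurableSpace α] {f : α → (N →L[ℝ] ℝ)}
    (hf : ∀ ξ, Measurable fun a => f a ξ) : Measurable f := by
  refine measurable_iff_comap_le.2 ?_
  rw [cylinderSigmaAlgebra, MeasurableSpace.comap_iSup]
  refine iSup_le fun ξ => ?_
  rw [MeasurableSpace.comap_comp]
  exact (hf ξ).comap_le

theorem measurable_fst_add_snd :
    Measurable fun y : (N →L[ℝ] ℝ) × (N →L[ℝ] ℝ) => y.1 + y.2 :=
  measurable_of_apply fun ξ =>
    ((measurable_apply ξ).comp measurable_fst).add ((measurable_apply ξ).comp measurable_snd)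

theorem toComplex_apply (x : N →L[ℝ] ℝ) (ξ : N) : toComplex x ξ = (x ξ : ℂ) := rfl

theorem toComplex_add (x y : N →L[ℝ] ℝ) : toComplex (x + y) = toComplex x + toComplex y := by
  ext ξ; simp [toComplex_apply]

theorem measurable_toComplex_add_apply (z : N →L[ℝ] ℂ) (ξ : N) :
    Measurable fun x : N →L[ℝ] ℝ => (toComplex x + z) ξ := by
  simp only [add_apply, toComplex_apply]
  exact (Complex.measurable_ofReal.comp (measurable_apply ξ)).add_const _

end Measurability

namespace NuclearNorms

variable {N : Type*} [AddCommGroup N] [Module ℝ N] [TopologicalSpace N] (S : NuclearNorms N)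

/-- Parseval replaces the uncountable supremum defining the norm by a countable sum of measurable
functions. -/
theorem measurable_dualNorm (p : ℕ) :
    Measurable fun x : N →L[ℝ] ℝ => S.dualNorm p (toComplex x) := by
  have h : ∀ x : N →L[ℝ] ℝ, S.dualNorm p (toComplex x)
      = (∑' j, ‖toComplex x (S.basis p j)‖ₑ ^ 2) ^ (1 / 2 : ℝ) := fun x => by
    rw [← dualNorm_sq_eq, ← ENNReal.rpow_natCast, ← ENNReal.rpow_mul]; norm_num
  simp_rw [h]
  refine Measurable.pow_const (Measurable.tsum fun j => Measurable.pow_const ?_ _) _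
  exact (Complex.measurable_ofReal.comp (measurable_apply _)).enorm

/-! ## Exponential moments of analytic measures -/

variable {μ : Measure (N →L[ℝ] ℝ)}

/-- The bound is local boundedness of `l_μ` at `0`, read off on real arguments `ξ`, where the
integrand is positive. Analyticity along complex lines is recovered later from the exponential
moments, in `ExpMoment.laplace_taylor`. -/
theorem exists_laplace_bound (hμ : IsAnalyticMeasure μ) : ∃ (p : ℕ) (δ M : ℝ), 0 < δ ∧
    ∀ ξ : N, S.nrm p ξ ≤ δ →
      Integrable (fun x : N →L[ℝ] ℝ => Real.exp (x ξ)) μ ∧ ∫ x, Real.exp (x ξ) ∂μ ≤ M := by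
  obtain ⟨U, hU, h0, hint, hol⟩ := hμ
  obtain ⟨-, V, hV, M, hM⟩ := hol 0 h0
  have hcont : Continuous fun ξ : N => (ξ, (0 : N)) := by fun_prop
  have hW : (fun ξ : N => (ξ, (0 : N))) ⁻¹' (U ∩ V) ∈ nhds (0 : N) :=
    hcont.continuousAt (Filter.inter_mem (hU.mem_nhds h0) hV)
  obtain ⟨⟨s, r⟩, hr, hsub⟩ := S.withSeminorms.hasBasis_zero_ball.mem_iff.1 hW
  obtain ⟨p, hp⟩ := S.sup_nrm_le s
  refine ⟨p, r / 2, M, half_pos hr, fun ξ hξ => ?_⟩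
  have hmem : (ξ, (0 : N)) ∈ U ∩ V := hsub (by
    rw [Seminorm.mem_ball_zero]
    exact (hp p le_rfl ξ).trans_lt (hξ.trans_lt (half_lt_self hr)))
  have hexp : ∀ x : N →L[ℝ] ℝ, Complex.exp (pairing (toComplex x) (ξ, 0)) = (Real.exp (x ξ) : ℂ) :=
    fun x => by rw [pairing_ofReal, toComplex_apply, Complex.ofReal_exp]
  have hi := hint _ hmem.1
  simp_rw [hexp] at hi
  have hre := hi.re
  simp only [RCLike.re_eq_complex_re, Complex.ofReal_re] at hre
  refine ⟨hre, ?_⟩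
  have h1 := hM _ hmem.2
  rw [laplace] at h1
  simp_rw [hexp] at h1
  rw [integral_complex_ofReal, Complex.norm_real] at h1
  exact (le_abs_self _).trans h1

theorem integral_cosh_le {p : ℕ} {δ M : ℝ} (h : ∀ ξ : N, S.nrm p ξ ≤ δ →
      Integrable (fun x : N →L[ℝ] ℝ => Real.exp (x ξ)) μ ∧ ∫ x, Real.exp (x ξ) ∂μ ≤ M)
    (ξ : N) (hξ : S.nrm p ξ ≤ δ) :
    Integrable (fun x : N →L[ℝ] ℝ => Real.cosh (x ξ)) μ ∧ ∫ x, Real.cosh (x ξ) ∂μ ≤ M := by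
  have h1 := h ξ hξ
  have h2 := h (-ξ) (by rwa [map_neg_eq_map])
  simp only [map_neg] at h2
  simp_rw [Real.cosh_eq]
  refine ⟨(h1.1.add h2.1).div_const 2, ?_⟩
  rw [integral_div, integral_add h1.1 h2.1]
  linarith [h1.2, h2.2]

/-- With `a j = |e_j|_p` and `A = ∑ (a j)²`, the vectors `η j = (ε √A / a j) e_j` satisfy `ε² ∑
x(e_j)² = ∑ ((a j)² / A) x(η j)²`. Convexity thus bounds the integrand by an average of `cosh (x (η
j))`, and `|η j|_p ≤ ε √A ≤ ε √C ≤ δ` puts each of these in the range of the Laplace bound. The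
result does not depend on `m`. -/
theorem lintegral_cosh_le [IsProbabilityMeasure μ] {p p' : ℕ} {δ M C ε : ℝ} (hδ : 0 ≤ δ)
    (h : ∀ ξ : N, S.nrm p ξ ≤ δ →
      Integrable (fun x : N →L[ℝ] ℝ => Real.exp (x ξ)) μ ∧ ∫ x, Real.exp (x ξ) ∂μ ≤ M)
    (hC : ∀ m, ∑ j ∈ Finset.range m, S.nrm p (S.basis p' j) ^ 2 ≤ C) (hε : 0 ≤ ε)
    (hεC : ε * √C ≤ δ) (m : ℕ) :
    ∫⁻ x, ENNReal.ofReal (Real.cosh (ε * √(∑ j ∈ Finset.range m, x (S.basis p' j) ^ 2))) ∂μ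
      ≤ ENNReal.ofReal M := by
  set a := fun j => S.nrm p (S.basis p' j) with ha
  have ha0 : ∀ j, 0 ≤ a j := fun j => apply_nonneg _ _
  set A := ∑ j ∈ Finset.range m, a j ^ 2 with hA
  have hA0 : 0 ≤ A := Finset.sum_nonneg fun j _ => sq_nonneg _
  rcases hA0.eq_or_lt with hA1 | hA1
  -- Degenerate case: all basis vectors involved vanish, the integrand is `1`, and `1 ≤ M` is the
  -- Laplace bound at `ξ = 0`.
  · have hz : ∀ j ∈ Finset.range m, S.basis p' j = 0 := fun j hj => by
      have := (Finset.sum_eq_zero_iff_of_nonneg fun j _ => sq_nonneg (a j)).1 hA1.symm j hj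
      exact S.definite p _ (pow_eq_zero_iff two_ne_zero |>.1 this)
    have hz2 : ∀ x : N →L[ℝ] ℝ, ∑ j ∈ Finset.range m, x (S.basis p' j) ^ 2 = 0 := fun x =>
      Finset.sum_eq_zero fun j hj => by rw [hz j hj]; simp
    have h1 := (h 0 (by rwa [map_zero])).2
    simp only [map_zero, Real.exp_zero, integral_const, probReal_univ, smul_eq_mul, mul_one] at h1
    simp only [hz2, Real.sqrt_zero, mul_zero, Real.cosh_zero, lintegral_const, measure_univ,
      mul_one]
    exact ENNReal.ofReal_le_ofReal h1
  · set η := fun j => (ε * √A * (a j)⁻¹) • S.basis p' j with hη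
    have hηδ : ∀ j, S.nrm p (η j) ≤ δ := fun j => by
      rw [hη, map_smul_eq_mul, Real.norm_of_nonneg (by have := ha0 j; positivity), mul_assoc]
      have h1 : (a j)⁻¹ * S.nrm p (S.basis p' j) ≤ 1 := by
        rw [mul_comm]; exact mul_inv_le_one
      calc ε * √A * ((a j)⁻¹ * S.nrm p (S.basis p' j)) ≤ ε * √A * 1 := by gcongr
        _ ≤ ε * √C := by rw [mul_one]; gcongr; exact hC m
        _ ≤ δ := hεC
    have hterm : ∀ (x : N →L[ℝ] ℝ) j, a j ^ 2 / A * x (η j) ^ 2 = ε ^ 2 * x (S.basis p' j) ^ 2 := by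
      intro x j
      rcases (ha0 j).eq_or_lt with h1 | h1
      · have h2 : S.basis p' j = 0 := S.definite p _ h1.symm
        simp [hη, h2]
      · simp only [hη, map_smul, smul_eq_mul, mul_pow, inv_pow, Real.sq_sqrt hA0]
        field_simp
    have hpt : ∀ x : N →L[ℝ] ℝ,
        Real.cosh (ε * √(∑ j ∈ Finset.range m, x (S.basis p' j) ^ 2))
          ≤ ∑ j ∈ Finset.range m, a j ^ 2 / A * Real.cosh (x (η j)) := by
      intro x
      have h1 := cosh_sqrt_sum_le (Finset.range m) (fun j => a j ^ 2 / A) (fun j => x (η j))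
        (fun j _ => by positivity) (by rw [← Finset.sum_div, div_self hA1.ne'])
      simp only [hterm, ← Finset.mul_sum] at h1
      rwa [Real.sqrt_mul (sq_nonneg ε), Real.sqrt_sq hε] at h1
    have hint : ∀ j ∈ Finset.range m,
        Integrable (fun x : N →L[ℝ] ℝ => a j ^ 2 / A * Real.cosh (x (η j))) μ := fun j _ =>
      (S.integral_cosh_le h (η j) (hηδ j)).1.const_mul _
    calc _ ≤ ∫⁻ x, ENNReal.ofReal (∑ j ∈ Finset.range m, a j ^ 2 / A * Real.cosh (x (η j))) ∂μ :=
          lintegral_mono fun x => ENNReal.ofReal_le_ofReal (hpt x)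
      _ = ENNReal.ofReal (∫ x, ∑ j ∈ Finset.range m, a j ^ 2 / A * Real.cosh (x (η j)) ∂μ) := by
          rw [ofReal_integral_eq_lintegral_ofReal (integrable_finsetSum _ hint)]
          exact Filter.Eventually.of_forall fun x => Finset.sum_nonneg fun j _ =>
            mul_nonneg (by positivity) (Real.cosh_pos _).le
      _ ≤ ENNReal.ofReal M := by
          refine ENNReal.ofReal_le_ofReal ?_
          rw [integral_finsetSum _ hint]
          simp_rw [integral_const_mul]
          calc _ ≤ ∑ j ∈ Finset.range m, a j ^ 2 / A * M :=
                Finset.sum_le_sum fun j _ => mul_le_mul_of_nonneg_left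
                  (S.integral_cosh_le h (η j) (hηδ j)).2 (by positivity)
            _ = M := by rw [← Finset.sum_mul, ← Finset.sum_div, div_self hA1.ne', one_mul]

/-- The measure `μ` has uniformly bounded exponential moments of order `ε` with respect to the
norms `|·|_{-p}`, `p ≥ p₀`. -/
structure ExpMoment (μ : Measure (N →L[ℝ] ℝ)) (p₀ : ℕ) (ε K : ℝ) : Prop where
  pos : 0 < ε
  ae_ne_top : ∀ p, p₀ ≤ p → ∀ᵐ x ∂μ, S.dualNorm p (toComplex x) ≠ ∞
  integrable : ∀ p, p₀ ≤ p →
    Integrable (fun x => Real.exp (ε * (S.dualNorm p (toComplex x)).toReal)) μ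
  integral_le : ∀ p, p₀ ≤ p → ∫ x, Real.exp (ε * (S.dualNorm p (toComplex x)).toReal) ∂μ ≤ K

/-- Monotone convergence in `m` carries the uniform bound of `lintegral_cosh_le` to the supremum.
Where the supremum is finite, `exp ≤ 2 cosh` bounds the partial sums of Parseval's series, so that
`|x|_{-p'}` is finite and its exponential is at most twice the supremum. -/
theorem exists_expMoment [IsProbabilityMeasure μ] (hμ : IsAnalyticMeasure μ) :
    ∃ p₀ ε K, S.ExpMoment μ p₀ ε K := by
  obtain ⟨p, δ, M, hδ, h⟩ := S.exists_laplace_bound hμ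
  obtain ⟨p', -, C, hC0, hC⟩ := S.exists_sum_basis_le p
  set ε := δ / √C with hε
  have hε0 : 0 < ε := div_pos hδ (Real.sqrt_pos.2 hC0)
  have hεC : ε * √C ≤ δ := by rw [hε, div_mul_cancel₀ _ (Real.sqrt_pos.2 hC0).ne']
  let f : ℕ → (N →L[ℝ] ℝ) → ℝ≥0∞ := fun m x =>
    ENNReal.ofReal (Real.cosh (ε * √(∑ j ∈ Finset.range m, x (S.basis p' j) ^ 2)))
  have hfm : ∀ m, Measurable (f m) := fun m => by
    refine ENNReal.measurable_ofReal.comp (Real.continuous_cosh.measurable.comp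
      (measurable_const.mul (Real.continuous_sqrt.measurable.comp ?_)))
    exact Finset.measurable_fun_sum _ fun j _ => (measurable_apply _).pow_const 2
  have hmono : Monotone f := fun m n hmn x => by
    refine ENNReal.ofReal_le_ofReal (Real.cosh_le_cosh.2 ?_)
    rw [abs_of_nonneg (by positivity), abs_of_nonneg (by positivity)]
    gcongr
  have hlint : ∫⁻ x, ⨆ m, f m x ∂μ ≤ ENNReal.ofReal M := by
    rw [lintegral_iSup hfm hmono]
    exact iSup_le fun m => S.lintegral_cosh_le hδ.le h hC hε0.le hεC m
  have hae : ∀ᵐ x ∂μ, ⨆ m, f m x < ∞ :=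
    ae_lt_top (Measurable.iSup hfm) (ne_top_of_le_ne_top ENNReal.ofReal_ne_top hlint)
  have hpt : ∀ x, ⨆ m, f m x < ∞ → S.dualNorm p' (toComplex x) ≠ ∞ ∧
      ENNReal.ofReal (Real.exp (ε * (S.dualNorm p' (toComplex x)).toReal))
        ≤ 2 * ⨆ m, f m x := by
    intro x hx
    set B := (⨆ m, f m x).toReal with hB
    have h1 : ∀ m, Real.exp (ε * √(∑ j ∈ Finset.range m, x (S.basis p' j) ^ 2)) ≤ 2 * B := by
      intro m
      have h2 : Real.cosh (ε * √(∑ j ∈ Finset.range m, x (S.basis p' j) ^ 2)) ≤ B := by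
        rw [← ENNReal.ofReal_le_ofReal_iff ENNReal.toReal_nonneg, ENNReal.ofReal_toReal hx.ne]
        exact le_iSup (fun m => f m x) m
      rw [Real.cosh_eq] at h2
      have := (Real.exp_pos (-(ε * √(∑ j ∈ Finset.range m, x (S.basis p' j) ^ 2)))).le
      linarith
    have h2B : 1 ≤ 2 * B := by simpa using h1 0
    set L := Real.log (2 * B) with hL
    have hL0 : 0 ≤ L := Real.log_nonneg h2B
    have h3 : S.dualNorm p' (toComplex x) ≤ ENNReal.ofReal (L / ε) := by
      refine S.dualNorm_le_of_sum_le p' _ (by positivity) fun m => ?_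
      simp only [toComplex_apply, Complex.norm_real, Real.norm_eq_abs, sq_abs]
      have h4 := (Real.le_log_iff_exp_le (by linarith)).2 (h1 m)
      rw [← le_div_iff₀' hε0] at h4
      exact (Real.sqrt_le_left (by positivity)).1 h4
    have hfin := ne_top_of_le_ne_top ENNReal.ofReal_ne_top h3
    refine ⟨hfin, ?_⟩
    have h5 := ENNReal.toReal_mono ENNReal.ofReal_ne_top h3
    rw [ENNReal.toReal_ofReal (by positivity), le_div_iff₀' hε0] at h5
    calc _ ≤ ENNReal.ofReal (2 * B) := ENNReal.ofReal_le_ofReal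
          (((Real.exp_le_exp).2 h5).trans_eq (Real.exp_log (by linarith)))
      _ = _ := by
        rw [ENNReal.ofReal_mul (by norm_num), hB, ENNReal.ofReal_toReal hx.ne]; simp
  have hmeas : ∀ q, Measurable fun x : N →L[ℝ] ℝ =>
      Real.exp (ε * (S.dualNorm q (toComplex x)).toReal) := fun q =>
    Real.measurable_exp.comp (measurable_const.mul (S.measurable_dualNorm q).ennreal_toReal)
  have hlint2 : ∫⁻ x, ENNReal.ofReal (Real.exp (ε * (S.dualNorm p' (toComplex x)).toReal)) ∂μ
      ≤ 2 * ENNReal.ofReal M := by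
    calc _ ≤ ∫⁻ x, 2 * ⨆ m, f m x ∂μ := lintegral_mono_ae (hae.mono fun x hx => (hpt x hx).2)
      _ = 2 * ∫⁻ x, ⨆ m, f m x ∂μ := lintegral_const_mul _ (Measurable.iSup hfm)
      _ ≤ _ := by gcongr
  have hint : Integrable (fun x => Real.exp (ε * (S.dualNorm p' (toComplex x)).toReal)) μ := by
    refine ⟨(hmeas p').aestronglyMeasurable, ?_⟩
    rw [hasFiniteIntegral_iff_ofReal (Filter.Eventually.of_forall fun x => (Real.exp_pos _).le)]
    exact hlint2.trans_lt (ENNReal.mul_lt_top (by simp) ENNReal.ofReal_lt_top)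
  have hle : ∀ q, p' ≤ q → ∀ᵐ x ∂μ, Real.exp (ε * (S.dualNorm q (toComplex x)).toReal)
      ≤ Real.exp (ε * (S.dualNorm p' (toComplex x)).toReal) := fun q hq => hae.mono fun x hx => by
    gcongr
    exacts [(hpt x hx).1, S.dualNorm_anti hq _]
  have hint' : ∀ q, p' ≤ q →
      Integrable (fun x => Real.exp (ε * (S.dualNorm q (toComplex x)).toReal)) μ := fun q hq =>
    hint.mono' (hmeas q).aestronglyMeasurable ((hle q hq).mono fun x hx => by
      rwa [Real.norm_of_nonneg (Real.exp_pos _).le])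
  -- The dual norms decrease in the index, so the moment at `p'` serves as `K` for every `q ≥ p'`.
  exact ⟨p', ε, _, hε0, fun q hq => hae.mono fun x hx =>
    ne_top_of_le_ne_top (hpt x hx).1 (S.dualNorm_anti hq _), hint',
    fun q hq => integral_mono_ae (hint' q hq) hint (hle q hq)⟩

/-! ## Measurability of kernels -/

/-- Composed with a finite-rank projection, the kernel is a polynomial in finitely many evaluations
of `x`, hence measurable. On the set where `|x|_{-p}` is finite it is the pointwise limit of such
polynomials, and these sets exhaust `N'` as `p → ∞`. -/
theorem measurable_diag {n : ℕ} (k : S.SymKernel n) (z : N →L[ℝ] ℂ) :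
    Measurable fun x : N →L[ℝ] ℝ => k.1 fun _ => toComplex x + z := by
  obtain ⟨p₁, hz⟩ := S.exists_dualNorm_ne_top z
  have hset : ∀ p, MeasurableSet {x : N →L[ℝ] ℝ | S.dualNorm p (toComplex x) ≠ ∞} := fun p =>
    (S.measurable_dualNorm p) (measurableSet_singleton ∞).compl
  have h1 : ∀ p, p₁ ≤ p → Measurable
      ({x : N →L[ℝ] ℝ | S.dualNorm p (toComplex x) ≠ ∞}.indicator
        fun x => k.1 fun _ => toComplex x + z) := by
    intro p hp
    obtain ⟨q, hpq, hap⟩ := S.exists_proj_approx p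
    choose m e he hap' using fun j : ℕ => hap (1 / ((j : ℝ) + 1)) (by positivity)
    refine measurable_of_tendsto_metrizable (f := fun j =>
      {x : N →L[ℝ] ℝ | S.dualNorm p (toComplex x) ≠ ∞}.indicator
        fun x => k.1 fun _ => S.dualProj q (e j) (toComplex x + z))
      (fun j => Measurable.indicator ?_ (hset p)) ?_
    · simp_rw [S.comp_dualProj_eq_sum q (e j) k.1 fun _ => toComplex _ + z]
      refine Finset.measurable_fun_sum _ fun i _ => Measurable.mul_const ?_ _
      exact Finset.measurable_fun_prod _ fun l _ => measurable_toComplex_add_apply z _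
    · rw [tendsto_pi_nhds]
      intro x
      by_cases hx : S.dualNorm p (toComplex x) ≠ ∞
      · simp only [Set.indicator_of_mem (s := {x | S.dualNorm p (toComplex x) ≠ ∞}) hx]
        rw [tendsto_iff_norm_sub_tendsto_zero]
        have hxz := S.add_ne_top' hx (hz p hp)
        set B : ℝ := 2 ^ n / n.factorial * ((S.hsNorm q k.1).toReal * n ^ n)
        have hlim : Filter.Tendsto (fun j : ℕ => 2 ^ n * B * (1 / ((j : ℝ) + 1)) *
            ∏ _i : Fin n, (S.dualNorm p (toComplex x + z)).toReal) Filter.atTop (nhds 0) := by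
          have := (tendsto_one_div_add_atTop_nhds_zero_nat (𝕜 := ℝ)).const_mul (2 ^ n * B)
            |>.mul_const (∏ _i : Fin n, (S.dualNorm p (toComplex x + z)).toReal)
          simpa using this
        refine squeeze_zero (fun j => norm_nonneg _) (fun j => ?_) hlim
        rw [norm_sub_rev]
        refine S.norm_sub_comp_dualProj_le hpq (he j) (by positivity) ?_ (hap' j) k.1
          (by positivity) (fun v hv => S.norm_kernel_le q k v hv) _ fun _ => hxz
        rw [div_le_one (by positivity)]
        linarith [(Nat.cast_nonneg j : (0 : ℝ) ≤ j)]
      · simp only [Set.indicator_of_notMem (s := {x | S.dualNorm p (toComplex x) ≠ ∞}) hx]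
        exact tendsto_const_nhds
  refine measurable_of_tendsto_metrizable (fun j => h1 (p₁ + j) (Nat.le_add_right _ _)) ?_
  rw [tendsto_pi_nhds]
  intro x
  obtain ⟨p₂, hp₂⟩ := S.exists_dualNorm_ne_top (toComplex x)
  refine tendsto_const_nhds.congr' ?_
  filter_upwards [Filter.eventually_ge_atTop p₂] with j hj
  rw [Set.indicator_of_mem]
  exact hp₂ _ (hj.trans (Nat.le_add_left _ _))

end NuclearNorms

end NonGaussian

namespace NonGaussian

namespace NuclearNorms

variable {N : Type*} [AddCommGroup N] [Module ℝ N] [TopologicalSpace N] (S : NuclearNorms N)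

/-! ## The convolution operator on functions of exponential growth -/

/-- `|φ(z)| ≤ A exp(ε |z|_{-p})` on `H_{-p}`. -/
def ExpBound (p : ℕ) (ε A : ℝ) (φ : (N →L[ℝ] ℂ) → ℂ) : Prop :=
  ∀ z, S.dualNorm p z ≠ ∞ → ‖φ z‖ ≤ A * Real.exp (ε * (S.dualNorm p z).toReal)

/-- Functions with measurable translates and of exponential growth `ε` on all `H_{-p}`,
`p ≥ p₀`. -/
def ExpGrowth (p₀ : ℕ) (ε : ℝ) : Submodule ℂ ((N →L[ℝ] ℂ) → ℂ) where
  carrier := {φ | (∀ z, Measurable fun x : N →L[ℝ] ℝ => φ (toComplex x + z)) ∧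
    ∀ p, p₀ ≤ p → ∃ A, S.ExpBound p ε A φ}
  zero_mem' := ⟨fun z => measurable_const, fun p _ => ⟨0, fun z _ => by simp⟩⟩
  add_mem' := by
    rintro φ ψ ⟨h1, h2⟩ ⟨h3, h4⟩
    refine ⟨fun z => (h1 z).add (h3 z), fun p hp => ?_⟩
    obtain ⟨A, hA⟩ := h2 p hp
    obtain ⟨B, hB⟩ := h4 p hp
    exact ⟨A + B, fun z hz => (norm_add_le _ _).trans
      ((add_le_add (hA z hz) (hB z hz)).trans_eq (add_mul _ _ _).symm)⟩
  smul_mem' := by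
    rintro c φ ⟨h1, h2⟩
    refine ⟨fun z => (h1 z).const_mul c, fun p hp => ?_⟩
    obtain ⟨A, hA⟩ := h2 p hp
    refine ⟨‖c‖ * A, fun z hz => ?_⟩
    rw [Pi.smul_apply, norm_smul, mul_assoc]
    exact mul_le_mul_of_nonneg_left (hA z hz) (norm_nonneg c)

variable {S}

theorem ExpBound.nonneg {p : ℕ} {ε A : ℝ} {φ : (N →L[ℝ] ℂ) → ℂ} (h : S.ExpBound p ε A φ) :
    0 ≤ A := by
  have h1 := h 0 (by simp [dualNorm_zero])
  simp only [dualNorm_zero, ENNReal.toReal_zero, mul_zero, Real.exp_zero, mul_one] at h1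
  exact (norm_nonneg _).trans h1

variable {μ : Measure (N →L[ℝ] ℝ)} {p₀ : ℕ} {ε K : ℝ}

theorem ExpMoment.nonneg (H : S.ExpMoment μ p₀ ε K) : 0 ≤ K :=
  (integral_nonneg fun _ => (Real.exp_pos _).le).trans (H.integral_le p₀ le_rfl)

theorem ExpMoment.ae_norm_le (H : S.ExpMoment μ p₀ ε K) {φ : (N →L[ℝ] ℂ) → ℂ} {p : ℕ}
    (hp : p₀ ≤ p) {A : ℝ} (hA : S.ExpBound p ε A φ) {z : N →L[ℝ] ℂ} (hz : S.dualNorm p z ≠ ∞) :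
    ∀ᵐ x ∂μ, ‖φ (toComplex x + z)‖ ≤ A * Real.exp (ε * (S.dualNorm p z).toReal) *
      Real.exp (ε * (S.dualNorm p (toComplex x)).toReal) := by
  filter_upwards [H.ae_ne_top p hp] with x hx
  refine (hA _ (S.add_ne_top' hx hz)).trans ?_
  rw [mul_assoc, ← Real.exp_add, ← mul_add]
  refine mul_le_mul_of_nonneg_left (Real.exp_le_exp.2 ?_) hA.nonneg
  refine mul_le_mul_of_nonneg_left ?_ H.pos.le
  rw [add_comm (S.dualNorm p z).toReal]
  exact S.toReal_dualNorm_add_le p hx hz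

theorem ExpMoment.integrable_translate (H : S.ExpMoment μ p₀ ε K) (φ : S.ExpGrowth p₀ ε)
    (z : N →L[ℝ] ℂ) : Integrable (fun x => φ.1 (toComplex x + z)) μ := by
  obtain ⟨q, hq⟩ := S.exists_dualNorm_ne_top z
  obtain ⟨A, hA⟩ := φ.2.2 (max p₀ q) (le_max_left _ _)
  exact ((H.integrable _ (le_max_left p₀ q)).const_mul _).mono' (φ.2.1 z).aestronglyMeasurable
    (H.ae_norm_le (le_max_left _ _) hA (hq _ (le_max_right _ _)))

/-- From `exp(ε |x + z|) ≤ exp(ε |x|) exp(ε |z|)`: the rate `ε` is preserved and only the constant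
grows, by `K`, so the convolution can be iterated. -/
theorem ExpMoment.expBound_integral (H : S.ExpMoment μ p₀ ε K) {φ : (N →L[ℝ] ℂ) → ℂ} {p : ℕ}
    (hp : p₀ ≤ p) {A : ℝ} (hA : S.ExpBound p ε A φ) :
    S.ExpBound p ε (A * K) fun z => ∫ x, φ (toComplex x + z) ∂μ := by
  intro z hz
  have h1 := norm_integral_le_of_norm_le ((H.integrable _ hp).const_mul
    (A * Real.exp (ε * (S.dualNorm p z).toReal))) (H.ae_norm_le hp hA hz)
  rw [integral_const_mul] at h1
  refine h1.trans ?_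
  rw [mul_right_comm A K]
  exact mul_le_mul_of_nonneg_left (H.integral_le p hp)
    (mul_nonneg hA.nonneg (Real.exp_pos _).le)

/-- The convolution operator `φ ↦ ∫ φ(x + ·) dμ(x)`. -/
noncomputable def smoothing [SFinite μ] (H : S.ExpMoment μ p₀ ε K) :
    Module.End ℂ (S.ExpGrowth p₀ ε) where
  toFun φ := ⟨fun z => ∫ x, φ.1 (toComplex x + z) ∂μ, fun z => by
      -- The translate by `z` composed with addition is jointly measurable, so the integral over one
      -- variable is measurable in the other.
      have h1 : Measurable fun y : (N →L[ℝ] ℝ) × (N →L[ℝ] ℝ) =>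
          φ.1 (toComplex y.2 + (toComplex y.1 + z)) := by
        have e : (fun y : (N →L[ℝ] ℝ) × (N →L[ℝ] ℝ) => φ.1 (toComplex y.2 + (toComplex y.1 + z)))
            = (fun x => φ.1 (toComplex x + z)) ∘ fun y => y.1 + y.2 := funext fun y => by
          simp only [Function.comp_apply, toComplex_add]
          rw [add_left_comm, add_assoc]
        rw [e]
        exact (φ.2.1 z).comp measurable_fst_add_snd
      exact h1.stronglyMeasurable.integral_prod_right'.measurable, fun p hp => by
      obtain ⟨A, hA⟩ := φ.2.2 p hp
      exact ⟨_, H.expBound_integral hp hA⟩⟩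
  map_add' φ ψ := by
    ext z
    exact integral_add (H.integrable_translate φ z) (H.integrable_translate ψ z)
  map_smul' c φ := by
    ext z
    exact integral_const_mul c _

theorem smoothing_apply [SFinite μ] (H : S.ExpMoment μ p₀ ε K) (φ : S.ExpGrowth p₀ ε)
    (z : N →L[ℝ] ℂ) : (smoothing H φ).1 z = ∫ x, φ.1 (toComplex x + z) ∂μ := rfl

theorem ExpMoment.expBound_one_sub_pow [SFinite μ] (H : S.ExpMoment μ p₀ ε K)
    {φ : S.ExpGrowth p₀ ε} {p : ℕ} (hp : p₀ ≤ p) {A : ℝ} (hA : S.ExpBound p ε A φ.1) (r : ℕ) :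
    S.ExpBound p ε (A * (1 + K) ^ r) (((1 - smoothing H) ^ r) φ).1 := by
  induction r with
  | zero => simpa using hA
  | succ r ih =>
    rw [pow_succ', pow_succ' (1 - smoothing H), Module.End.mul_apply]
    intro z hz
    set ψ := ((1 - smoothing H) ^ r) φ
    have h1 := ih z hz
    have h2 := H.expBound_integral hp ih z hz
    calc ‖ψ.1 z - ∫ x, ψ.1 (toComplex x + z) ∂μ‖ ≤ _ := norm_sub_le _ _
      _ ≤ _ := add_le_add h1 h2
      _ = _ := by ring

variable (S) in
-- From `sⁿ / n! ≤ exp s` at `s = ε |z|_{-p}`.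
theorem expBound_diag {n : ℕ} (k : S.SymKernel n) (p : ℕ) {ε : ℝ} (hε : 0 < ε) :
    S.ExpBound p ε ((S.hsNorm p k.1).toReal * (n.factorial / ε ^ n)) fun z => k.1 fun _ => z := by
  intro z hz
  refine (S.norm_diag_le p k hz).trans ?_
  rw [mul_assoc]
  refine mul_le_mul_of_nonneg_left ?_ ENNReal.toReal_nonneg
  have h := Real.pow_div_factorial_le_exp (ε * (S.dualNorm p z).toReal)
    (mul_nonneg hε.le ENNReal.toReal_nonneg) n
  have h0 : (0 : ℝ) < n.factorial := by exact_mod_cast n.factorial_pos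
  rw [mul_pow, div_le_iff₀ h0] at h
  rw [div_mul_eq_mul_div, le_div_iff₀ (pow_pos hε n)]
  linarith

/-- The homogeneous polynomial `z ↦ ⟨z^{⊗n}, k⟩`. -/
noncomputable def diagMap (S : NuclearNorms N) (p₀ : ℕ) {ε : ℝ} (hε : 0 < ε) (n : ℕ) :
    S.SymKernel n →ₗ[ℂ] S.ExpGrowth p₀ ε where
  toFun k := ⟨fun z => k.1 fun _ => z, S.measurable_diag k, fun p _ =>
    ⟨_, S.expBound_diag k p hε⟩⟩
  map_add' _ _ := rfl
  map_smul' _ _ := rfl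

/-- The polynomial `z ↦ ⟨P_n^μ(z), k⟩`: since `1 - C_μ` lowers the degree, the inverse of the
convolution `C_μ` on polynomials of degree `n` is `∑_{r ≤ n} (1 - C_μ)^r`. -/
noncomputable def appellMap [SFinite μ] (H : S.ExpMoment μ p₀ ε K) (n : ℕ) :
    S.SymKernel n →ₗ[ℂ] S.ExpGrowth p₀ ε :=
  (∑ r ∈ Finset.range (n + 1), (1 - smoothing H) ^ r) ∘ₗ S.diagMap p₀ H.pos n

/-- Each factor `1 - C_μ` costs `1 + K`, and there are `n + 1 ≤ 2ⁿ` summands. It is essential that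
the constant is only of order `n! cⁿ`, which the weights of the test space can absorb. -/
theorem ExpMoment.expBound_appellMap [SFinite μ] (H : S.ExpMoment μ p₀ ε K) (n : ℕ)
    (k : S.SymKernel n) {p : ℕ} (hp : p₀ ≤ p) :
    S.ExpBound p ε ((S.hsNorm p k.1).toReal * (n.factorial * (2 * (1 + K) / ε) ^ n))
      (appellMap H n k).1 := by
  intro z hz
  have hK := H.nonneg
  have hε := H.pos
  have h1 : (appellMap H n k).1 z
      = ∑ r ∈ Finset.range (n + 1), (((1 - smoothing H) ^ r) (S.diagMap p₀ H.pos n k)).1 z := by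
    simp only [appellMap, LinearMap.comp_apply, LinearMap.sum_apply, Submodule.coe_sum,
      Finset.sum_apply]
  rw [h1]
  set X := (S.hsNorm p k.1).toReal * (n.factorial / ε ^ n) with hX
  have hX0 : 0 ≤ X := by positivity
  set Y := Real.exp (ε * (S.dualNorm p z).toReal)
  have hY0 : 0 ≤ Y := (Real.exp_pos _).le
  have h2 : ∀ r ∈ Finset.range (n + 1),
      ‖(((1 - smoothing H) ^ r) (S.diagMap p₀ H.pos n k)).1 z‖ ≤ X * (1 + K) ^ n * Y := by
    intro r hr
    refine (H.expBound_one_sub_pow hp (S.expBound_diag k p H.pos) r z hz).trans ?_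
    have : (1 + K) ^ r ≤ (1 + K) ^ n :=
      pow_le_pow_right₀ (by linarith) (Nat.lt_succ_iff.1 (Finset.mem_range.1 hr))
    gcongr
  refine (norm_sum_le_of_le _ h2).trans ?_
  rw [Finset.sum_const, Finset.card_range, nsmul_eq_mul]
  have h3 : ((n + 1 : ℕ) : ℝ) ≤ 2 ^ n := by exact_mod_cast n.lt_two_pow_self
  calc ((n + 1 : ℕ) : ℝ) * (X * (1 + K) ^ n * Y) ≤ 2 ^ n * (X * (1 + K) ^ n * Y) := by gcongr
    _ = _ := by rw [hX, div_pow, mul_pow]; field_simp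

end NuclearNorms

end NonGaussian

namespace NonGaussian

/-! ## Taylor series of one variable -/

/-- The Taylor series of a function at `0`. -/
noncomputable def taylorSeries (f : ℂ → ℂ) : PowerSeries ℂ :=
  PowerSeries.mk fun n => (n.factorial : ℂ)⁻¹ * iteratedDeriv n f 0

theorem taylorSeries_mul {f g : ℂ → ℂ} (hf : AnalyticAt ℂ f 0) (hg : AnalyticAt ℂ g 0) :
    taylorSeries (fun t => f t * g t) = taylorSeries f * taylorSeries g := by
  ext n
  rw [PowerSeries.coeff_mul, Finset.Nat.sum_antidiagonal_eq_sum_range_succ_mk]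
  simp only [taylorSeries, PowerSeries.coeff_mk]
  rw [iteratedDeriv_fun_mul hf.contDiffAt hg.contDiffAt, Finset.mul_sum]
  refine Finset.sum_congr rfl fun i hi => ?_
  have hi' : i ≤ n := Nat.lt_succ_iff.1 (Finset.mem_range.1 hi)
  have h1 : (n.factorial : ℂ) ≠ 0 := by exact_mod_cast n.factorial_ne_zero
  have h2 : (i.factorial : ℂ) ≠ 0 := by exact_mod_cast i.factorial_ne_zero
  have h3 : ((n - i).factorial : ℂ) ≠ 0 := by exact_mod_cast (n - i).factorial_ne_zero
  rw [Nat.cast_choose ℂ hi']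
  field_simp

theorem taylorSeries_congr {f g : ℂ → ℂ} (h : f =ᶠ[nhds 0] g) :
    taylorSeries f = taylorSeries g := by
  ext n
  simp only [taylorSeries, PowerSeries.coeff_mk, h.iteratedDeriv_eq n]

theorem analyticAt_and_taylorSeries_eq {f : ℂ → ℂ} {M : PowerSeries ℂ} {r : ℝ} (hr : 0 < r)
    (h : ∀ t : ℂ, ‖t‖ ≤ r → HasSum (fun n => t ^ n * PowerSeries.coeff n M) (f t)) :
    AnalyticAt ℂ f 0 ∧ taylorSeries f = M := by
  have h1 : HasFPowerSeriesAt f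
      (FormalMultilinearSeries.ofScalars ℂ fun n => PowerSeries.coeff n M) 0 := by
    rw [hasFPowerSeriesAt_iff]
    filter_upwards [Metric.closedBall_mem_nhds (0 : ℂ) hr] with t ht
    simpa [FormalMultilinearSeries.coeff_ofScalars] using h t (by simpa using ht)
  refine ⟨h1.analyticAt, ?_⟩
  ext n
  obtain ⟨ρ, h2⟩ := h1
  have h3 := h2.factorial_smul (1 : ℂ) n
  have h4 : (n.factorial : ℂ) ≠ 0 := by exact_mod_cast n.factorial_ne_zero
  rw [taylorSeries, PowerSeries.coeff_mk, iteratedDeriv_eq_iteratedFDeriv, ← h3]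
  simp [FormalMultilinearSeries.ofScalars, h4]

/-- The series `1 - M` is divisible by `X`. This is the algebraic reason why the Neumann series for
the inverse of `C_μ` terminates in each degree. -/
theorem coeff_pow_mul_eq_zero {M Q : PowerSeries ℂ} (hM : PowerSeries.coeff 0 M = 1) (n : ℕ) :
    PowerSeries.coeff n ((1 - M) ^ (n + 1) * Q) = 0 := by
  have h1 : PowerSeries.X ∣ 1 - M := PowerSeries.X_dvd_iff.2 (by
    rw [← PowerSeries.coeff_zero_eq_constantCoeff_apply, map_sub, hM]; simp)
  exact PowerSeries.X_pow_dvd_iff.1 ((pow_dvd_pow_of_dvd h1 (n + 1)).mul_right Q) n n.lt_succ_self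

/-- The exponential series `∑ aⁿ tⁿ / n!`. -/
noncomputable def expSeries (a : ℂ) : PowerSeries ℂ :=
  PowerSeries.mk fun n => (n.factorial : ℂ)⁻¹ * a ^ n

theorem coeff_expSeries (a : ℂ) (n : ℕ) :
    PowerSeries.coeff n (expSeries a) = (n.factorial : ℂ)⁻¹ * a ^ n := PowerSeries.coeff_mk _ _

theorem hasSum_expSeries (a t : ℂ) :
    HasSum (fun n => t ^ n * PowerSeries.coeff n (expSeries a)) (Complex.exp (t * a)) := by
  have h := NormedSpace.expSeries_div_hasSum_exp (t * a)
  rw [← Complex.exp_eq_exp_ℂ] at h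
  have e : (fun n => t ^ n * PowerSeries.coeff n (expSeries a))
      = fun n => (t * a) ^ n / (n.factorial : ℂ) := funext fun n => by
    rw [coeff_expSeries, mul_pow]; ring
  rw [e]
  exact h

theorem expSeries_add (a b : ℂ) : expSeries (a + b) = expSeries a * expSeries b := by
  have h := fun a => (analyticAt_and_taylorSeries_eq one_pos fun t _ => hasSum_expSeries a t)
  rw [← (h a).2, ← (h b).2, ← (h (a + b)).2, ← taylorSeries_mul (h a).1 (h b).1]
  simp only [mul_add, Complex.exp_add]

namespace NuclearNorms

variable {N : Type*} [AddCommGroup N] [Module ℝ N] [TopologicalSpace N] {S : NuclearNorms N}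
variable {μ : Measure (N →L[ℝ] ℝ)} {p₀ : ℕ} {ε K : ℝ}

/-! ## The Appell kernels -/

theorem pairing_cmul (z : N →L[ℝ] ℂ) (t : ℂ) (θ : N × N) :
    pairing z (cmul t θ) = t * pairing z θ := by
  simp only [pairing, cmul, map_sub, map_add, map_smul, Complex.real_smul]
  linear_combination (-(z θ.2) * t.im) * Complex.I_sq +
    (z θ.1 + Complex.I * z θ.2) * Complex.re_add_im t

/-- The moment series `∑ (tⁿ / n!) ∫ ⟨x, θ⟩ⁿ dμ(x)`. -/
noncomputable def momentSeries (μ : Measure (N →L[ℝ] ℝ)) (θ : N × N) : PowerSeries ℂ :=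
  PowerSeries.mk fun n => (n.factorial : ℂ)⁻¹ * ∫ x, pairing (toComplex x) θ ^ n ∂μ

theorem measurable_pairing_toComplex (θ : N × N) :
    Measurable fun x : N →L[ℝ] ℝ => pairing (toComplex x) θ := by
  have h := fun ξ : N => Complex.measurable_ofReal.comp (measurable_apply ξ)
  exact (h θ.1).add ((h θ.2).const_mul Complex.I)

/-- For `|t| (|θ|_{p₀} + 1) ≤ ε` one has `|t⟨x, θ⟩| ≤ ε |x|_{-p₀}` almost everywhere, so the
exponential series is dominated by that of `exp(ε |x|_{-p₀})`, which is integrable. The `+ 1` avoids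
a division by zero at `θ = 0`. -/
theorem ExpMoment.laplace_taylor (H : S.ExpMoment μ p₀ ε K) (θ : N × N) :
    AnalyticAt ℂ (fun t => laplace μ (cmul t θ)) 0 ∧
      taylorSeries (fun t => laplace μ (cmul t θ)) = momentSeries μ θ := by
  have hc := S.cnorm_nonneg p₀ θ
  have hε := H.pos
  refine analyticAt_and_taylorSeries_eq (r := ε / (S.cnorm p₀ θ + 1)) (by positivity)
    fun t ht => ?_
  rw [le_div_iff₀ (by positivity)] at ht
  simp only [laplace, pairing_cmul, momentSeries, PowerSeries.coeff_mk]
  have h1 : ∀ n : ℕ, t ^ n * ((n.factorial : ℂ)⁻¹ * ∫ x, pairing (toComplex x) θ ^ n ∂μ)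
      = ∫ x, t ^ n * PowerSeries.coeff n (expSeries (pairing (toComplex x) θ)) ∂μ := by
    intro n
    simp only [coeff_expSeries, integral_const_mul]
  simp_rw [h1]
  have hb : ∀ x : N →L[ℝ] ℝ, HasSum
      (fun n : ℕ => (ε * (S.dualNorm p₀ (toComplex x)).toReal) ^ n / n.factorial)
      (Real.exp (ε * (S.dualNorm p₀ (toComplex x)).toReal)) := fun x => by
    have := NormedSpace.expSeries_div_hasSum_exp (ε * (S.dualNorm p₀ (toComplex x)).toReal)
    rwa [← Real.exp_eq_exp_ℝ] at this
  refine hasSum_integral_of_dominated_convergence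
    (fun n x => (ε * (S.dualNorm p₀ (toComplex x)).toReal) ^ n / n.factorial) (fun n => ?_)
    (fun n => ?_) (Filter.Eventually.of_forall fun x => (hb x).summable) ?_
    (Filter.Eventually.of_forall fun x => hasSum_expSeries _ t)
  · simp only [coeff_expSeries]
    exact ((((measurable_pairing_toComplex θ).pow_const n).const_mul _).const_mul
      _).aestronglyMeasurable
  · filter_upwards [H.ae_ne_top p₀ le_rfl] with x hx
    rw [coeff_expSeries, norm_mul, norm_mul, norm_inv, norm_pow, norm_pow, Complex.norm_natCast,
      mul_left_comm, ← mul_pow, mul_comm, div_eq_mul_inv]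
    refine mul_le_mul_of_nonneg_right (pow_le_pow_left₀ (by positivity) ?_ n) (by positivity)
    calc ‖t‖ * ‖pairing (toComplex x) θ‖
        ≤ ‖t‖ * ((S.dualNorm p₀ (toComplex x)).toReal * (S.cnorm p₀ θ + 1)) := by
          gcongr
          refine (S.norm_pairing_le p₀ hx θ).trans ?_
          gcongr; linarith
      _ = ‖t‖ * (S.cnorm p₀ θ + 1) * (S.dualNorm p₀ (toComplex x)).toReal := by ring
      _ ≤ _ := by gcongr
  · simp_rw [fun x => (hb x).tsum_eq]
    exact H.integrable p₀ le_rfl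

theorem coeff_zero_momentSeries [IsProbabilityMeasure μ] (θ : N × N) :
    PowerSeries.coeff 0 (momentSeries μ θ) = 1 := by
  simp [momentSeries]

/-- The polynomial `∑ᵢ fᵢ ⟨z, θ⟩^{n-i} / (n-i)!`, the `n`-th coefficient of `f(t) exp(t⟨z, θ⟩)`. -/
noncomputable def polyMap (S : NuclearNorms N) (p₀ : ℕ) {ε : ℝ} (hε : 0 < ε) (θ : N × N) (n : ℕ) :
    PowerSeries ℂ →ₗ[ℂ] S.ExpGrowth p₀ ε where
  toFun f := ∑ i ∈ Finset.HasAntidiagonal.antidiagonal n,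
    (PowerSeries.coeff i.1 f * (i.2.factorial : ℂ)⁻¹) • S.diagMap p₀ hε i.2 (S.powKernel i.2 θ)
  map_add' f g := by simp only [map_add, add_mul, add_smul, Finset.sum_add_distrib]
  map_smul' c f := by
    simp only [map_smul, smul_eq_mul, mul_assoc, Finset.smul_sum, RingHom.id_apply, smul_smul]

theorem polyMap_apply (hε : 0 < ε) (θ : N × N) (n : ℕ) (f : PowerSeries ℂ) (z : N →L[ℝ] ℂ) :
    (polyMap S p₀ hε θ n f).1 z = PowerSeries.coeff n (f * expSeries (pairing z θ)) := by
  rw [PowerSeries.coeff_mul]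
  simp only [polyMap, LinearMap.coe_mk, AddHom.coe_mk, Submodule.coe_sum, Finset.sum_apply,
    Submodule.coe_smul, Pi.smul_apply, smul_eq_mul, coeff_expSeries, mul_assoc]
  refine Finset.sum_congr rfl fun i _ => ?_
  simp [diagMap, powKernel, powForm_apply]

/-- The coefficient of `tⁿ` in the identity `∫ f(t) exp(t⟨x + z, θ⟩) dμ(x) = f(t) l_μ(tθ) exp(t⟨z,
θ⟩)`. Taken coefficientwise it only involves finite sums and moments. -/
theorem smoothing_polyMap [IsProbabilityMeasure μ] (H : S.ExpMoment μ p₀ ε K) (θ : N × N) (n : ℕ)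
    (f : PowerSeries ℂ) : smoothing H (polyMap S p₀ H.pos θ n f)
      = polyMap S p₀ H.pos θ n (f * momentSeries μ θ) := by
  ext z
  rw [smoothing_apply, polyMap_apply]
  simp only [polyMap_apply, pairing_add, expSeries_add]
  simp_rw [mul_left_comm f, ← mul_assoc, mul_comm (expSeries _) f, mul_right_comm f,
    PowerSeries.coeff_mul n _ (expSeries (pairing (toComplex _) θ))]
  have hint : ∀ j : ℕ, Integrable (fun x => pairing (toComplex x) θ ^ j) μ := fun j => by
    have h := H.integrable_translate (S.diagMap p₀ H.pos j (S.powKernel j θ)) 0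
    simpa [diagMap, powKernel, powForm_apply] using h
  rw [PowerSeries.coeff_mul, integral_finsetSum]
  · refine Finset.sum_congr rfl fun i _ => ?_
    simp only [coeff_expSeries, integral_const_mul, momentSeries, PowerSeries.coeff_mk]
  · intro i _
    simp only [coeff_expSeries]
    exact ((hint _).const_mul _).const_mul _

theorem one_sub_smoothing_pow_polyMap [IsProbabilityMeasure μ] (H : S.ExpMoment μ p₀ ε K)
    (θ : N × N) (n r : ℕ) (f : PowerSeries ℂ) :
    ((1 - smoothing H) ^ r) (polyMap S p₀ H.pos θ n f)
      = polyMap S p₀ H.pos θ n (f * (1 - momentSeries μ θ) ^ r) := by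
  induction r generalizing f with
  | zero => simp
  | succ r ih =>
    rw [pow_succ, Module.End.mul_apply, LinearMap.sub_apply, Module.End.one_apply,
      smoothing_polyMap, ← map_sub, ih]
    congr 1; ring

theorem appellMap_powKernel [IsProbabilityMeasure μ] (H : S.ExpMoment μ p₀ ε K) (θ : N × N)
    (n : ℕ) : appellMap H n (S.powKernel n θ) = (n.factorial : ℂ) • polyMap S p₀ H.pos θ n
      (∑ r ∈ Finset.range (n + 1), (1 - momentSeries μ θ) ^ r) := by
  have h1 : S.diagMap p₀ H.pos n (S.powKernel n θ)
      = (n.factorial : ℂ) • polyMap S p₀ H.pos θ n 1 := by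
    ext z
    have h0 : (n.factorial : ℂ) ≠ 0 := by exact_mod_cast n.factorial_ne_zero
    rw [Submodule.coe_smul, Pi.smul_apply, polyMap_apply, one_mul, coeff_expSeries, smul_eq_mul,
      mul_inv_cancel_left₀ h0]
    simp [diagMap, powKernel, powForm_apply]
  rw [appellMap, LinearMap.comp_apply, h1, map_smul, LinearMap.sum_apply, map_sum]
  simp only [one_sub_smoothing_pow_polyMap, one_mul]

/-- The functional `k ↦ ⟨P_n^μ(z), k⟩`. -/
noncomputable def appellFun [SFinite μ] (H : S.ExpMoment μ p₀ ε K) (n : ℕ) (z : N →L[ℝ] ℂ) :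
    S.SymKernel n →ₗ[ℂ] ℂ :=
  LinearMap.proj z ∘ₗ (S.ExpGrowth p₀ ε).subtype ∘ₗ appellMap H n

theorem appellFun_apply [SFinite μ] (H : S.ExpMoment μ p₀ ε K) (n : ℕ) (z : N →L[ℝ] ℂ)
    (k : S.SymKernel n) : appellFun H n z k = (appellMap H n k).1 z := rfl

/-- Let `Q` be the Taylor series of `exp(t⟨z, θ⟩) / l_μ(tθ)`, analytic at `0` as `l_μ(0) = 1`. Then
`Q * M` is the exponential series, and the geometric sum gives `(∑_{r ≤ n} (1 - M)^r) Q M = Q - (1 -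
M)^{n+1} Q`, whose `n`-th coefficient is that of `Q`. -/
theorem ExpMoment.isAppell_appellFun [IsProbabilityMeasure μ] (H : S.ExpMoment μ p₀ ε K) (n : ℕ)
    (z : N →L[ℝ] ℂ) : S.IsAppell μ n z (appellFun H n z) := by
  obtain ⟨q, hq⟩ := S.exists_dualNorm_ne_top z
  refine ⟨⟨max p₀ q, _, fun k => (H.expBound_appellMap n k (le_max_left _ _) z
    (hq _ (le_max_right _ _))).trans_eq (by rw [mul_assoc, mul_comm])⟩, fun θ => ?_⟩
  obtain ⟨hl, hM⟩ := H.laplace_taylor θ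
  set M := momentSeries μ θ
  have hM0 : PowerSeries.coeff 0 M = 1 := coeff_zero_momentSeries θ
  have hl0 : laplace μ (cmul 0 θ) = 1 := by
    rw [← hM] at hM0
    simpa [taylorSeries] using hM0
  obtain ⟨he, hE⟩ := analyticAt_and_taylorSeries_eq one_pos
    fun t _ => hasSum_expSeries (pairing z θ) t
  have hdiv : AnalyticAt ℂ
      (fun t : ℂ => Complex.exp (t * pairing z θ) / laplace μ (cmul t θ)) 0 := he.div hl (by rw [hl0]; exact one_ne_zero)
  set Q := taylorSeries fun t : ℂ => Complex.exp (t * pairing z θ) / laplace μ (cmul t θ) with hQ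
  have hQM : Q * M = expSeries (pairing z θ) := by
    rw [← hM, hQ, ← taylorSeries_mul hdiv hl, ← hE]
    refine taylorSeries_congr ?_
    filter_upwards [hl.continuousAt.eventually_ne (by rw [hl0]; exact one_ne_zero)] with t ht
    exact div_mul_cancel₀ _ ht
  have h1 : (∑ r ∈ Finset.range (n + 1), (1 - M) ^ r) * expSeries (pairing z θ)
      = Q - (1 - M) ^ (n + 1) * Q := by
    have h2 := geom_sum_mul_neg (1 - M) (n + 1)
    rw [sub_sub_cancel] at h2
    rw [← hQM, mul_comm Q, ← mul_assoc, h2, sub_mul, one_mul]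
  have h0 : (n.factorial : ℂ) ≠ 0 := by exact_mod_cast n.factorial_ne_zero
  rw [appellFun_apply, appellMap_powKernel, Submodule.coe_smul, Pi.smul_apply, polyMap_apply, h1,
    map_sub, coeff_pow_mul_eq_zero hM0, sub_zero, hQ, taylorSeries, PowerSeries.coeff_mk,
    smul_eq_mul, mul_inv_cancel_left₀ h0]

/-- The two functionals may be bounded by different norms, which is why `eq_zero_of_powKernel`
admits two indices. -/
theorem IsAppell.unique {n : ℕ} {z : N →L[ℝ] ℂ} {P Q : S.SymKernel n →ₗ[ℂ] ℂ}
    (hP : S.IsAppell μ n z P) (hQ : S.IsAppell μ n z Q) : P = Q := by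
  obtain ⟨⟨p, C, hp⟩, hP'⟩ := hP
  obtain ⟨⟨q, D, hq⟩, hQ'⟩ := hQ
  refine sub_eq_zero.1 (S.eq_zero_of_powKernel (P - Q) p q (max C D) (fun k => ?_) fun ξ => ?_)
  · rw [LinearMap.sub_apply, mul_add]
    exact (norm_sub_le _ _).trans (add_le_add
      ((hp k).trans (mul_le_mul_of_nonneg_right (le_max_left _ _) ENNReal.toReal_nonneg))
      ((hq k).trans (mul_le_mul_of_nonneg_right (le_max_right _ _) ENNReal.toReal_nonneg)))
  · rw [LinearMap.sub_apply, hP', hQ', sub_self]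

theorem ExpMoment.appell_eq [IsProbabilityMeasure μ] (H : S.ExpMoment μ p₀ ε K) (n : ℕ)
    (z : N →L[ℝ] ℂ) : S.appell μ n z = appellFun H n z :=
  IsAppell.unique (Classical.epsilon_spec ⟨_, H.isAppell_appellFun n z⟩) (H.isAppell_appellFun n z)

end NuclearNorms

end NonGaussian

namespace NonGaussian

namespace NuclearNorms

variable {N : Type*} [AddCommGroup N] [Module ℝ N] [TopologicalSpace N] {S : NuclearNorms N}
variable {μ : Measure (N →L[ℝ] ℝ)} {p₀ : ℕ} {ε K : ℝ}

/-! ## Convolution of test functions -/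

/-- Both sides are bounded functionals of `k`, so powers `ξ^{⊗n}` suffice. There the geometric sum
times `M` telescopes to `1 - (1 - M)^{n+1}`, and the last term does not reach the coefficient of
`tⁿ`. -/
theorem ExpMoment.smoothing_appellMap [IsProbabilityMeasure μ] (H : S.ExpMoment μ p₀ ε K) (n : ℕ)
    (k : S.SymKernel n) (z : N →L[ℝ] ℂ) :
    ∫ x, (appellMap H n k).1 (toComplex x + z) ∂μ = k.1 fun _ => z := by
  let ev : S.ExpGrowth p₀ ε →ₗ[ℂ] ℂ := LinearMap.proj z ∘ₗ (S.ExpGrowth p₀ ε).subtype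
  suffices h : ev ∘ₗ (smoothing H ∘ₗ appellMap H n - S.diagMap p₀ H.pos n) = 0 from
    sub_eq_zero.1 (LinearMap.congr_fun h k)
  obtain ⟨q, hq⟩ := S.exists_dualNorm_ne_top z
  have hz := hq (max p₀ q) (le_max_right _ _)
  set p := max p₀ q
  have hp : p₀ ≤ p := le_max_left _ _
  set Y := Real.exp (ε * (S.dualNorm p z).toReal)
  refine S.eq_zero_of_powKernel _ p p (max ((n.factorial * (2 * (1 + K) / ε) ^ n) * K * Y)
    (n.factorial / ε ^ n * Y)) (fun k => ?_) fun ξ => ?_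
  · have h1 := H.expBound_integral hp (H.expBound_appellMap n k hp) z hz
    have h2 := S.expBound_diag k p H.pos z hz
    have h3 : (0 : ℝ) ≤ (S.hsNorm p k.1).toReal := ENNReal.toReal_nonneg
    change ‖(∫ x, (appellMap H n k).1 (toComplex x + z) ∂μ) - (S.diagMap p₀ H.pos n k).1 z‖ ≤ _
    refine (norm_sub_le _ _).trans ?_
    rw [mul_add]
    refine add_le_add (h1.trans ?_) (h2.trans ?_)
    · calc _ = ((n.factorial * (2 * (1 + K) / ε) ^ n) * K * Y) * (S.hsNorm p k.1).toReal := by ring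
        _ ≤ _ := mul_le_mul_of_nonneg_right (le_max_left _ _) h3
    · calc _ = (n.factorial / ε ^ n * Y) * (S.hsNorm p k.1).toReal := by ring
        _ ≤ _ := mul_le_mul_of_nonneg_right (le_max_right _ _) h3
  · have h0 : (n.factorial : ℂ) ≠ 0 := by exact_mod_cast n.factorial_ne_zero
    set M := momentSeries μ (ξ, 0)
    have hM0 : PowerSeries.coeff 0 M = 1 := coeff_zero_momentSeries _
    have h2 := geom_sum_mul_neg (1 - M) (n + 1)
    rw [sub_sub_cancel] at h2
    change (smoothing H (appellMap H n (S.powKernel n (ξ, 0)))).1 z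
      - (S.diagMap p₀ H.pos n (S.powKernel n (ξ, 0))).1 z = 0
    rw [appellMap_powKernel, map_smul, smoothing_polyMap, Submodule.coe_smul, Pi.smul_apply,
      polyMap_apply, h2, sub_mul, one_mul, map_sub, coeff_pow_mul_eq_zero hM0, sub_zero,
      coeff_expSeries, smul_eq_mul, mul_inv_cancel_left₀ h0]
    simp [diagMap, powKernel, powForm_apply]

/-- A single term of the weighted sum. The even index `2 * s` keeps the exponent an integer after
taking the square root. -/
theorem le_seqNorm (S : NuclearNorms N) (p s n : ℕ) (k : ∀ n, (Fin n → (N →L[ℝ] ℂ)) → ℂ) :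
    (n.factorial : ℝ≥0∞) * 2 ^ (n * s) * S.hsNorm p (k n) ≤ S.seqNorm p (2 * s) k := by
  have h : (n.factorial : ℝ≥0∞) ^ 2 * 2 ^ (n * (2 * s)) * S.hsNorm p (k n) ^ 2
      = ((n.factorial : ℝ≥0∞) * 2 ^ (n * s) * S.hsNorm p (k n)) ^ (2 : ℝ) := by
    rw [ENNReal.rpow_two, mul_pow, mul_pow, ← pow_mul, mul_assoc n, mul_comm 2 s]
  calc _ = (((n.factorial : ℝ≥0∞) * 2 ^ (n * s) * S.hsNorm p (k n)) ^ (2 : ℝ)) ^ (1 / 2 : ℝ) := by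
        rw [← ENNReal.rpow_mul]; norm_num
    _ ≤ _ := ENNReal.rpow_le_rpow (h ▸ ENNReal.le_tsum n) (by norm_num)

theorem hsNorm_kernel_le (φ : S.TestSpace μ) (p s n : ℕ) :
    (S.hsNorm p (φ.1 n).1).toReal
      ≤ (S.testNorm p (2 * s) φ).toReal * ((n.factorial : ℝ)⁻¹ * (2⁻¹ ^ s) ^ n) := by
  have h := ENNReal.toReal_mono (φ.2 p (2 * s)) (S.le_seqNorm p s n fun n => (φ.1 n).1)
  rw [ENNReal.toReal_mul, ENNReal.toReal_mul, ENNReal.toReal_natCast, ENNReal.toReal_pow,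
    ENNReal.toReal_ofNat] at h
  have h0 : (0 : ℝ) < n.factorial := by exact_mod_cast n.factorial_pos
  calc (S.hsNorm p (φ.1 n).1).toReal
      = ((n.factorial : ℝ) * 2 ^ (n * s) * (S.hsNorm p (φ.1 n).1).toReal) *
        ((n.factorial : ℝ)⁻¹ * (2⁻¹ ^ s) ^ n) := by
        rw [← pow_mul, inv_pow, mul_comm s n]; field_simp
    _ ≤ _ := mul_le_mul_of_nonneg_right h (by positivity)

/-- Since all weights `2^{nq}` are available, `s` can be taken with `2 R < 2^s`; then `2^{-s} R ≤
1/2`. -/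
theorem exists_hsNorm_le_geometric (φ : S.TestSpace μ) (p : ℕ) {R : ℝ} (hR : 0 ≤ R) :
    ∃ A, 0 ≤ A ∧ ∀ n : ℕ,
      (S.hsNorm p (φ.1 n).1).toReal * (n.factorial * R ^ n) ≤ A * 2⁻¹ ^ n := by
  obtain ⟨s, hs⟩ := pow_unbounded_of_one_lt (2 * R) (one_lt_two)
  refine ⟨(S.testNorm p (2 * s) φ).toReal, ENNReal.toReal_nonneg, fun n => ?_⟩
  have h0 : (0 : ℝ) < n.factorial := by exact_mod_cast n.factorial_pos
  have h1 : 2⁻¹ ^ s * R ≤ 2⁻¹ := by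
    rw [inv_pow, inv_mul_le_iff₀ (by positivity)]; linarith
  calc _ ≤ (S.testNorm p (2 * s) φ).toReal * ((n.factorial : ℝ)⁻¹ * (2⁻¹ ^ s) ^ n) *
        (n.factorial * R ^ n) :=
        mul_le_mul_of_nonneg_right (hsNorm_kernel_le φ p s n) (by positivity)
    _ = (S.testNorm p (2 * s) φ).toReal * (2⁻¹ ^ s * R) ^ n := by rw [mul_pow]; field_simp
    _ ≤ _ := mul_le_mul_of_nonneg_left (pow_le_pow_left₀ (by positivity) h1 n)
        ENNReal.toReal_nonneg

theorem ExpMoment.exists_appell_le [IsProbabilityMeasure μ] (H : S.ExpMoment μ p₀ ε K)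
    (φ : S.TestSpace μ) {p : ℕ} (hp : p₀ ≤ p) :
    ∃ A, 0 ≤ A ∧ ∀ n, S.ExpBound p ε (A * 2⁻¹ ^ n) fun z => S.appell μ n z (φ.1 n) := by
  have hK := H.nonneg
  have hε := H.pos
  obtain ⟨A, hA0, hA⟩ := exists_hsNorm_le_geometric φ p (R := 2 * (1 + K) / ε) (by positivity)
  refine ⟨A, hA0, fun n z hz => ?_⟩
  change ‖S.appell μ n z (φ.1 n)‖ ≤ _
  rw [H.appell_eq n z]
  exact (H.expBound_appellMap n (φ.1 n) hp z hz).trans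
    (mul_le_mul_of_nonneg_right (hA n) (Real.exp_pos _).le)

theorem summable_geometric_half (A : ℝ) : Summable fun n : ℕ => A * 2⁻¹ ^ n :=
  (summable_geometric_of_lt_one (by norm_num) (by norm_num)).mul_left A

theorem ExpMoment.summable_appell [IsProbabilityMeasure μ] (H : S.ExpMoment μ p₀ ε K)
    (φ : S.TestSpace μ) (z : N →L[ℝ] ℂ) : Summable fun n => S.appell μ n z (φ.1 n) := by
  obtain ⟨q, hq⟩ := S.exists_dualNorm_ne_top z
  obtain ⟨A, -, hA⟩ := H.exists_appell_le φ (le_max_left p₀ q)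
  exact Summable.of_norm_bounded ((summable_geometric_half A).mul_right _)
    fun n => hA n z (hq _ (le_max_right _ _))

theorem ExpMoment.expBound_testFun [IsProbabilityMeasure μ] (H : S.ExpMoment μ p₀ ε K)
    (φ : S.TestSpace μ) {p : ℕ} (hp : p₀ ≤ p) : ∃ A, S.ExpBound p ε A (S.testFun φ) := by
  obtain ⟨A, -, hA⟩ := H.exists_appell_le φ hp
  exact ⟨_, fun z hz => tsum_of_norm_bounded
    ((summable_geometric_half A).hasSum.mul_right _) fun n => hA n z hz⟩

theorem ExpMoment.measurable_appell [IsProbabilityMeasure μ] (H : S.ExpMoment μ p₀ ε K)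
    (n : ℕ) (k : S.SymKernel n) (z : N →L[ℝ] ℂ) :
    Measurable fun x : N →L[ℝ] ℝ => S.appell μ n (toComplex x + z) k := by
  simp_rw [H.appell_eq n]
  exact (appellMap H n k).2.1 z

theorem ExpMoment.integrable_testFun [IsProbabilityMeasure μ] (H : S.ExpMoment μ p₀ ε K)
    (φ : S.TestSpace μ) (z : N →L[ℝ] ℂ) :
    Integrable (fun x => S.testFun φ (toComplex x + z)) μ := by
  obtain ⟨q, hq⟩ := S.exists_dualNorm_ne_top z
  obtain ⟨A, hA⟩ := H.expBound_testFun φ (le_max_left p₀ q)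
  refine ((H.integrable _ (le_max_left p₀ q)).const_mul _).mono' (Measurable.aestronglyMeasurable ?_)
    (H.ae_norm_le (le_max_left _ _) hA (hq _ (le_max_right _ _)))
  exact Measurable.tsum fun n => H.measurable_appell n (φ.1 n) z

/-- The convolution of a test function has the Taylor kernels of the test function. -/
theorem ExpMoment.hasSum_conv [IsProbabilityMeasure μ] (H : S.ExpMoment μ p₀ ε K)
    (φ : S.TestSpace μ) (z : N →L[ℝ] ℂ) :
    HasSum (fun n => (φ.1 n).1 fun _ => z) (S.conv φ z) := by
  obtain ⟨q, hq⟩ := S.exists_dualNorm_ne_top z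
  have hz := hq (max p₀ q) (le_max_right _ _)
  set p := max p₀ q
  have hp : p₀ ≤ p := le_max_left _ _
  obtain ⟨A, -, hA⟩ := H.exists_appell_le φ hp
  have h1 : ∀ n, ((φ.1 n).1 fun _ => z) = ∫ x, S.appell μ n (toComplex x + z) (φ.1 n) ∂μ := by
    intro n
    rw [← H.smoothing_appellMap n (φ.1 n) z]
    simp_rw [H.appell_eq n]
    rfl
  simp_rw [h1]
  have hs : ∀ x : N →L[ℝ] ℝ, HasSum (fun n : ℕ => A * 2⁻¹ ^ n *
      Real.exp (ε * (S.dualNorm p z).toReal) * Real.exp (ε * (S.dualNorm p (toComplex x)).toReal))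
      ((∑' n : ℕ, A * 2⁻¹ ^ n) * Real.exp (ε * (S.dualNorm p z).toReal) *
        Real.exp (ε * (S.dualNorm p (toComplex x)).toReal)) := fun x =>
    ((summable_geometric_half A).hasSum.mul_right _).mul_right _
  refine hasSum_integral_of_dominated_convergence _
    (fun n => (H.measurable_appell n (φ.1 n) z).aestronglyMeasurable)
    (fun n => H.ae_norm_le hp (hA n) hz) (Filter.Eventually.of_forall fun x => (hs x).summable) ?_
    (Filter.Eventually.of_forall fun x => (H.summable_appell φ _).hasSum)
  simp_rw [fun x => (hs x).tsum_eq]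
  exact (H.integrable p hp).const_mul _

end NuclearNorms

end NonGaussian

namespace NonGaussian

namespace NuclearNorms

variable {N : Type*} [AddCommGroup N] [Module ℝ N] [TopologicalSpace N] {S : NuclearNorms N}
variable {μ : Measure (N →L[ℝ] ℝ)} {p₀ : ℕ} {ε K : ℝ}

/-! ## Convolutions of test functions are entire -/

/-- The power series with the kernels of `φ`, restricted to the span of finitely many vectors. -/
noncomputable def kernelSeries (φ : S.TestSpace μ) {m : ℕ} (u : Fin m → (N →L[ℝ] ℂ)) :
    FormalMultilinearSeries ℂ (Fin m → ℂ) ℂ := fun n =>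
  { (φ.1 n).1.compLinearMap fun _ => Fintype.linearCombination ℂ u with
    cont := by
      have h : ∀ t : Fin n → Fin m → ℂ, ((φ.1 n).1 fun j => ∑ i, t j i • u i) =
          ∑ r : Fin n → Fin m, (∏ j, t j (r j)) • (φ.1 n).1 fun j => u (r j) := fun t => by
        rw [MultilinearMap.map_sum]
        exact Finset.sum_congr rfl fun r _ => MultilinearMap.map_smul_univ _ _ _
      change Continuous fun t : Fin n → Fin m → ℂ => (φ.1 n).1 fun j => ∑ i, t j i • u i
      simp_rw [h]
      fun_prop }

theorem kernelSeries_apply (φ : S.TestSpace μ) {m : ℕ} (u : Fin m → (N →L[ℝ] ℂ)) (n : ℕ)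
    (t : Fin n → Fin m → ℂ) :
    kernelSeries φ u n t = (φ.1 n).1 fun j => ∑ i, t j i • u i := rfl

/-- The polarization constant is made geometric by `nⁿ / n! ≤ eⁿ`. -/
theorem norm_kernel_le_exp (p : ℕ) {n : ℕ} (k : S.SymKernel n) (v : Fin n → (N →L[ℝ] ℂ))
    (hv : ∀ i, S.dualNorm p (v i) ≠ ∞) :
    ‖k.1 v‖ ≤ (S.hsNorm p k.1).toReal * (2 * Real.exp 1) ^ n *
      ∏ i, (S.dualNorm p (v i)).toReal := by
  refine (S.norm_kernel_le p k v hv).trans (mul_le_mul_of_nonneg_right ?_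
    (Finset.prod_nonneg fun _ _ => ENNReal.toReal_nonneg))
  have h := Real.pow_div_factorial_le_exp (n : ℝ) n.cast_nonneg n
  rw [← mul_one (n : ℝ), Real.exp_nat_mul, mul_one] at h
  calc _ = (S.hsNorm p k.1).toReal * (2 ^ n * ((n : ℝ) ^ n / n.factorial)) := by ring
    _ ≤ _ := by
      rw [mul_pow]
      exact mul_le_mul_of_nonneg_left (mul_le_mul_of_nonneg_left h (by positivity))
        ENNReal.toReal_nonneg

/-- On the span of the `u i` the `n`-th term has norm at most `|φ^{(n)}|_p (2eD)ⁿ`, with `D` the sum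
of the dual norms of the `u i`; by `exists_hsNorm_le_geometric` this beats every power `rⁿ`. -/
theorem kernelSeries_radius (φ : S.TestSpace μ) {m : ℕ} (u : Fin m → (N →L[ℝ] ℂ)) :
    (kernelSeries φ u).radius = ∞ := by
  obtain ⟨p, hp⟩ := S.exists_forall_dualNorm_ne_top u
  obtain ⟨D, hD⟩ : ∃ D, D = ∑ i, (S.dualNorm p (u i)).toReal := ⟨_, rfl⟩
  have hD0 : 0 ≤ D := hD ▸ Finset.sum_nonneg fun _ _ => ENNReal.toReal_nonneg
  have hw : ∀ w : Fin m → ℂ, S.dualNorm p (∑ i, w i • u i) ≠ ∞ ∧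
      (S.dualNorm p (∑ i, w i • u i)).toReal ≤ D * ‖w‖ := by
    intro w
    have h1 := S.dualNorm_sum_le p Finset.univ fun i => w i • u i
    have h2 : ∑ i, S.dualNorm p (w i • u i) ≠ ∞ :=
      ENNReal.sum_ne_top.2 fun i _ => S.smul_ne_top' (w i) (hp p le_rfl i)
    refine ⟨ne_top_of_le_ne_top h2 h1, (ENNReal.toReal_mono h2 h1).trans ?_⟩
    rw [ENNReal.toReal_sum fun i _ => S.smul_ne_top' (w i) (hp p le_rfl i), hD, Finset.sum_mul]
    refine Finset.sum_le_sum fun i _ => ?_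
    rw [toReal_dualNorm_smul, mul_comm]
    exact mul_le_mul_of_nonneg_left (norm_le_pi_norm w i) ENNReal.toReal_nonneg
  have hnorm : ∀ n, ‖kernelSeries φ u n‖ ≤
      (S.hsNorm p (φ.1 n).1).toReal * (2 * Real.exp 1 * D) ^ n := by
    intro n
    refine ContinuousMultilinearMap.opNorm_le_bound (by positivity) fun t => ?_
    rw [kernelSeries_apply]
    refine (norm_kernel_le_exp p (φ.1 n) _ fun j => (hw (t j)).1).trans ?_
    have h3 := Finset.prod_le_prod (s := Finset.univ) (fun j _ => ENNReal.toReal_nonneg)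
      fun j (_ : j ∈ (Finset.univ : Finset (Fin n))) => (hw (t j)).2
    rw [Finset.prod_mul_distrib, Finset.prod_const, Finset.card_univ, Fintype.card_fin] at h3
    refine (mul_le_mul_of_nonneg_left h3 (by positivity)).trans_eq ?_
    rw [mul_pow _ D]
    ring
  refine ENNReal.eq_top_of_forall_nnreal_le fun r => ?_
  obtain ⟨A, hA0, hA⟩ := exists_hsNorm_le_geometric φ p
    (R := 2 * Real.exp 1 * D * r) (by positivity)
  refine FormalMultilinearSeries.le_radius_of_bound _ A fun n => ?_
  have h1 : (1 : ℝ) ≤ n.factorial := by exact_mod_cast n.factorial_pos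
  have h2 : (2⁻¹ : ℝ) ^ n ≤ 1 := pow_le_one₀ (by norm_num) (by norm_num)
  calc _ ≤ (S.hsNorm p (φ.1 n).1).toReal * (2 * Real.exp 1 * D) ^ n * r ^ n :=
        mul_le_mul_of_nonneg_right (hnorm n) (by positivity)
    _ = (S.hsNorm p (φ.1 n).1).toReal * (1 * (2 * Real.exp 1 * D * r) ^ n) := by
        rw [mul_pow _ (r : ℝ)]; ring
    _ ≤ (S.hsNorm p (φ.1 n).1).toReal * (n.factorial * (2 * Real.exp 1 * D * r) ^ n) := by
        gcongr
    _ ≤ A * 1 := (hA n).trans (mul_le_mul_of_nonneg_left h2 hA0)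
    _ = A := mul_one A

theorem ExpMoment.hasFPowerSeriesOnBall_conv [IsProbabilityMeasure μ]
    (H : S.ExpMoment μ p₀ ε K) (φ : S.TestSpace μ) {m : ℕ} (u : Fin m → (N →L[ℝ] ℂ)) :
    HasFPowerSeriesOnBall (fun t : Fin m → ℂ => S.conv φ (∑ i, t i • u i)) (kernelSeries φ u)
      0 ∞ where
  r_le := (kernelSeries_radius φ u).ge
  r_pos := ENNReal.zero_lt_top
  hasSum := fun {y} _ => by
    rw [zero_add]
    exact H.hasSum_conv φ _

/-- The `n`-th derivative at `0` is the sum over permutations of the `n`-th coefficient of the power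
series; symmetry of the kernel makes it `n!` equal terms, cancelling the factor in `taylorForm`. The
norm identity of the theorem follows at once. -/
theorem ExpMoment.taylorForm_conv [IsProbabilityMeasure μ]
    (H : S.ExpMoment μ p₀ ε K) (φ : S.TestSpace μ) (n : ℕ) :
    taylorForm (S.conv φ) n = (φ.1 n).1 := by
  ext v
  have h0 : (n.factorial : ℂ) ≠ 0 := by exact_mod_cast n.factorial_ne_zero
  have h1 : ∀ σ : Equiv.Perm (Fin n), kernelSeries φ v n
      (fun i => (Pi.single (σ i) 1 : Fin n → ℂ)) = (φ.1 n).1 v := by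
    intro σ
    rw [kernelSeries_apply, ← (φ.1 n).2.1 σ v]
    congr 1
    ext1 j
    rw [Finset.sum_eq_single (σ j) (fun x _ hx => by rw [Pi.single_eq_of_ne hx]; exact zero_smul ℂ (v x))
      (by simp), Pi.single_eq_same, one_smul, Function.comp_apply]
  rw [taylorForm, (H.hasFPowerSeriesOnBall_conv φ v).iteratedFDeriv_eq_sum_of_completeSpace,
    Finset.sum_congr rfl fun σ _ => h1 σ, Finset.sum_const, Finset.card_univ, Fintype.card_perm,
    Fintype.card_fin, nsmul_eq_mul, inv_mul_cancel_left₀ h0]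

/-- Since `|φ^{(n)}|_p ≤ ‖φ‖_{p,2l} 2^{-ln} / n!`, the Taylor series is dominated by the exponential
series at `2^{-l} |z|_{-p}`. -/
theorem ExpMoment.norm_conv_le [IsProbabilityMeasure μ] (H : S.ExpMoment μ p₀ ε K)
    (φ : S.TestSpace μ) (p l : ℕ) {z : N →L[ℝ] ℂ} (hz : S.dualNorm p z ≠ ∞) :
    ‖S.conv φ z‖ ≤ (S.testNorm p (2 * l) φ).toReal *
      Real.exp ((2 : ℝ)⁻¹ ^ l * (S.dualNorm p z).toReal) := by
  obtain ⟨B, hB⟩ : ∃ B, B = (S.testNorm p (2 * l) φ).toReal := ⟨_, rfl⟩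
  obtain ⟨y, hy⟩ : ∃ y, y = (S.dualNorm p z).toReal := ⟨_, rfl⟩
  have hexp : ∀ x : ℝ, HasSum (fun n : ℕ => x ^ n / n.factorial) (Real.exp x) := fun x => by
    rw [Real.exp_eq_exp_ℝ]
    exact NormedSpace.expSeries_div_hasSum_exp x
  have h := (hexp ((2 : ℝ)⁻¹ ^ l * y)).mul_left B
  rw [← hB, ← hy]
  rw [← (H.hasSum_conv φ z).tsum_eq]
  refine tsum_of_norm_bounded h fun n => (S.norm_diag_le p (φ.1 n) hz).trans ?_
  refine (mul_le_mul_of_nonneg_right (hsNorm_kernel_le φ p l n)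
    (pow_nonneg ENNReal.toReal_nonneg n)).trans_eq ?_
  rw [← hB, ← hy, mul_pow]
  ring

theorem ExpMoment.growthNorm_conv_le [IsProbabilityMeasure μ] (H : S.ExpMoment μ p₀ ε K)
    (φ : S.TestSpace μ) (p l : ℕ) :
    S.growthNorm p l (S.conv φ) ≤ S.testNorm p (2 * l) φ := by
  refine iSup₂_le fun z hz => ?_
  have h : S.testNorm p (2 * l) φ ≠ ∞ := φ.2 p (2 * l)
  rw [← ENNReal.ofReal_toReal h, ← ofReal_norm,
    ← ENNReal.ofReal_mul (norm_nonneg _)]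
  refine ENNReal.ofReal_le_ofReal ?_
  rw [Real.exp_neg, ← div_eq_mul_inv, div_le_iff₀ (Real.exp_pos _)]
  exact H.norm_conv_le φ p l hz

theorem ExpMoment.conv_mem_eMin [IsProbabilityMeasure μ] (H : S.ExpMoment μ p₀ ε K)
    (φ : S.TestSpace μ) : S.conv φ ∈ S.EMin := by
  refine ⟨fun p => ⟨fun z w _ _ => ?_, fun z hz => ⟨1, one_pos,
    (S.testNorm p (2 * 0) φ).toReal * Real.exp ((S.dualNorm p z).toReal + 1), fun w hw => ?_⟩⟩,
    fun p l => ne_top_of_le_ne_top (φ.2 p (2 * l)) (H.growthNorm_conv_le φ p l)⟩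
  -- The complex line `z + t • w` is the curve `t ↦ (1, t)` in the plane spanned by `z` and `w`,
  -- where the convolution is an everywhere convergent power series.
  · have h := (H.hasFPowerSeriesOnBall_conv φ ![z, w]).differentiableOn
    have h2 : Differentiable ℂ fun t : ℂ => (![1, t] : Fin 2 → ℂ) :=
      differentiable_pi.2 fun i => by fin_cases i <;> simp
    intro t
    have h3 := (h _ (by simp : (![1, t] : Fin 2 → ℂ) ∈ Metric.eball 0 ∞)).differentiableAt
      (by simp)
    have h4 := h3.comp t (h2 t)
    refine h4.congr_of_eventuallyEq (Filter.Eventually.of_forall fun t => ?_)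
    simp
  · have hw' : S.dualNorm p w ≠ ∞ := ne_top_of_le_ne_top ENNReal.ofReal_ne_top hw
    refine (H.norm_conv_le φ p 0 (S.add_ne_top' hz hw')).trans (mul_le_mul_of_nonneg_left
      (Real.exp_le_exp.2 ?_) ENNReal.toReal_nonneg)
    rw [pow_zero, one_mul]
    refine (S.toReal_dualNorm_add_le p hz hw').trans (add_le_add_right ?_ _)
    exact (ENNReal.toReal_mono ENNReal.ofReal_ne_top hw).trans (by simp)

end NuclearNorms

end NonGaussian

namespace NonGaussian

/-! ## Directional derivatives of entire functions -/

theorem norm_dslope_le {f : ℂ → ℂ} (hf : Differentiable ℂ f) {ρ M : ℝ}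
    (hM : ∀ t, ‖t‖ < ρ → ‖f t‖ ≤ M) {t : ℂ} (ht : ‖t‖ < ρ) : ‖dslope f 0 t‖ ≤ 2 * M / ρ := by
  have hρ : 0 < ρ := (norm_nonneg t).trans_lt ht
  refine Complex.norm_dslope_le_div_of_mapsTo_ball (R₂ := 2 * M) hf.differentiableOn
    (fun s hs => ?_) (mem_ball_zero_iff.2 ht)
  rw [mem_closedBall_iff_norm, two_mul]
  exact (norm_sub_le _ _).trans (add_le_add (hM s (mem_ball_zero_iff.1 hs))
    (hM 0 (by rwa [norm_zero])))

/-- The Schwarz lemma applied to the difference quotient itself. The bound depends on `f` only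
through `M` and `ρ`, which makes the convergence of difference quotients uniform over families of
lines. -/
theorem norm_dslope_sub_deriv_le {f : ℂ → ℂ} (hf : Differentiable ℂ f) {ρ M : ℝ}
    (hM : ∀ t, ‖t‖ < ρ → ‖f t‖ ≤ M) {t : ℂ} (ht : ‖t‖ < ρ) :
    ‖dslope f 0 t - deriv f 0‖ ≤ 4 * M / ρ / ρ * ‖t‖ := by
  have hρ : 0 < ρ := (norm_nonneg t).trans_lt ht
  have hd : DifferentiableOn ℂ (dslope f 0) Set.univ :=
    (Complex.differentiableOn_dslope Filter.univ_mem).2 hf.differentiableOn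
  have h := Complex.dist_le_div_mul_dist_of_mapsTo_ball (f := dslope f 0) (c := 0) (R₁ := ρ)
    (R₂ := 4 * M / ρ) (z := t) (hd.mono (Set.subset_univ _)) (fun s hs => ?_)
    (mem_ball_zero_iff.2 ht)
  · rwa [dslope_same, dist_eq_norm, dist_zero_right] at h
  · rw [mem_closedBall_iff_norm]
    refine (norm_sub_le _ _).trans ((add_le_add (norm_dslope_le hf hM (mem_ball_zero_iff.1 hs))
      (norm_dslope_le hf hM (by rwa [norm_zero]))).trans_eq (by ring))

theorem tendsto_const_mul_norm (C : ℝ) :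
    Filter.Tendsto (fun t : ℂ => C * ‖t‖) (nhds 0) (nhds 0) := by
  simpa using (tendsto_norm_zero (E := ℂ)).const_mul C

namespace NuclearNorms

variable {N : Type*} [AddCommGroup N] [Module ℝ N] [TopologicalSpace N] {S : NuclearNorms N}

/-- Functions that are entire on every `H_{-p}`. -/
def Entire (S : NuclearNorms N) : Submodule ℂ ((N →L[ℝ] ℂ) → ℂ) where
  carrier := {F | ∀ p, S.IsEntireOn p F}
  zero_mem' := fun p => (S.EMin.zero_mem.1 p)
  add_mem' := by
    intro F G hF hG
    refine fun p => ⟨fun z w hz hw => ((hF p).1 z w hz hw).add ((hG p).1 z w hz hw),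
      fun z hz => ?_⟩
    obtain ⟨r, hr, M, hM⟩ := (hF p).2 z hz
    obtain ⟨r', hr', M', hM'⟩ := (hG p).2 z hz
    refine ⟨min r r', lt_min hr hr', M + M', fun w hw => ?_⟩
    exact (norm_add_le _ _).trans (add_le_add
      (hM w (hw.trans (ENNReal.ofReal_le_ofReal (min_le_left _ _))))
      (hM' w (hw.trans (ENNReal.ofReal_le_ofReal (min_le_right _ _)))))
  smul_mem' := by
    intro c F hF
    refine fun p => ⟨fun z w hz hw => ((hF p).1 z w hz hw).const_mul c, fun z hz => ?_⟩
    obtain ⟨r, hr, M, hM⟩ := (hF p).2 z hz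
    refine ⟨r, hr, ‖c‖ * M, fun w hw => ?_⟩
    rw [Pi.smul_apply, norm_smul]
    exact mul_le_mul_of_nonneg_left (hM w hw) (norm_nonneg c)

theorem differentiable_line {F : (N →L[ℝ] ℂ) → ℂ} (hF : F ∈ S.Entire) (z w : N →L[ℝ] ℂ) :
    Differentiable ℂ fun t : ℂ => F (z + t • w) := by
  obtain ⟨p, hp⟩ := S.exists_dualNorm_ne_top z
  obtain ⟨q, hq⟩ := S.exists_dualNorm_ne_top w
  exact (hF (max p q)).1 z w (hp _ (le_max_left _ _)) (hq _ (le_max_right _ _))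

/-- The derivative of `F` in the direction `w`. -/
noncomputable def dirDeriv (w : N →L[ℝ] ℂ) (F : (N →L[ℝ] ℂ) → ℂ) (z : N →L[ℝ] ℂ) : ℂ :=
  deriv (fun t : ℂ => F (z + t • w)) 0

/-- Near every point, the values of `F` along lines of direction `w` are uniformly bounded. -/
theorem exists_bound_lines {F : (N →L[ℝ] ℂ) → ℂ} (hF : F ∈ S.Entire) {p : ℕ}
    {z w : N →L[ℝ] ℂ} (hz : S.dualNorm p z ≠ ∞) (hw : S.dualNorm p w ≠ ∞) :
    ∃ r : ℝ, 0 < r ∧ ∃ ρ : ℝ, 0 < ρ ∧ ∃ M : ℝ, ∀ y, S.dualNorm p y ≤ ENNReal.ofReal r →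
      ∀ t : ℂ, ‖t‖ < ρ → ‖F (z + y + t • w)‖ ≤ M := by
  obtain ⟨r, hr, M, hM⟩ := (hF p).2 z hz
  have hW : 0 < 1 + (S.dualNorm p w).toReal := by positivity
  refine ⟨r / 2, by positivity, r / 2 / (1 + (S.dualNorm p w).toReal), by positivity, M,
    fun y hy t ht => ?_⟩
  rw [add_assoc]
  refine hM _ ((S.dualNorm_add_le p y _).trans ?_)
  rw [← add_halves r, ENNReal.ofReal_add (by positivity) (by positivity)]
  refine add_le_add hy ?_
  rw [← ENNReal.ofReal_toReal (S.smul_ne_top' t hw), toReal_dualNorm_smul]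
  refine ENNReal.ofReal_le_ofReal ?_
  rw [lt_div_iff₀ hW] at ht
  exact (mul_le_mul_of_nonneg_left (le_add_of_nonneg_left zero_le_one) (norm_nonneg t)).trans ht.le

theorem exists_pos_norm_lt (p : ℕ) {v : N →L[ℝ] ℂ} (hv : S.dualNorm p v ≠ ∞) {r : ℝ}
    (hr : 0 < r) : ∃ δ : ℝ, 0 < δ ∧ ∀ s : ℂ, ‖s‖ < δ →
      S.dualNorm p (s • v) ≤ ENNReal.ofReal r := by
  have hW : 0 < 1 + (S.dualNorm p v).toReal := by positivity
  refine ⟨r / (1 + (S.dualNorm p v).toReal), by positivity, fun s hs => ?_⟩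
  rw [← ENNReal.ofReal_toReal (S.smul_ne_top' s hv), toReal_dualNorm_smul]
  refine ENNReal.ofReal_le_ofReal ?_
  rw [lt_div_iff₀ hW] at hs
  exact (mul_le_mul_of_nonneg_left (le_add_of_nonneg_left zero_le_one) (norm_nonneg s)).trans hs.le

/-- Near `s₀` the derivative in direction `w` is a uniform limit of difference quotients, each of
which is holomorphic in `s`. Uniformity comes from the local bound on `F`. -/
theorem differentiable_dirDeriv {F : (N →L[ℝ] ℂ) → ℂ} (hF : F ∈ S.Entire)
    (w z v : N →L[ℝ] ℂ) : Differentiable ℂ fun s : ℂ => dirDeriv w F (z + s • v) := by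
  intro s₀
  obtain ⟨p, hp⟩ := S.exists_forall_dualNorm_ne_top ![z, v, w]
  have hz : S.dualNorm p z ≠ ∞ := hp p le_rfl 0
  have hv : S.dualNorm p v ≠ ∞ := hp p le_rfl 1
  have hw : S.dualNorm p w ≠ ∞ := hp p le_rfl 2
  obtain ⟨r, hr, ρ, hρ, M, hM⟩ := exists_bound_lines hF (S.add_ne_top' hz (S.smul_ne_top' s₀ hv)) hw
  obtain ⟨δ, hδ, hδr⟩ := exists_pos_norm_lt p hv hr
  have hline : ∀ s : ℂ, z + s₀ • v + (s - s₀) • v = z + s • v := fun s => by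
    rw [add_assoc, ← add_smul s₀ (s - s₀) v, add_sub_cancel]
  have hb : ∀ s, ‖s - s₀‖ < δ → ∀ t : ℂ, ‖t‖ < ρ → ‖F (z + s • v + t • w)‖ ≤ M := by
    intro s hs t ht
    rw [← hline s]
    exact hM _ (hδr _ hs) t ht
  have hU : TendstoUniformlyOn
      (fun (h : ℂ) (s : ℂ) => dslope (fun t : ℂ => F (z + s • v + t • w)) 0 h)
      (fun s => dirDeriv w F (z + s • v)) (nhdsWithin 0 {0}ᶜ) (Metric.ball s₀ δ) := by
    rw [Metric.tendstoUniformlyOn_iff]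
    intro e he
    filter_upwards [mem_nhdsWithin_of_mem_nhds ((tendsto_const_mul_norm (4 * M / ρ / ρ)).eventually
      (gt_mem_nhds he)),
      mem_nhdsWithin_of_mem_nhds (Metric.ball_mem_nhds (0 : ℂ) hρ)] with h h1 h2 s hs
    rw [dist_comm, dist_eq_norm]
    exact (norm_dslope_sub_deriv_le (differentiable_line hF _ w)
      (hb s (mem_ball_iff_norm.1 hs)) (mem_ball_zero_iff.1 h2)).trans_lt h1
  have hD := hU.tendstoLocallyUniformlyOn.differentiableOn (U := Metric.ball s₀ δ) ?_
    Metric.isOpen_ball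
  · exact hD.differentiableAt (Metric.ball_mem_nhds s₀ hδ)
  · filter_upwards [self_mem_nhdsWithin] with h hh
    have h0 : h ≠ 0 := hh
    have h1 : (fun s : ℂ => dslope (fun t : ℂ => F (z + s • v + t • w)) 0 h) =
        fun s : ℂ => h⁻¹ * (F (z + h • w + s • v) - F (z + s • v)) := by
      ext s
      have h2 : (0 : ℂ) • w = 0 := zero_smul ℂ w
      rw [dslope_of_ne _ h0, slope_def_module, h2, add_zero, sub_zero, smul_eq_mul,
        add_right_comm]
    rw [h1]
    exact (((differentiable_line hF (z + h • w) v).sub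
      (differentiable_line hF z v)).const_mul _).differentiableOn

theorem dirDeriv_mem {F : (N →L[ℝ] ℂ) → ℂ} (hF : F ∈ S.Entire) (w : N →L[ℝ] ℂ) :
    dirDeriv w F ∈ S.Entire := by
  refine fun p => ⟨fun z v _ _ => differentiable_dirDeriv hF w z v, fun z hz => ?_⟩
  -- The direction `w` need not lie in `H_{-p}`, so the bound on `F` is taken in the larger space
  -- with index `max p q`, whose norm is the smaller one.
  obtain ⟨q, hq⟩ := S.exists_dualNorm_ne_top w
  obtain ⟨r, hr, ρ, hρ, M, hM⟩ := exists_bound_lines hF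
    (ne_top_of_le_ne_top hz (S.dualNorm_anti (le_max_left p q) z)) (hq _ (le_max_right p q))
  refine ⟨r, hr, 2 * M / ρ, fun y hy => ?_⟩
  have h := norm_dslope_le (differentiable_line hF (z + y) w)
    (hM y ((S.dualNorm_anti (le_max_left p q) y).trans hy)) (t := 0) (by rwa [norm_zero])
  rwa [dslope_same] at h

/-- The quotient along `v + w` at `z` is the one along `v` at `z` plus the one along `w` at the
moved point `z + t • v`. The latter differs from `dirDeriv w F (z + t • v)` by `O(|t|)`, and this
derivative is continuous in `t`. -/
theorem dirDeriv_add {F : (N →L[ℝ] ℂ) → ℂ} (hF : F ∈ S.Entire) (v w : N →L[ℝ] ℂ) :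
    dirDeriv (v + w) F = dirDeriv v F + dirDeriv w F := by
  ext z
  obtain ⟨p, hp⟩ := S.exists_forall_dualNorm_ne_top ![z, v, w]
  have hz : S.dualNorm p z ≠ ∞ := hp p le_rfl 0
  have hv : S.dualNorm p v ≠ ∞ := hp p le_rfl 1
  have hw : S.dualNorm p w ≠ ∞ := hp p le_rfl 2
  obtain ⟨r, hr, ρ, hρ, M, hM⟩ := exists_bound_lines hF hz hw
  obtain ⟨δ, hδ, hδr⟩ := exists_pos_norm_lt p hv hr
  -- the increment splits into an increment along `w` and one along `v`
  set d : ℂ → ℂ := fun t => dslope (fun s : ℂ => F (z + t • v + s • w)) 0 t with hd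
  have hlimD : Filter.Tendsto (fun t : ℂ => dirDeriv w F (z + t • v)) (nhdsWithin 0 {0}ᶜ)
      (nhds (dirDeriv w F z)) := by
    have h := (differentiable_dirDeriv hF w z v).continuous.tendsto 0
    have h0 : (0 : ℂ) • v = 0 := zero_smul ℂ v
    rw [h0, add_zero] at h
    exact h.mono_left nhdsWithin_le_nhds
  have hdiff : Filter.Tendsto (fun t : ℂ => d t - dirDeriv w F (z + t • v))
      (nhdsWithin 0 {0}ᶜ) (nhds 0) := by
    refine squeeze_zero_norm' ?_
      ((tendsto_const_mul_norm (4 * M / ρ / ρ)).mono_left nhdsWithin_le_nhds)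
    filter_upwards [mem_nhdsWithin_of_mem_nhds (Metric.ball_mem_nhds (0 : ℂ) hρ),
      mem_nhdsWithin_of_mem_nhds (Metric.ball_mem_nhds (0 : ℂ) hδ)] with t h1 h2
    exact norm_dslope_sub_deriv_le (differentiable_line hF _ w)
      (hM _ (hδr _ (mem_ball_zero_iff.1 h2))) (mem_ball_zero_iff.1 h1)
  have hd' : Filter.Tendsto d (nhdsWithin 0 {0}ᶜ) (nhds (dirDeriv w F z)) := by
    simpa using hdiff.add hlimD
  have hv' := hasDerivAt_iff_tendsto_slope.1 (differentiable_line hF z v 0).hasDerivAt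
  have h : HasDerivAt (fun t : ℂ => F (z + t • (v + w))) (dirDeriv v F z + dirDeriv w F z) 0 := by
    rw [hasDerivAt_iff_tendsto_slope]
    refine (hv'.add hd').congr' ?_
    filter_upwards [self_mem_nhdsWithin] with t ht
    have h0 : ∀ u : N →L[ℝ] ℂ, (0 : ℂ) • u = 0 := fun u => zero_smul ℂ u
    have h1 : z + t • (v + w) = z + t • v + t • w := by rw [add_assoc, ← smul_add t v w]
    simp only [hd]
    rw [dslope_of_ne _ ht]
    simp only [slope_def_module, h0, h1, add_zero, sub_zero, smul_eq_mul]
    ring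
  exact h.deriv

theorem dirDeriv_smul {F : (N →L[ℝ] ℂ) → ℂ} (hF : F ∈ S.Entire) (c : ℂ) (w : N →L[ℝ] ℂ) :
    dirDeriv (c • w) F = c • dirDeriv w F := by
  ext z
  have h1 : ∀ t : ℂ, z + t • c • w = z + (t * c) • w := fun t => by rw [smul_smul]
  have h2 : HasDerivAt (fun t : ℂ => F (z + t • w)) (dirDeriv w F z) (0 * c) := by
    rw [zero_mul]
    exact (differentiable_line hF z w 0).hasDerivAt
  have h3 := h2.comp 0 ((hasDerivAt_id (0 : ℂ)).mul_const c)
  rw [one_mul, mul_comm] at h3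
  simp only [dirDeriv, h1]
  exact h3.deriv

/-- The directional derivatives as operators on entire functions. -/
noncomputable def derivOp (S : NuclearNorms N) : (N →L[ℝ] ℂ) →ₗ[ℂ] Module.End ℂ S.Entire where
  toFun w :=
    { toFun := fun F => ⟨dirDeriv w F.1, dirDeriv_mem F.2 w⟩
      map_add' := fun F G => Subtype.ext <| funext fun z =>
        deriv_add (differentiable_line F.2 z w 0) (differentiable_line G.2 z w 0)
      map_smul' := fun c F => Subtype.ext <| funext fun z =>
        deriv_const_mul c (differentiable_line F.2 z w 0) }
  map_add' v w := LinearMap.ext fun F => Subtype.ext (dirDeriv_add F.2 v w)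
  map_smul' c w := LinearMap.ext fun F => Subtype.ext (dirDeriv_smul F.2 c w)

/-! ### Taylor kernels of entire functions and their norms -/

theorem iteratedDeriv_line (z : N →L[ℝ] ℂ) (n : ℕ) (F : S.Entire) (t : ℂ) :
    iteratedDeriv n (fun t : ℂ => F.1 (t • z)) t = ((S.derivOp z ^ n) F).1 (t • z) := by
  induction n generalizing F with
  | zero => simp
  | succ n ih =>
    have h : deriv (fun t : ℂ => F.1 (t • z)) = fun t : ℂ => (S.derivOp z F).1 (t • z) := by
      ext s
      have h1 := deriv_comp_const_add (f := fun t : ℂ => F.1 (t • z)) s 0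
      rw [add_zero] at h1
      rw [← h1]
      change _ = deriv (fun t : ℂ => F.1 (s • z + t • z)) 0
      congr 1
      ext t
      exact congrArg F.1 (add_smul s t z)
    rw [iteratedDeriv_succ', h, ih, pow_succ]
    rfl

/-- The derivatives of `F` at zero as multilinear forms. -/
noncomputable def derivForm (F : S.Entire) (n : ℕ) :
    MultilinearMap ℂ (fun _ : Fin n => N →L[ℝ] ℂ) ℂ :=
  ((LinearMap.proj 0 ∘ₗ S.Entire.subtype) ∘ₗ LinearMap.applyₗ F).compMultilinearMap
    ((MultilinearMap.mkPiAlgebraFin ℂ n (Module.End ℂ S.Entire)).compLinearMap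
      fun _ => S.derivOp)

theorem derivForm_diag (F : S.Entire) (n : ℕ) (z : N →L[ℝ] ℂ) :
    derivForm F n (fun _ => z) = iteratedDeriv n (fun t : ℂ => F.1 (t • z)) 0 := by
  have h : (0 : ℂ) • z = 0 := zero_smul ℂ z
  rw [iteratedDeriv_line, h]
  simp [derivForm]

/-- The Taylor kernels of an entire function at zero. -/
noncomputable def taylorKernel (F : S.Entire) (n : ℕ) :
    MultilinearMap ℂ (fun _ : Fin n => N →L[ℝ] ℂ) ℂ :=
  -- One factor is the Taylor coefficient, the other the average over permutations. Symmetrizing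
  -- makes it unnecessary to show that the directional derivatives commute, and it does not change
  -- the diagonal.
  ((n.factorial : ℂ)⁻¹ * (n.factorial : ℂ)⁻¹) •
    ∑ σ : Equiv.Perm (Fin n), (derivForm F n).domDomCongr σ

theorem taylorKernel_diag (F : S.Entire) (n : ℕ) (z : N →L[ℝ] ℂ) :
    taylorKernel F n (fun _ => z) =
      (n.factorial : ℂ)⁻¹ * iteratedDeriv n (fun t : ℂ => F.1 (t • z)) 0 := by
  have h0 : (n.factorial : ℂ) ≠ 0 := by exact_mod_cast n.factorial_ne_zero
  have h : taylorKernel F n (fun _ => z) = ((n.factorial : ℂ)⁻¹ * (n.factorial : ℂ)⁻¹) *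
      ∑ _σ : Equiv.Perm (Fin n), derivForm F n fun _ => z := by
    simp [taylorKernel]
  rw [h, Finset.sum_const, Finset.card_univ, Fintype.card_perm, Fintype.card_fin, nsmul_eq_mul,
    mul_assoc, inv_mul_cancel_left₀ h0, derivForm_diag]

theorem taylorKernel_symm (F : S.Entire) (n : ℕ) (τ : Equiv.Perm (Fin n))
    (v : Fin n → (N →L[ℝ] ℂ)) : taylorKernel F n (v ∘ τ) = taylorKernel F n v := by
  have h : ∀ v, taylorKernel F n v = ((n.factorial : ℂ)⁻¹ * (n.factorial : ℂ)⁻¹) *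
      ∑ σ : Equiv.Perm (Fin n), derivForm F n fun i => v (σ i) := fun v => by
    simp [taylorKernel]
  rw [h, h]
  congr 1
  exact Equiv.sum_comp (Equiv.mulLeft τ) fun σ : Equiv.Perm (Fin n) => derivForm F n fun i => v (σ i)

theorem hasSum_taylorKernel (F : S.Entire) (z : N →L[ℝ] ℂ) :
    HasSum (fun n => taylorKernel F n fun _ => z) (F.1 z) := by
  have hd : Differentiable ℂ fun t : ℂ => F.1 (t • z) := by
    simpa using differentiable_line F.2 0 z
  have h := Complex.hasSum_taylorSeries_of_entire hd 0 1
  simp only [one_smul, sub_zero, one_pow] at h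
  refine h.congr_fun fun n => ?_
  exact taylorKernel_diag F n z

/-- Cauchy's estimate for `t ↦ F(t y)` on the circle `|t| = 2^l`: there `2^{-l} |t y|_{-p} =
|y|_{-p} ≤ n`, so `|F(t y)|` is at most the growth norm times `eⁿ`. -/
theorem norm_taylorKernel_diag_le (F : S.Entire) (p l n : ℕ) (hF : S.growthNorm p l F.1 ≠ ∞)
    {y : N →L[ℝ] ℂ} (hy : S.dualNorm p y ≠ ∞) (hyn : (S.dualNorm p y).toReal ≤ n) :
    ‖taylorKernel F n fun _ => y‖ ≤
      (S.growthNorm p l F.1).toReal * (Real.exp 1 * 2⁻¹ ^ l) ^ n := by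
  have hd : Differentiable ℂ fun t : ℂ => F.1 (t • y) := by
    simpa using differentiable_line F.2 0 y
  have hb : ∀ z, S.dualNorm p z ≠ ∞ → ‖F.1 z‖ ≤ (S.growthNorm p l F.1).toReal *
      Real.exp ((2 : ℝ)⁻¹ ^ l * (S.dualNorm p z).toReal) := by
    intro z hz
    have h : ‖F.1 z‖ₑ * ENNReal.ofReal (Real.exp (-((2 : ℝ)⁻¹ ^ l * (S.dualNorm p z).toReal))) ≤
        S.growthNorm p l F.1 := le_iSup₂_of_le z hz le_rfl
    have h2 := ENNReal.toReal_mono hF h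
    rw [ENNReal.toReal_mul, toReal_enorm, ENNReal.toReal_ofReal (Real.exp_pos _).le, Real.exp_neg,
      ← div_eq_mul_inv, div_le_iff₀ (Real.exp_pos _)] at h2
    exact h2
  have h2l : (0 : ℝ) < 2 ^ l := by positivity
  have h := Complex.norm_iteratedDeriv_le_of_forall_mem_sphere_norm_le (c := 0) n h2l
    hd.diffContOnCl (C := (S.growthNorm p l F.1).toReal * Real.exp n) fun t ht => ?_
  · rw [taylorKernel_diag, norm_mul, norm_inv, Complex.norm_natCast]
    have h0 : (0 : ℝ) < n.factorial := by exact_mod_cast n.factorial_pos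
    rw [inv_mul_le_iff₀ h0]
    refine h.trans_eq ?_
    rw [mul_pow, ← Real.exp_nat_mul, mul_one, inv_pow, inv_pow]
    ring
  · refine (hb _ (S.smul_ne_top' t hy)).trans (mul_le_mul_of_nonneg_left (Real.exp_le_exp.2 ?_)
      ENNReal.toReal_nonneg)
    rw [toReal_dualNorm_smul, mem_sphere_zero_iff_norm.1 ht, inv_pow,
      inv_mul_cancel_left₀ h2l.ne']
    exact hyn

/-- The Hilbert–Schmidt norms of the Taylor kernels are controlled by the growth of `F`. -/
theorem exists_hsNorm_taylorKernel_le (S : NuclearNorms N) (p : ℕ) : ∃ p' : ℕ, ∃ C : ℝ, 0 < C ∧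
    ∀ (F : S.Entire) (l n : ℕ), S.growthNorm p' l F.1 ≠ ∞ →
      S.hsNorm p (taylorKernel F n) ≤ ENNReal.ofReal
        ((S.growthNorm p' l F.1).toReal * (C * 2⁻¹ ^ l) ^ n / n.factorial) := by
  obtain ⟨p', -, C, hC, h⟩ := S.exists_hsNorm_le p
  refine ⟨p', 2 * Real.exp 1 * C, by positivity, fun F l n hF => ?_⟩
  refine (h n (taylorKernel F n) (2 ^ n / n.factorial * ((S.growthNorm p' l F.1).toReal *
    (Real.exp 1 * 2⁻¹ ^ l) ^ n)) (by positivity) fun v hv => ?_).trans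
    (ENNReal.ofReal_le_ofReal (le_of_eq ?_))
  · exact S.norm_le_of_diag p' _ (taylorKernel_symm F n)
      (fun y hy hyn => norm_taylorKernel_diag_le F p' l n hF hy hyn) v hv
  · rw [mul_pow, mul_pow, mul_pow, mul_pow]
    ring

/-- The weighted norms of the Taylor kernels are controlled by the growth of `F`. -/
theorem exists_seqNorm_taylorKernel_le (S : NuclearNorms N) (p q : ℕ) : ∃ p' l : ℕ,
    ∀ F : S.Entire, S.growthNorm p' l F.1 ≠ ∞ →
      S.seqNorm p q (fun n => taylorKernel F n) ≤ 2 * S.growthNorm p' l F.1 := by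
  obtain ⟨p', C, hC, h⟩ := S.exists_hsNorm_taylorKernel_le p
  -- This `l` gives `C 2^{-l} 2^q ≤ 1/2`; the factorials cancel, and the `n`-th term of the weighted
  -- sum is at most `G² 2^{-n}`.
  obtain ⟨l, hl⟩ := pow_unbounded_of_one_lt (C * 2 ^ q * 2) (one_lt_two (α := ℝ))
  refine ⟨p', l, fun F hF => ?_⟩
  obtain ⟨G, hG⟩ : ∃ G, G = (S.growthNorm p' l F.1).toReal := ⟨_, rfl⟩
  have hG0 : 0 ≤ G := hG ▸ ENNReal.toReal_nonneg
  have hx : C * 2⁻¹ ^ l * 2 ^ q ≤ 2⁻¹ := by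
    have h2l : (0 : ℝ) < 2 ^ l := by positivity
    rw [inv_pow, mul_right_comm, ← div_eq_mul_inv, div_le_iff₀ h2l]
    linarith
  have h1 : ∀ n : ℕ, (n.factorial : ℝ≥0∞) ^ 2 * 2 ^ (n * q) * S.hsNorm p (taylorKernel F n) ^ 2 ≤
      ENNReal.ofReal (G ^ 2 * 2⁻¹ ^ n) := by
    intro n
    have h0 : (0 : ℝ) < n.factorial := by exact_mod_cast n.factorial_pos
    have h2 : (n.factorial : ℝ≥0∞) ^ 2 * 2 ^ (n * q) * ENNReal.ofReal
        (G * (C * 2⁻¹ ^ l) ^ n / n.factorial) ^ 2 = ENNReal.ofReal ((n.factorial : ℝ) ^ 2 *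
          2 ^ (n * q) * (G * (C * 2⁻¹ ^ l) ^ n / n.factorial) ^ 2) := by
      rw [ENNReal.ofReal_mul (by positivity), ENNReal.ofReal_mul (by positivity),
        ENNReal.ofReal_pow (by positivity), ENNReal.ofReal_pow (by positivity),
        ENNReal.ofReal_pow (by positivity), ENNReal.ofReal_natCast, ENNReal.ofReal_ofNat]
    refine (mul_le_mul_right (pow_le_pow_left' (hG ▸ h F l n hF) 2) _).trans ?_
    rw [h2]
    refine ENNReal.ofReal_le_ofReal ?_
    have h3 : (C * 2⁻¹ ^ l) ^ 2 * 2 ^ q ≤ (2 : ℝ)⁻¹ := by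
      have h4 : C * 2⁻¹ ^ l ≤ 1 := by
        refine le_trans ?_ (hx.trans (by norm_num))
        exact le_mul_of_one_le_right (by positivity) (one_le_pow₀ (by norm_num))
      calc _ = (C * 2⁻¹ ^ l) * (C * 2⁻¹ ^ l * 2 ^ q) := by ring
        _ ≤ 1 * 2⁻¹ := mul_le_mul h4 hx (by positivity) zero_le_one
        _ = _ := one_mul _
    calc _ = G ^ 2 * ((C * 2⁻¹ ^ l) ^ 2 * 2 ^ q) ^ n := by
          rw [mul_pow _ (2 ^ q), ← pow_mul, ← pow_mul, mul_comm n q, mul_comm 2 n, pow_mul _ n 2]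
          field_simp
      _ ≤ _ := mul_le_mul_of_nonneg_left (pow_le_pow_left₀ (by positivity) h3 n) (by positivity)
  -- The geometric sum is `2 G²`, bounded generously by `(2 G)²` to obtain the constant `2`.
  have h5 : ∑' n : ℕ, ENNReal.ofReal (G ^ 2 * 2⁻¹ ^ n) ≤ ENNReal.ofReal (2 * G) ^ (2 : ℝ) := by
    rw [← ENNReal.ofReal_tsum_of_nonneg (fun n => by positivity) (summable_geometric_half _),
      tsum_mul_left, tsum_geometric_of_lt_one (by norm_num) (by norm_num), ENNReal.rpow_two,
      ← ENNReal.ofReal_pow (by positivity)]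
    refine ENNReal.ofReal_le_ofReal ?_
    norm_num
    nlinarith [sq_nonneg G]
  refine (ENNReal.rpow_le_rpow ((ENNReal.tsum_le_tsum h1).trans h5) (by norm_num)).trans ?_
  rw [← ENNReal.rpow_mul]
  norm_num
  rw [hG, ENNReal.ofReal_toReal hF]

end NuclearNorms

end NonGaussian

namespace NonGaussian

namespace NuclearNorms

variable {N : Type*} [AddCommGroup N] [Module ℝ N] [TopologicalSpace N] {S : NuclearNorms N}
variable {μ : Measure (N →L[ℝ] ℝ)} {p₀ : ℕ} {ε K : ℝ}

/-! ## The convolution as a topological isomorphism -/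

/-- An entire function on `N'_ℂ` is determined by its values on `N'`. -/
theorem eq_zero_of_toComplex {F : (N →L[ℝ] ℂ) → ℂ} (hF : F ∈ S.Entire)
    (h : ∀ x : N →L[ℝ] ℝ, F (toComplex x) = 0) : F = 0 := by
  ext z
  -- Splitting `z = x + iy` with `x, y ∈ N'`, the entire function `t ↦ F(x + t y)` vanishes at the
  -- real points `1 / (n + 1)`, which accumulate at `0`; hence it vanishes at `t = i`.
  have hz : z = toComplex (Complex.reCLM.comp z) + Complex.I • toComplex (Complex.imCLM.comp z) := by
    ext ξ
    simp [toComplex_apply, mul_comm Complex.I]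
  have hd := differentiable_line hF (toComplex (Complex.reCLM.comp z))
    (toComplex (Complex.imCLM.comp z))
  have hlim : Filter.Tendsto (fun n : ℕ => ((1 / ((n : ℝ) + 1) : ℝ) : ℂ)) Filter.atTop
      (nhdsWithin 0 {0}ᶜ) := by
    refine tendsto_nhdsWithin_iff.2 ⟨?_, Filter.Eventually.of_forall fun n => ?_⟩
    · have h1 := (Complex.continuous_ofReal.tendsto 0).comp
        (tendsto_one_div_add_atTop_nhds_zero_nat (𝕜 := ℝ))
      rwa [Complex.ofReal_zero] at h1
    · have h1 : (1 / ((n : ℝ) + 1) : ℝ) ≠ 0 := by positivity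
      exact Complex.ofReal_ne_zero.2 h1
  have hfun : (fun t : ℂ => F (toComplex (Complex.reCLM.comp z) +
      t • toComplex (Complex.imCLM.comp z))) = fun _ => 0 := by
    refine AnalyticOnNhd.eq_of_frequently_eq (𝕜 := ℂ) (z₀ := 0) (fun t _ => hd.analyticAt t)
      (fun t _ => analyticAt_const) (hlim.frequently (Filter.Frequently.of_forall fun n => ?_))
    have h1 : toComplex (Complex.reCLM.comp z) + ((1 / ((n : ℝ) + 1) : ℝ) : ℂ) •
        toComplex (Complex.imCLM.comp z) = toComplex (Complex.reCLM.comp z +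
          (1 / ((n : ℝ) + 1) : ℝ) • Complex.imCLM.comp z) := by
      ext ξ
      simp [toComplex_apply]
    rw [h1, h]
  rw [hz]
  exact congrFun hfun Complex.I

theorem EMin_le_Entire : S.EMin ≤ S.Entire := fun _ hF => hF.1

theorem ExpMoment.conv_injective [IsProbabilityMeasure μ] (H : S.ExpMoment μ p₀ ε K)
    {φ ψ : S.TestSpace μ} (h : S.conv φ = S.conv ψ) : φ = ψ := by
  refine Subtype.ext (funext fun n => Subtype.ext (DFunLike.coe_injective ?_))
  rw [← H.taylorForm_conv φ n, ← H.taylorForm_conv ψ n, h]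

/-- For `y ∈ N'` the convolution at `y` only involves values at `x + y ∈ N'`. So the two
convolutions agree on `N'`, hence everywhere, and `ExpMoment.conv_injective` applies. -/
theorem ExpMoment.testFun_injective [IsProbabilityMeasure μ] (H : S.ExpMoment μ p₀ ε K)
    {φ ψ : S.TestSpace μ}
    (h : ∀ x : N →L[ℝ] ℝ, S.testFun φ (toComplex x) = S.testFun ψ (toComplex x)) : φ = ψ := by
  refine H.conv_injective (sub_eq_zero.1 (eq_zero_of_toComplex (S := S) (S.Entire.sub_mem
    (EMin_le_Entire (H.conv_mem_eMin φ)) (EMin_le_Entire (H.conv_mem_eMin ψ))) fun y => ?_))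
  refine sub_eq_zero.2 (integral_congr_ae (Filter.Eventually.of_forall fun x => ?_))
  change S.testFun φ (toComplex x + toComplex y) = S.testFun ψ (toComplex x + toComplex y)
  rw [← toComplex_add]
  exact h _

/-- The convolution as a linear map. -/
noncomputable def convMap [IsProbabilityMeasure μ] (H : S.ExpMoment μ p₀ ε K) :
    S.TestSpace μ →ₗ[ℂ] S.EMin where
  toFun φ := ⟨S.conv φ, H.conv_mem_eMin φ⟩
  -- Linearity is read off from the Taylor expansion, whose terms are linear in the kernels.
  map_add' φ ψ := Subtype.ext <| funext fun z =>
    (H.hasSum_conv (φ + ψ) z).unique ((H.hasSum_conv φ z).add (H.hasSum_conv ψ z))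
  map_smul' c φ := Subtype.ext <| funext fun z =>
    (H.hasSum_conv (c • φ) z).unique ((H.hasSum_conv φ z).mul_left c)

theorem taylorKernel_mem (F : S.EMin) (n : ℕ) :
    taylorKernel ⟨F.1, EMin_le_Entire F.2⟩ n ∈ S.SymKernel n := by
  refine ⟨taylorKernel_symm _ n, fun p => ?_⟩
  obtain ⟨p', C, -, h⟩ := S.exists_hsNorm_taylorKernel_le p
  exact ne_top_of_le_ne_top ENNReal.ofReal_ne_top (h _ 0 n (F.2.2 p' 0))

/-- The test function whose kernels are the Taylor kernels of `F`. -/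
noncomputable def taylorTest (μ : Measure (N →L[ℝ] ℝ)) (F : S.EMin) : S.TestSpace μ :=
  ⟨fun n => ⟨taylorKernel ⟨F.1, EMin_le_Entire F.2⟩ n, taylorKernel_mem F n⟩, fun p q => by
    obtain ⟨p', l, h⟩ := S.exists_seqNorm_taylorKernel_le p q
    exact ne_top_of_le_ne_top (ENNReal.mul_ne_top ENNReal.ofNat_ne_top (F.2.2 p' l))
      (h ⟨F.1, EMin_le_Entire F.2⟩ (F.2.2 p' l))⟩

theorem convMap_taylorTest [IsProbabilityMeasure μ] (H : S.ExpMoment μ p₀ ε K) (F : S.EMin) :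
    convMap H (taylorTest μ F) = F :=
  Subtype.ext <| funext fun z => (H.hasSum_conv (taylorTest μ F) z).unique
    (hasSum_taylorKernel ⟨F.1, EMin_le_Entire F.2⟩ z)

/-- The convolution as a linear isomorphism. -/
noncomputable def convEquiv [IsProbabilityMeasure μ] (H : S.ExpMoment μ p₀ ε K) :
    S.TestSpace μ ≃ₗ[ℂ] S.EMin :=
  LinearEquiv.ofBijective (convMap H)
    ⟨fun _ _ h => H.conv_injective (congrArg Subtype.val h),
      fun F => ⟨taylorTest μ F, convMap_taylorTest H F⟩⟩

theorem convEquiv_symm_apply [IsProbabilityMeasure μ] (H : S.ExpMoment μ p₀ ε K) (F : S.EMin) :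
    (convEquiv H).symm F = taylorTest μ F :=
  (LinearEquiv.symm_apply_eq _).2 (convMap_taylorTest H F).symm

theorem continuous_convEquiv [IsProbabilityMeasure μ] (H : S.ExpMoment μ p₀ ε K) :
    Continuous (convEquiv H) := by
  refine WithSeminorms.continuous_of_isBounded S.testSpace_withSeminorms S.eMin_withSeminorms
    (convEquiv H).toLinearMap fun pl => ⟨{(pl.1, 2 * pl.2)}, 1, fun φ => ?_⟩
  rw [Finset.sup_singleton, one_smul]
  exact ENNReal.toReal_mono (φ.2 _ _) (H.growthNorm_conv_le φ pl.1 pl.2)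

theorem continuous_convEquiv_symm [IsProbabilityMeasure μ] (H : S.ExpMoment μ p₀ ε K) :
    Continuous (convEquiv H).symm := by
  refine WithSeminorms.continuous_of_isBounded S.eMin_withSeminorms S.testSpace_withSeminorms
    (convEquiv H).symm.toLinearMap fun pq => ?_
  obtain ⟨p', l, h⟩ := S.exists_seqNorm_taylorKernel_le pq.1 pq.2
  refine ⟨{(p', l)}, 2, fun F => ?_⟩
  rw [Finset.sup_singleton]
  have h1 := h ⟨F.1, EMin_le_Entire F.2⟩ (F.2.2 p' l)
  have h2 := ENNReal.toReal_mono (ENNReal.mul_ne_top ENNReal.ofNat_ne_top (F.2.2 p' l)) h1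
  rw [ENNReal.toReal_mul, ENNReal.toReal_ofNat] at h2
  change (S.testNorm pq.1 pq.2 ((convEquiv H).symm F)).toReal ≤
    2 * (S.growthNorm p' l F.1).toReal
  rw [convEquiv_symm_apply]
  exact h2

end NuclearNorms

end NonGaussian

/-! ### The main theorem -/

theorem mainTheorem4 {N : Type*} [AddCommGroup N] [Module ℝ N] [TopologicalSpace N]
    (S : NuclearNorms N) (μ : Measure (N →L[ℝ] ℝ)) [IsProbabilityMeasure μ]
    (hμ : IsAnalyticMeasure μ) :
    (∀ (n : ℕ) (z : N →L[ℝ] ℂ), S.IsAppell μ n z (S.appell μ n z)) ∧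
    (∀ (φ : S.TestSpace μ) (z : N →L[ℝ] ℂ),
      Summable (fun n => S.appell μ n z (φ.1 n)) ∧
      Integrable (fun x => S.testFun φ (toComplex x + z)) μ) ∧
    (∀ φ ψ : S.TestSpace μ,
      (∀ x : N →L[ℝ] ℝ, S.testFun φ (toComplex x) = S.testFun ψ (toComplex x)) → φ = ψ) ∧
    ∃ C : S.TestSpace μ ≃L[ℂ] S.EMin,
      (∀ (φ : S.TestSpace μ) (z : N →L[ℝ] ℂ), (C φ).1 z = S.conv φ z) ∧
      ∀ (p q : ℕ) (φ : S.TestSpace μ), S.kernelNorm p q (C φ) = S.testNorm p q φ := by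
  obtain ⟨p₀, ε, K, H⟩ := S.exists_expMoment hμ
  refine ⟨fun n z => ?_, fun φ z => ⟨H.summable_appell φ z, H.integrable_testFun φ z⟩,
    fun φ ψ h => H.testFun_injective h,
    { NuclearNorms.convEquiv H with
      continuous_toFun := NuclearNorms.continuous_convEquiv H
      continuous_invFun := NuclearNorms.continuous_convEquiv_symm H }, fun φ z => rfl,
    fun p q φ => ?_⟩
  · rw [H.appell_eq n z]
    exact H.isAppell_appellFun n z
  · exact congrArg (S.seqNorm p q) (funext fun n => H.taylorForm_conv φ n)
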